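/- For $g:\mathbb{R}\to\mathbb{C}$ put $\|g\|_{BMO(\mathbb{R})}=\sup_I \frac1{|I|}\int_I|g-g_I|\,dx$, the supremum being over all bounded intervals $I$ of positive length, where $g_I=\frac{1}{|I|}\int_I g$. For a measurable $b:\mathbb{R}^2\to\mathbb{C}$ write $b^y(x)=b(x,y)$ and $\|b\|_{BMO,\infty}=\operatorname{ess\,sup}_{y\in\mathbb{R}}\|b^y\|_{BMO(\mathbb{R})}$. Let $$H_\tau f(x,y)=\mathrm{p.v.}\int_{-\infty}^{\infty} f(x-t,y)\,\frac{dt}{t}=\lim_{\varepsilon\to0^+}\int_{|t|>\varepsilon} f(x-t,y)\,\frac{dt}{t}$$ be the Hilbert transform along horizontal lines, and $[b,H_\tau]f=b\,H_\tau f-H_\tau(bf)$. **Proposition.** Let $1<p<\infty$. There is a constant $C_p$, depending only on $p$, such that for every measurable $b:\mathbb{R}^2\to\mathbb{C}$ with $\|b\|_{BMO,\infty}<\infty$ the following holds. For every $f\in L^p(\mathbb{R}^2)$ the principal values defining $H_\tau f$ and $H_\tau(bf)$ exist almost everywhere (with absolutely convergent truncated integrals), and $f\mapsto[b,H_\tau]f$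 is a bounded linear operator on $L^p(\mathbb{R}^2)$ with $$\|[b,H_\tau]:L^p(\mathbb{R}^2)\to L^p(\mathbb{R}^2)\|\le C_p\,\|b\|_{BMO,\infty}.$$ -/

import Mathlib

open MeasureTheory Filter Topology
open scoped ENNReal NNReal

noncomputable section

/-- The mean oscillation norm on the line: the supremum over all bounded intervals `I = [r, s]`,
`r < s`, of the average over `I` of `|g - g_I|`, with `g_I` the average of `g` over `I`.
(For a.e.-measurable `g` that is not integrable on some `I` the value is `∞`.) -/
def bmoNorm (g : ℝ → ℂ) : ℝ≥0∞ :=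
  ⨆ (r : ℝ) (s : ℝ) (_ : r < s),
    ⨍⁻ x in Set.Icc r s, ‖g x - ⨍ u in Set.Icc r s, g u‖ₑ ∂volume

/-- The norm `‖ y ↦ ‖b(·, y)‖_BMO ‖_∞` of a function `b` on the plane. -/
def bmoInftyNorm (b : ℝ × ℝ → ℂ) : ℝ≥0∞ :=
  essSup (fun y : ℝ => bmoNorm (fun x : ℝ => b (x, y))) volume

/-- The truncated Hilbert transform `∫_{|t| > ε} g(x - t) dt / t`. -/
def truncHilbert (ε : ℝ) (g : ℝ → ℂ) (x : ℝ) : ℂ :=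
  ∫ t in {t : ℝ | ε < |t|}, g (x - t) / (t : ℂ)

/-- The principal value integral `p.v. ∫ g(x - t) dt / t` exists and is equal to `L`: all the
truncated integrals converge absolutely, and they tend to `L` as `ε ↓ 0`. -/
def HasHilbertPV (g : ℝ → ℂ) (x : ℝ) (L : ℂ) : Prop :=
  (∀ ε : ℝ, 0 < ε → IntegrableOn (fun t : ℝ => g (x - t) / (t : ℂ)) {t : ℝ | ε < |t|} volume) ∧
    Tendsto (fun ε : ℝ => truncHilbert ε g x) (𝓝[>] 0) (𝓝 L)

/-- The one-dimensional Hilbert transform `p.v. ∫ g(x - t) dt / t`. -/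
def hilbert (g : ℝ → ℂ) (x : ℝ) : ℂ :=
  limUnder (𝓝[>] (0 : ℝ)) (fun ε : ℝ => truncHilbert ε g x)

theorem HasHilbertPV.hilbert_eq {g : ℝ → ℂ} {x : ℝ} {L : ℂ} (h : HasHilbertPV g x L) :
    hilbert g x = L :=
  h.2.limUnder_eq

/-- The Hilbert transform along horizontal lines,
`H_τ f(x, y) = p.v. ∫ f(x - t, y) dt / t = (H f^y)(x)`. -/
def hilbertLine (f : ℝ × ℝ → ℂ) (z : ℝ × ℝ) : ℂ :=
  hilbert (fun x : ℝ => f (x, z.2)) z.1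

/-- The principal value defining `H_τ f` exists at the point `z`. -/
def HilbertLineExistsAt (f : ℝ × ℝ → ℂ) (z : ℝ × ℝ) : Prop :=
  ∃ L : ℂ, HasHilbertPV (fun x : ℝ => f (x, z.2)) z.1 L

/-- The commutator `[b, T] f = b T(f) - T(b f)`. -/
def multCommutator (b : ℝ × ℝ → ℂ) (T : (ℝ × ℝ → ℂ) → ℝ × ℝ → ℂ) (f : ℝ × ℝ → ℂ) :
    ℝ × ℝ → ℂ :=
  fun z => b z * T f z - T (fun w => b w * f w) z

end

/-! For almost every horizontal line the restriction of `b` has mean oscillation at most the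
essential supremum, and both the commutator and the `L^p` norm split over the lines. By Tonelli it
is enough to prove the one-dimensional theorem of Coifman, Rochberg and Weiss with a constant linear
in the oscillation `β`, and then to settle measurability in the plane.

On the line the singular kernel is replaced by the Cauchy kernels `1 / (t + i d)`, `d > 0`, which
are continuous and give absolutely convergent integrals. All bounds are uniform in `d`. For `L²`,
the square of the Cauchy operator at height `d` is `-2πi` times the one at height `2d`, and its
transpose is minus the operator at height `-d`. For real `f` the square norm thereby becomes a
pairing of `f` with a Poisson integral, whose kernel has mass `π`. The sharp maximal function
(`fefferman_stein`) gives `p > 2`, and duality gives `p < 2`.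

For the commutator, subtracting from `b` its average over an interval changes nothing.
John-Nirenberg and Hölder then bound the mean oscillation of the commutator over any interval by `K
β` times the sum of the maximal functions of exponent `s`, `1 < s < p`, of the Cauchy integral and
of `f`, taken at any point of the interval (`commutator_osc`). `fefferman_stein` turns this into an
`L^p` bound. It needs the commutator to be in `L^p` beforehand, so `b` is first cut off at a finite
height; the cut-off costs a fixed factor and is removed by Fatou's lemma.

It remains to let `d` tend to `0`. The Cauchy integrals of an `L^p` function converge in `L^p`. They
are, up to the factor `π`, the Poisson integrals of their limit, so they converge at its
Poisson-Lebesgue points, that is almost everywhere. The product `b f` need not be in `L^p`, but it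
is locally in `L^s` for some `s > 1`, and its distant part causes no difficulty. The truncated
Hilbert kernel differs from the Cauchy kernel of the same scale by an approximate identity up to a
constant, so principal values exist almost everywhere and equal the boundary value plus a fixed
multiple of the function. That multiple cancels in the commutator, and Fatou's lemma carries the
bound over. -/

open Metric

/-! ### Maximal function: weak type, Vitali covering and stopping intervals. -/

/-- The uncentred Hardy-Littlewood maximal function on the line. -/
noncomputable def hlMaximal (u : ℝ → ℝ≥0∞) (x : ℝ) : ℝ≥0∞ :=
  ⨆ (c : ℝ) (r : ℝ) (_ : x ∈ ball c r), (∫⁻ y in ball c r, u y) / ENNReal.ofReal (2 * r)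

theorem lt_maximal_iff {u : ℝ → ℝ≥0∞} {x : ℝ} {l : ℝ≥0∞} :
    l < hlMaximal u x ↔ ∃ c r, x ∈ ball c r ∧ l * ENNReal.ofReal (2 * r) < ∫⁻ y in ball c r, u y := by
  simp only [hlMaximal, lt_iSup_iff, exists_prop]
  refine exists_congr fun c => exists_congr fun r => and_congr_right fun hx => ?_
  have hr : 0 < r := pos_of_mem_ball hx
  rw [ENNReal.lt_div_iff_mul_lt]
  · left; simpa using hr
  · left; exact ENNReal.ofReal_ne_top

theorem lintegral_ball_le_maximal (u : ℝ → ℝ≥0∞) {x c r : ℝ} (hx : x ∈ ball c r) :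
    ∫⁻ y in ball c r, u y ≤ ENNReal.ofReal (2 * r) * hlMaximal u x := by
  by_contra! h
  have : hlMaximal u x < hlMaximal u x := lt_maximal_iff.2 ⟨c, r, hx, by rwa [mul_comm]⟩
  exact lt_irrefl _ this

theorem hlMaximal_le_iff {u : ℝ → ℝ≥0∞} {x : ℝ} {l : ℝ≥0∞} :
    hlMaximal u x ≤ l ↔ ∀ c r, x ∈ ball c r → ∫⁻ y in ball c r, u y ≤ l * ENNReal.ofReal (2 * r) := by
  rw [← not_lt, lt_maximal_iff]; push Not; rfl

/-- An interval that witnesses the inequality at one point witnesses it at all of its points. This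
is what the uncentred definition buys: measurability of the maximal function of an arbitrary `u`. -/
theorem isOpen_lt_maximal (u : ℝ → ℝ≥0∞) (l : ℝ≥0∞) : IsOpen {x | l < hlMaximal u x} := by
  rw [Metric.isOpen_iff]
  intro x hx
  obtain ⟨c, r, hxc, h⟩ := lt_maximal_iff.1 hx
  obtain ⟨e, he, hsub⟩ := Metric.isOpen_iff.1 isOpen_ball x hxc
  exact ⟨e, he, fun y hy => lt_maximal_iff.2 ⟨c, r, hsub hy, h⟩⟩

theorem measurable_maximal (u : ℝ → ℝ≥0∞) : Measurable (hlMaximal u) :=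
  measurable_of_Ioi fun l => (isOpen_lt_maximal u l).measurableSet

theorem maximal_mono {u v : ℝ → ℝ≥0∞} (h : ∀ᵐ x, u x ≤ v x) (x : ℝ) :
    hlMaximal u x ≤ hlMaximal v x := by
  refine hlMaximal_le_iff.2 fun c r hx => ?_
  rw [mul_comm]
  exact (lintegral_mono_ae (ae_restrict_of_ae h)).trans (lintegral_ball_le_maximal v hx)

theorem maximal_congr {u v : ℝ → ℝ≥0∞} (h : u =ᵐ[volume] v) : hlMaximal u = hlMaximal v :=
  funext fun x => le_antisymm (maximal_mono (h.mono fun _ h => h.le) x)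
    (maximal_mono (h.mono fun _ h => h.ge) x)

theorem ball_subset_lt_maximal {u : ℝ → ℝ≥0∞} {c r : ℝ} {l : ℝ≥0∞}
    (h : l * ENNReal.ofReal (2 * r) < ∫⁻ y in ball c r, u y) : ball c r ⊆ {x | l < hlMaximal u x} :=
  fun _ hx => lt_maximal_iff.2 ⟨c, r, hx, h⟩

/-- Vitali's covering lemma for open intervals. -/
theorem exists_countable_disjoint_balls {S : Set ℝ} (c r : ℝ → ℝ) (R : ℝ)
    (hpos : ∀ x ∈ S, 0 < r x) (hR : ∀ x ∈ S, r x ≤ R) :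
    ∃ T ⊆ S, T.Countable ∧ T.PairwiseDisjoint (fun a => ball (c a) (r a)) ∧
      ∀ a ∈ S, ∃ b ∈ T, ball (c a) (r a) ⊆ ball (c b) (6 * r b) := by
  obtain ⟨T, hTS, hd, hc⟩ :=
    -- The factor 5 for closed balls becomes 6, which leaves room to return to open ones.
    Vitali.exists_disjoint_subfamily_covering_enlargement_closedBall S c r R hR 5 (by norm_num)
  have hd' : T.PairwiseDisjoint (fun a => ball (c a) (r a)) :=
    fun a ha b hb hab => (hd ha hb hab).mono ball_subset_closedBall ball_subset_closedBall
  refine ⟨T, hTS, ?_, hd', fun a ha => ?_⟩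
  · exact hd'.countable_of_isOpen (fun a _ => isOpen_ball)
      fun a ha => nonempty_ball.2 (hpos a (hTS ha))
  · obtain ⟨b, hb, h⟩ := hc a ha
    refine ⟨b, hb, ball_subset_closedBall.trans (h.trans (closedBall_subset_ball ?_))⟩
    have := hpos b (hTS hb)
    linarith

theorem tsum_lintegral_ball_le {T : Set ℝ} {c r : ℝ → ℝ} (hT : T.Countable)
    (hd : T.PairwiseDisjoint (fun a => ball (c a) (r a))) (u : ℝ → ℝ≥0∞) :
    ∑' a : T, ∫⁻ y in ball (c a) (r a), u y ≤ ∫⁻ y, u y := by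
  rw [← lintegral_biUnion hT (fun _ _ => measurableSet_ball) hd]
  exact setLIntegral_le_lintegral _ _

theorem tsum_volume_ball_le {T : Set ℝ} {c r : ℝ → ℝ} (hT : T.Countable)
    (hd : T.PairwiseDisjoint (fun a => ball (c a) (r a))) {A : Set ℝ}
    (hA : ∀ a ∈ T, ball (c a) (r a) ⊆ A) :
    ∑' a : T, ENNReal.ofReal (2 * r a) ≤ volume A := by
  calc ∑' a : T, ENNReal.ofReal (2 * r a) = ∑' a : T, volume (ball (c a) (r a)) := by
        simp [Real.volume_ball]
    _ = volume (⋃ a ∈ T, ball (c a) (r a)) :=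
        (measure_biUnion hT hd fun _ _ => measurableSet_ball).symm
    _ ≤ volume A := measure_mono (Set.iUnion₂_subset hA)

theorem measure_le_tsum_of_cover {T : Set ℝ} (hT : T.Countable) {A : Set ℝ} {c R : ℝ → ℝ}
    (h : A ⊆ ⋃ a ∈ T, ball (c a) (R a)) :
    volume A ≤ ∑' a : T, ENNReal.ofReal (2 * R a) := by
  calc volume A ≤ volume (⋃ a ∈ T, ball (c a) (R a)) := measure_mono h
    _ ≤ ∑' a : T, volume (ball (c a) (R a)) := measure_biUnion_le _ hT _
    _ = _ := by simp [Real.volume_ball]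

/-- Supplies stopping radii when the supremum is not attained: a selection rule that succeeds at the
chosen radius fails at twice that radius and beyond. -/
theorem exists_near_sup {P : Set ℝ} (hne : P.Nonempty) (hb : BddAbove P) (hpos : ∀ r ∈ P, 0 < r) :
    ∃ r ∈ P, ∀ r' ∈ P, r' < 2 * r := by
  obtain ⟨r0, hr0⟩ := hne
  have h0 : 0 < sSup P := (hpos r0 hr0).trans_le (le_csSup hb hr0)
  obtain ⟨r, hr, h⟩ := exists_lt_of_lt_csSup ⟨r0, hr0⟩ (show sSup P / 2 < sSup P by linarith)
  exact ⟨r, hr, fun r' hr' => by have := le_csSup hb hr'; linarith⟩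

/-- The weak type `(1, 1)` inequality for the maximal function. -/
theorem maximal_weak_type (u : ℝ → ℝ≥0∞) (l : ℝ≥0∞) :
    l * volume {x | l < hlMaximal u x} ≤ 6 * ∫⁻ y, u y := by
  rcases eq_or_ne (∫⁻ y, u y) ∞ with hi | hi
  · simp [hi]
  rcases eq_or_ne l 0 with rfl | hl
  · simp
  rcases eq_or_ne l ∞ with rfl | hl'
  · simp
  have H : ∀ x ∈ {x | l < hlMaximal u x}, ∃ c r, x ∈ ball c r ∧
      l * ENNReal.ofReal (2 * r) < ∫⁻ y in ball c r, u y := fun x hx => lt_maximal_iff.1 hx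
  choose! c r hx h using H
  have hle : ∀ x ∈ {x | l < hlMaximal u x}, r x ≤ ((∫⁻ y, u y) / l).toReal := by
    intro x hx'
    have h1 := (h x hx').trans_le (setLIntegral_le_lintegral _ _)
    have h2 : ENNReal.ofReal (2 * r x) ≤ (∫⁻ y, u y) / l := by
      rw [ENNReal.le_div_iff_mul_le (Or.inl hl) (Or.inl hl'), mul_comm]; exact h1.le
    have h3 := (ENNReal.ofReal_le_iff_le_toReal (ENNReal.div_ne_top hi hl)).1 h2
    have := pos_of_mem_ball (hx x hx')
    linarith
  obtain ⟨T, hTS, hT, hd, hc⟩ := exists_countable_disjoint_balls c r _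
    (fun x hx' => pos_of_mem_ball (hx x hx')) hle
  have hcov : {x | l < hlMaximal u x} ⊆ ⋃ a ∈ T, ball (c a) (6 * r a) := by
    intro x hx'
    obtain ⟨b, hb, hs⟩ := hc x hx'
    exact Set.mem_biUnion hb (hs (hx x hx'))
  calc l * volume {x | l < hlMaximal u x}
      ≤ l * ∑' a : T, ENNReal.ofReal (2 * (6 * r a)) := by
        gcongr; exact measure_le_tsum_of_cover (R := fun a => 6 * r a) hT hcov
    _ = 6 * ∑' a : T, l * ENNReal.ofReal (2 * r a) := by
        have e : ∀ a : T, ENNReal.ofReal (2 * (6 * r a)) = 6 * ENNReal.ofReal (2 * r a) := by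
          intro a
          rw [show 2 * (6 * r a) = 6 * (2 * r a) by ring, ENNReal.ofReal_mul (by norm_num)]
          simp only [ENNReal.ofReal_ofNat]
        simp_rw [e, ENNReal.tsum_mul_left]
        ring
    _ ≤ 6 * ∑' a : T, ∫⁻ y in ball (c a) (r a), u y := by
        gcongr with a; exact (h a (hTS a.2)).le
    _ ≤ 6 * ∫⁻ y, u y := by gcongr; exact tsum_lintegral_ball_le hT hd u

/-- Stopping intervals for the maximal function, of almost maximal length. -/
theorem exists_stopping_balls (u : ℝ → ℝ≥0∞) (l : ℝ≥0∞) (hfin : volume {x | l < hlMaximal u x} ≠ ∞) :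
    ∃ (c r : ℝ → ℝ) (T : Set ℝ), T.Countable ∧
      T.PairwiseDisjoint (fun a => ball (c a) (r a)) ∧
      {x | l < hlMaximal u x} ⊆ ⋃ a ∈ T, ball (c a) (6 * r a) ∧
      ∀ a ∈ T, a ∈ ball (c a) (r a) ∧ ball (c a) (r a) ⊆ {x | l < hlMaximal u x} ∧
        ∀ c' r', 2 * r a ≤ r' → a ∈ ball c' r' →
          ∫⁻ y in ball c' r', u y ≤ l * ENNReal.ofReal (2 * r') := by
  -- A selected interval lies inside the level set, so its length is bounded by the finite measure
  -- of that set. Integrability of `u` is not required, as `u` will be the modulus of an `L^p`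
  -- function.
  have hbd : ∀ c r, l * ENNReal.ofReal (2 * r) < ∫⁻ y in ball c r, u y →
      r ≤ (volume {x | l < hlMaximal u x}).toReal := by
    intro c r h
    have h1 := measure_mono (μ := volume) (ball_subset_lt_maximal h)
    rw [Real.volume_ball, ENNReal.ofReal_le_iff_le_toReal hfin] at h1
    have : 0 ≤ (volume {x | l < hlMaximal u x}).toReal := ENNReal.toReal_nonneg
    linarith
  have H : ∀ x ∈ {x | l < hlMaximal u x}, ∃ c r, (x ∈ ball c r ∧
      l * ENNReal.ofReal (2 * r) < ∫⁻ y in ball c r, u y) ∧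
      ∀ c' r', 2 * r ≤ r' → x ∈ ball c' r' →
          ∫⁻ y in ball c' r', u y ≤ l * ENNReal.ofReal (2 * r') := by
    intro x hx
    let P : Set ℝ := {r | ∃ c, x ∈ ball c r ∧
      l * ENNReal.ofReal (2 * r) < ∫⁻ y in ball c r, u y}
    obtain ⟨c0, r0, h0⟩ := lt_maximal_iff.1 hx
    obtain ⟨r, ⟨c, hc⟩, hr⟩ := exists_near_sup (P := P) ⟨r0, c0, h0⟩
      ⟨_, fun r ⟨c, hc⟩ => hbd c r hc.2⟩ (fun r ⟨c, hc⟩ => pos_of_mem_ball hc.1)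
    refine ⟨c, r, hc, fun c' r' hr' hx' => ?_⟩
    by_contra! hcon
    exact absurd (hr r' ⟨c', hx', hcon⟩) (not_lt.2 hr')
  choose! c r h h' using H
  obtain ⟨T, hTS, hT, hd, hc⟩ := exists_countable_disjoint_balls c r _
    (fun x hx' => pos_of_mem_ball (h x hx').1) (fun x hx' => hbd _ _ (h x hx').2)
  refine ⟨c, r, T, hT, hd, ?_, fun a ha => ⟨(h a (hTS ha)).1,
    ball_subset_lt_maximal (h a (hTS ha)).2, h' a (hTS ha)⟩⟩
  intro x hx'
  obtain ⟨b, hb, hs⟩ := hc x hx'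
  exact Set.mem_biUnion hb (hs (h x hx').1)

/-! ### Layer-cake formulas and the strong type maximal inequality. -/

theorem lintegral_Ioo_rpow {p : ℝ} (hp : 0 < p) {a : ℝ} (ha : 0 ≤ a) :
    ∫⁻ t in Set.Ioo 0 a, ENNReal.ofReal (p * t ^ (p - 1)) = ENNReal.ofReal a ^ p := by
  have hi : IntervalIntegrable (fun t : ℝ => p * t ^ (p - 1)) volume 0 a :=
    (intervalIntegral.intervalIntegrable_rpow' (by linarith)).const_mul _
  rw [intervalIntegrable_iff_integrableOn_Ioo_of_le ha] at hi
  rw [← ofReal_integral_eq_lintegral_ofReal hi, ← integral_Ioc_eq_integral_Ioo,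
    ← intervalIntegral.integral_of_le ha, intervalIntegral.integral_const_mul,
    integral_rpow (Or.inl (by linarith)), ENNReal.ofReal_rpow_of_nonneg ha hp.le]
  · congr 1
    rw [sub_add_cancel, Real.zero_rpow hp.ne']
    field_simp
    simp
  · refine (ae_restrict_iff' measurableSet_Ioo).2 (Eventually.of_forall fun t ht => ?_)
    have := Real.rpow_nonneg ht.1.le (p - 1)
    positivity

theorem lintegral_Ioi_indicator_rpow {p : ℝ} (hp : 0 < p) (a : ℝ≥0∞) :
    ∫⁻ t in Set.Ioi (0 : ℝ), {t : ℝ | ENNReal.ofReal t < a}.indicator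
      (fun t => ENNReal.ofReal (p * t ^ (p - 1))) t = a ^ p := by
  have key : ∀ a : ℝ, 0 ≤ a → ∀ b : ℝ≥0∞, ENNReal.ofReal a ≤ b →
      ENNReal.ofReal a ^ p ≤ ∫⁻ t in Set.Ioi (0 : ℝ), {t : ℝ | ENNReal.ofReal t < b}.indicator
      (fun t => ENNReal.ofReal (p * t ^ (p - 1))) t := by
    intro a ha b hab
    rw [← lintegral_Ioo_rpow hp ha, ← lintegral_indicator measurableSet_Ioo,
      ← lintegral_indicator measurableSet_Ioi]
    refine lintegral_mono fun t => ?_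
    by_cases ht : t ∈ Set.Ioo 0 a
    · have h1 : t ∈ Set.Ioi (0 : ℝ) := ht.1
      have h2 : t ∈ {t : ℝ | ENNReal.ofReal t < b} :=
        ((ENNReal.ofReal_lt_ofReal_iff (ht.1.trans ht.2)).2 ht.2).trans_le hab
      rw [Set.indicator_of_mem ht, Set.indicator_of_mem h1, Set.indicator_of_mem h2]
    · rw [Set.indicator_of_notMem ht]; exact zero_le
  rcases eq_or_ne a ∞ with rfl | hfin
  · rw [ENNReal.top_rpow_of_pos hp, eq_top_iff]
    refine le_of_forall_lt fun c hc => ?_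
    lift c to ℝ≥0 using hc.ne
    have h1 := key (((c : ℝ) + 1) ^ p⁻¹) (by positivity) ∞ le_top
    rw [ENNReal.ofReal_rpow_of_nonneg (by positivity) hp.le, ← Real.rpow_mul (by positivity),
      inv_mul_cancel₀ hp.ne', Real.rpow_one] at h1
    refine lt_of_lt_of_le ?_ h1
    rw [← ENNReal.ofReal_coe_nnreal]
    exact (ENNReal.ofReal_lt_ofReal_iff (by positivity)).2 (by linarith)
  · refine le_antisymm ?_ ?_
    · conv_rhs => rw [← ENNReal.ofReal_toReal hfin]
      rw [← lintegral_Ioo_rpow hp ENNReal.toReal_nonneg, ← lintegral_indicator measurableSet_Ioo,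
        ← lintegral_indicator measurableSet_Ioi]
      refine lintegral_mono fun t => ?_
      by_cases h1 : t ∈ Set.Ioi (0 : ℝ)
      · rw [Set.indicator_of_mem h1]
        by_cases h2 : t ∈ {t : ℝ | ENNReal.ofReal t < a}
        · have h3 : t ∈ Set.Ioo 0 a.toReal :=
            ⟨h1, (ENNReal.ofReal_lt_iff_lt_toReal (le_of_lt h1) hfin).1 h2⟩
          rw [Set.indicator_of_mem h2, Set.indicator_of_mem h3]
        · rw [Set.indicator_of_notMem h2]; exact zero_le
      · rw [Set.indicator_of_notMem h1]; exact zero_le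
    · have := key a.toReal ENNReal.toReal_nonneg a (ENNReal.ofReal_toReal hfin).le
      rwa [ENNReal.ofReal_toReal hfin] at this

theorem measurableSet_lt_prod {u : ℝ → ℝ≥0∞} (hu : Measurable u) :
    MeasurableSet {z : ℝ × ℝ | ENNReal.ofReal z.2 < u z.1} :=
  measurableSet_lt (ENNReal.measurable_ofReal.comp measurable_snd) (hu.comp measurable_fst)

/-- The weight `v` is needed because the distribution function of the maximal function is controlled
by an integral of `u` over a level set of `u`, and not only by the measure of that set. -/
theorem lintegral_mul_rpow_layercake {p : ℝ} (hp : 0 < p) {u v : ℝ → ℝ≥0∞} (hu : Measurable u)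
    (hv : Measurable v) :
    ∫⁻ x, v x * u x ^ p = ∫⁻ t in Set.Ioi (0 : ℝ), ENNReal.ofReal (p * t ^ (p - 1)) *
      ∫⁻ x in {x | ENNReal.ofReal t < u x}, v x := by
  have hm : Measurable (fun t : ℝ => ENNReal.ofReal (p * t ^ (p - 1))) := by fun_prop
  have hj : Measurable (fun z : ℝ × ℝ => {z : ℝ × ℝ | ENNReal.ofReal z.2 < u z.1}.indicator
      (fun z => v z.1 * ENNReal.ofReal (p * z.2 ^ (p - 1))) z) :=
    ((hv.comp measurable_fst).mul (hm.comp measurable_snd)).indicator (measurableSet_lt_prod hu)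
  calc ∫⁻ x, v x * u x ^ p
      = ∫⁻ x, ∫⁻ t in Set.Ioi (0 : ℝ), {z : ℝ × ℝ | ENNReal.ofReal z.2 < u z.1}.indicator
          (fun z => v z.1 * ENNReal.ofReal (p * z.2 ^ (p - 1))) (x, t) := by
        refine lintegral_congr fun x => ?_
        rw [← lintegral_Ioi_indicator_rpow hp, ← lintegral_const_mul]
        · refine lintegral_congr fun t => ?_
          by_cases h : ENNReal.ofReal t < u x
          · simp [Set.indicator, h]
          · simp [Set.indicator, h]
        · exact hm.indicator (measurableSet_lt ENNReal.measurable_ofReal measurable_const)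
    _ = ∫⁻ t in Set.Ioi (0 : ℝ), ∫⁻ x, {z : ℝ × ℝ | ENNReal.ofReal z.2 < u z.1}.indicator
          (fun z => v z.1 * ENNReal.ofReal (p * z.2 ^ (p - 1))) (x, t) :=
        lintegral_lintegral_swap hj.aemeasurable
    _ = _ := by
        refine lintegral_congr fun t => ?_
        rw [← lintegral_const_mul _ hv, ← lintegral_indicator]
        · refine lintegral_congr fun x => ?_
          by_cases h : ENNReal.ofReal t < u x
          · simp [Set.indicator, h, mul_comm]
          · simp [Set.indicator, h]
        · exact measurableSet_lt measurable_const hu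

theorem lintegral_rpow_layercake {p : ℝ} (hp : 0 < p) {u : ℝ → ℝ≥0∞} (hu : Measurable u) :
    ∫⁻ x, u x ^ p = ∫⁻ t in Set.Ioi (0 : ℝ), ENNReal.ofReal (p * t ^ (p - 1)) *
      volume {x | ENNReal.ofReal t < u x} := by
  simpa using lintegral_mul_rpow_layercake hp hu (v := fun _ => 1) measurable_const

theorem lintegral_Ioi_le_of_forall_pos {f g : ℝ → ℝ≥0∞} (h : ∀ t, 0 < t → f t ≤ g t) :
    ∫⁻ t in Set.Ioi (0 : ℝ), f t ≤ ∫⁻ t in Set.Ioi (0 : ℝ), g t :=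
  setLIntegral_mono' measurableSet_Ioi fun t ht => h t ht

/-- The part of `u` not exceeding `t / 2` adds at most `t / 2` to any average, so the rest must have
an average above `t / 2`. The weak type inequality for that rest gives the constant `2 * 6`. -/
theorem maximal_distribution_le {u : ℝ → ℝ≥0∞} (hu : Measurable u) {t : ℝ} (ht : 0 < t) :
    ENNReal.ofReal t * volume {x | ENNReal.ofReal t < hlMaximal u x} ≤
      12 * ∫⁻ x in {x | ENNReal.ofReal t < 2 * u x}, u x := by
  set A := {x | ENNReal.ofReal t < 2 * u x}
  have hA : MeasurableSet A := measurableSet_lt measurable_const (hu.const_mul _)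
  have hsub : {x | ENNReal.ofReal t < hlMaximal u x} ⊆
      {x | ENNReal.ofReal (t / 2) < hlMaximal (A.indicator u) x} := by
    intro x hx
    obtain ⟨c, r, hxc, h⟩ := lt_maximal_iff.1 hx
    refine lt_maximal_iff.2 ⟨c, r, hxc, ?_⟩
    by_contra! hcon
    refine absurd h (not_lt.2 ?_)
    calc ∫⁻ y in ball c r, u y
        ≤ ∫⁻ y in ball c r, (A.indicator u y + ENNReal.ofReal (t / 2)) := by
          refine lintegral_mono fun y => ?_
          by_cases hy : y ∈ A
          · simp [hy]
          · rw [Set.indicator_of_notMem hy, zero_add]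
            have hy' : 2 * u y ≤ ENNReal.ofReal t := not_lt.1 hy
            rw [ENNReal.ofReal_div_of_pos (by norm_num), ENNReal.le_div_iff_mul_le (by simp)
              (by simp), mul_comm]
            simpa using hy'
      _ = (∫⁻ y in ball c r, A.indicator u y) +
            ENNReal.ofReal (t / 2) * ENNReal.ofReal (2 * r) := by
          rw [lintegral_add_right _ measurable_const]; simp [Real.volume_ball]
      _ ≤ ENNReal.ofReal (t / 2) * ENNReal.ofReal (2 * r) +
            ENNReal.ofReal (t / 2) * ENNReal.ofReal (2 * r) := by gcongr
      _ = ENNReal.ofReal t * ENNReal.ofReal (2 * r) := by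
          rw [← add_mul, ← ENNReal.ofReal_add (by positivity) (by positivity), add_halves]
  calc ENNReal.ofReal t * volume {x | ENNReal.ofReal t < hlMaximal u x}
      ≤ (2 * ENNReal.ofReal (t / 2)) *
        volume {x | ENNReal.ofReal (t / 2) < hlMaximal (A.indicator u) x} := by
        gcongr
        rw [← ENNReal.ofReal_ofNat 2, ← ENNReal.ofReal_mul (by norm_num)]
        exact ENNReal.ofReal_le_ofReal (by linarith)
    _ ≤ 2 * (6 * ∫⁻ y, A.indicator u y) := by
        rw [mul_assoc]; exact mul_le_mul_right (maximal_weak_type _ _) 2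
    _ = 12 * ∫⁻ x in A, u x := by
        rw [lintegral_indicator hA, ← mul_assoc]; norm_num

/-- The Hardy-Littlewood maximal inequality. -/
theorem exists_maximal_strong_type {p : ℝ} (hp : 1 < p) :
    ∃ C : ℝ≥0, ∀ u : ℝ → ℝ≥0∞, AEMeasurable u → ∫⁻ x, hlMaximal u x ^ p ≤ C * ∫⁻ x, u x ^ p := by
  have hp0 : 0 < p := by linarith
  have hp1 : 0 < p - 1 := by linarith
  refine ⟨Real.toNNReal (12 * (p / (p - 1))) * 2 ^ (p - 1), fun u hu' => ?_⟩
  rw [maximal_congr hu'.ae_eq_mk, lintegral_congr_ae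
    (show (fun x => u x ^ p) =ᵐ[volume] fun x => hu'.mk u x ^ p from hu'.ae_eq_mk.fun_comp (· ^ p))]
  set v := hu'.mk u with hv
  have hu : Measurable v := hu'.measurable_mk
  rw [lintegral_rpow_layercake hp0 (measurable_maximal v)]
  have h1 : ∀ x, v x * (2 * v x) ^ (p - 1) = 2 ^ (p - 1) * v x ^ p := by
    intro x
    rw [ENNReal.mul_rpow_of_nonneg _ _ hp1.le, mul_left_comm]
    congr 1
    conv_lhs => enter [1]; rw [← ENNReal.rpow_one (v x)]
    rw [← ENNReal.rpow_add_of_nonneg _ _ zero_le_one hp1.le, add_sub_cancel]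
  -- Layer cake at exponent `p - 1` with weight `v`: one power of `t` is spent on the distribution
  -- estimate, and the integral over the level sets reassembles a multiple of the integral of `v ^
  -- p`.
  have h2 := lintegral_mul_rpow_layercake hp1 (hu.const_mul 2) hu
  simp_rw [h1] at h2
  rw [lintegral_const_mul _ (hu.pow_const p)] at h2
  calc ∫⁻ t in Set.Ioi (0 : ℝ), ENNReal.ofReal (p * t ^ (p - 1)) *
        volume {x | ENNReal.ofReal t < hlMaximal v x}
      ≤ ∫⁻ t in Set.Ioi (0 : ℝ), ENNReal.ofReal (12 * (p / (p - 1))) *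
        (ENNReal.ofReal ((p - 1) * t ^ (p - 1 - 1)) *
          ∫⁻ x in {x | ENNReal.ofReal t < 2 * v x}, v x) := by
        refine lintegral_Ioi_le_of_forall_pos fun t ht => ?_
        have e1 : p * t ^ (p - 1) = p / (p - 1) * ((p - 1) * t ^ (p - 1 - 1)) * t := by
          rw [Real.rpow_sub_one ht.ne' (p - 1)]; field_simp
        have hnn : 0 ≤ p / (p - 1) * ((p - 1) * t ^ (p - 1 - 1)) := by
          have := Real.rpow_nonneg ht.le (p - 1 - 1)
          positivity
        rw [e1, ENNReal.ofReal_mul hnn, mul_assoc]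
        calc _ ≤ ENNReal.ofReal (p / (p - 1) * ((p - 1) * t ^ (p - 1 - 1))) *
              (12 * ∫⁻ x in {x | ENNReal.ofReal t < 2 * v x}, v x) := by
              exact mul_le_mul_right (maximal_distribution_le hu ht) _
          _ = _ := by
              rw [ENNReal.ofReal_mul (by positivity), ENNReal.ofReal_mul (by norm_num : (0:ℝ) ≤ 12)]
              simp only [ENNReal.ofReal_ofNat]; ring
    _ = ENNReal.ofReal (12 * (p / (p - 1))) * (2 ^ (p - 1) * ∫⁻ x, v x ^ p) := by
        rw [lintegral_const_mul' _ _ ENNReal.ofReal_ne_top, h2]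
    _ = _ := by
        rw [← mul_assoc]
        congr 2
        push_cast
        rw [ENNReal.coe_rpow_of_nonneg _ hp1.le]
        rfl

/-! ### Lebesgue differentiation, the good-lambda inequality and the Fefferman-Stein inequality. -/

theorem Real.restrict_closedBall_eq_ball (c r : ℝ) :
    (volume : Measure ℝ).restrict (closedBall c r) = volume.restrict (ball c r) := by
  rw [Real.closedBall_eq_Icc, Real.ball_eq_Ioo]
  exact Measure.restrict_congr_set Ioo_ae_eq_Icc.symm

/-- Lebesgue differentiation. The exceptional set is fixed before `l` and `r`. -/
theorem ae_enorm_le_of_small_balls {F : ℝ → ℂ} (hF : LocallyIntegrable F) :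
    ∀ᵐ x, ∀ (l : ℝ≥0∞) (r : ℝ), 0 < r →
      (∀ s, 0 < s → s < r → ∫⁻ y in ball x s, ‖F y‖ₑ ≤ l * ENNReal.ofReal (2 * s)) →
      ‖F x‖ₑ ≤ l := by
  filter_upwards [IsUnifLocDoublingMeasure.ae_tendsto_average volume hF 1] with x hx l r hr hl
  have h := hx (fun _ => x) id (l := 𝓝[>] 0) tendsto_id
    (eventually_mem_nhdsWithin.mono fun s hs =>
      mem_closedBall_self (by simpa using (le_of_lt hs)))
  refine le_of_tendsto h.enorm ?_
  filter_upwards [Ioo_mem_nhdsGT hr] with s hs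
  have hs0 : 0 < s := hs.1
  simp only [id]
  rw [Real.restrict_closedBall_eq_ball, average_eq, enorm_smul]
  simp only [measureReal_restrict_apply_univ, Real.volume_real_ball hs0.le]
  rw [enorm_inv (by positivity), Real.enorm_of_nonneg (by positivity), mul_comm, ← div_eq_mul_inv]
  exact ENNReal.div_le_of_le_mul
    ((enorm_integral_le_lintegral_enorm _).trans (hl s hs0 hs.2))

theorem enorm_le_maximal_ae {F : ℝ → ℂ} (hF : LocallyIntegrable F) :
    ∀ᵐ x, ‖F x‖ₑ ≤ hlMaximal (fun x => ‖F x‖ₑ) x := by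
  filter_upwards [ae_enorm_le_of_small_balls hF] with x hx
  refine hx _ 1 one_pos fun s hs _ => ?_
  rw [mul_comm]
  exact lintegral_ball_le_maximal (fun x => ‖F x‖ₑ) (mem_ball_self hs)

/-- On a stopping interval of level `l`, a single point where `G` is at most `g l` makes `F` close
in mean to a constant `w` with modulus at most `2 l`. Where the maximal function of `F` exceeds `3
l`, the maximal function of the localized `F - w` must then exceed `l`. By the weak type inequality
this happens on a proportion of order `g` of the stopping interval; summing over the disjoint
intervals gives `180 = 6 * 30`. -/
theorem good_lambda {F : ℝ → ℂ} (hF : AEStronglyMeasurable F) {G : ℝ → ℝ≥0∞}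
    (hG : ∀ c r, 0 < r → ∃ a : ℂ, ∀ y ∈ ball c r,
      ∫⁻ x in ball c r, ‖F x - a‖ₑ ≤ ENNReal.ofReal (2 * r) * G y)
    {l g : ℝ≥0∞} (hl0 : l ≠ 0) (hl : l ≠ ∞) (hg : g ≤ 1)
    (hfin : volume {x | l < hlMaximal (fun x => ‖F x‖ₑ) x} ≠ ∞) :
    volume {y | 3 * l < hlMaximal (fun x => ‖F x‖ₑ) y ∧ G y ≤ g * l} ≤
      180 * g * volume {x | l < hlMaximal (fun x => ‖F x‖ₑ) x} := by
  obtain ⟨c, r, T, hT, hd, hcov, hst⟩ := exists_stopping_balls _ _ hfin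
  set E := {y | 3 * l < hlMaximal (fun x => ‖F x‖ₑ) y ∧ G y ≤ g * l} with hE
  have hlin : ∀ k s : ℝ, 0 ≤ k → ENNReal.ofReal (k * s) = ENNReal.ofReal k * ENNReal.ofReal s :=
    fun k s hk => ENNReal.ofReal_mul hk
  have hmain : ∀ a ∈ T, volume (E ∩ ball (c a) (6 * r a)) ≤
      180 * g * ENNReal.ofReal (2 * r a) := by
    intro a ha
    obtain ⟨hac, -, hmax⟩ := hst a ha
    have hr : 0 < r a := pos_of_mem_ball hac
    rcases (E ∩ ball (c a) (6 * r a)).eq_empty_or_nonempty with he | ⟨y0, hy0, hy0c⟩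
    · simp [he]
    -- The radius `30 r` is at least `2 r`, so the stopping rule bounds the mean of `F` there, and
    -- it contains every ball of radius below `10 r` that meets the ball of radius `6 r`.
    obtain ⟨w, hw⟩ := hG (c a) (30 * r a) (by positivity)
    set B := ball (c a) (30 * r a)
    set L := ENNReal.ofReal (2 * (30 * r a)) with hL
    have hL0 : L ≠ 0 := by simp [hL, hr]
    have hLt : L ≠ ∞ := ENNReal.ofReal_ne_top
    have hvB : volume B = L := by simp [B, hL, Real.volume_ball]
    have hosc : ∫⁻ x in B, ‖F x - w‖ₑ ≤ L * (g * l) :=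
      (hw y0 (ball_subset_ball (by linarith) hy0c)).trans (by gcongr; exact hy0.2)
    have hFB : ∫⁻ x in B, ‖F x‖ₑ ≤ l * L :=
      hmax _ _ (by linarith) (ball_subset_ball (by linarith) hac)
    have hwle : ‖w‖ₑ ≤ 2 * l := by
      have h1 : L * ‖w‖ₑ ≤ L * (2 * l) := by
        calc L * ‖w‖ₑ = ∫⁻ _ in B, ‖w‖ₑ := by simp [hvB, mul_comm]
          _ ≤ ∫⁻ x in B, (‖F x - w‖ₑ + ‖F x‖ₑ) := by
              refine lintegral_mono fun x => ?_
              calc ‖w‖ₑ = ‖F x - (F x - w)‖ₑ := by simp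
                _ ≤ _ := by rw [add_comm]; exact enorm_sub_le
          _ = (∫⁻ x in B, ‖F x - w‖ₑ) + ∫⁻ x in B, ‖F x‖ₑ :=
              lintegral_add_right' _ hF.restrict.enorm
          _ ≤ L * (1 * l) + l * L := by gcongr; exact hosc.trans (by gcongr)
          _ = L * (2 * l) := by ring
      exact (ENNReal.mul_le_mul_iff_right hL0 hLt).1 h1
    have hsub : E ∩ ball (c a) (6 * r a) ⊆
        {y | l < hlMaximal (B.indicator fun x => ‖F x - w‖ₑ) y} := by
      rintro y ⟨⟨hy, -⟩, hyc⟩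
      obtain ⟨c', r', hyc', h⟩ := lt_maximal_iff.1 hy
      refine lt_maximal_iff.2 ⟨c', r', hyc', ?_⟩
      have hr' : 0 < r' := pos_of_mem_ball hyc'
      rw [mem_ball, Real.dist_eq, abs_lt] at hyc hyc' hac
      -- A ball of radius at least `10 r` through `y` contains the base point `a` once doubled,
      -- since `a` is within `7 r + r'` of its centre. The stopping rule then bounds the original
      -- average by `2 l`, which is less than the required `3 l`.
      have hsm : r' < 10 * r a := by
        by_contra! hcon
        have h2 := hmax c' (2 * r') (by linarith)
          (by rw [mem_ball, Real.dist_eq, abs_lt]; constructor <;> linarith)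
        refine absurd h (not_lt.2 ?_)
        calc ∫⁻ x in ball c' r', ‖F x‖ₑ ≤ ∫⁻ x in ball c' (2 * r'), ‖F x‖ₑ :=
              lintegral_mono_set (ball_subset_ball (by linarith))
          _ ≤ l * ENNReal.ofReal (2 * (2 * r')) := h2
          _ = 2 * l * ENNReal.ofReal (2 * r') := by
              rw [hlin 2 (2 * r') (by norm_num)]; simp only [ENNReal.ofReal_ofNat]; ring
          _ ≤ 3 * l * ENNReal.ofReal (2 * r') := by gcongr; norm_num
      have hLB : ball c' r' ⊆ B := by
        intro x hx
        simp only [B]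
        rw [mem_ball, Real.dist_eq, abs_lt] at hx ⊢
        constructor <;> linarith
      have h3 : ∫⁻ x in ball c' r', ‖F x‖ₑ ≤
          (∫⁻ x in ball c' r', B.indicator (fun x => ‖F x - w‖ₑ) x) +
            2 * l * ENNReal.ofReal (2 * r') := by
        calc ∫⁻ x in ball c' r', ‖F x‖ₑ
            ≤ ∫⁻ x in ball c' r', (B.indicator (fun x => ‖F x - w‖ₑ) x + 2 * l) := by
              refine setLIntegral_mono' measurableSet_ball fun x hx => ?_
              rw [Set.indicator_of_mem (hLB hx)]
              calc ‖F x‖ₑ = ‖(F x - w) + w‖ₑ := by simp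
                _ ≤ ‖F x - w‖ₑ + ‖w‖ₑ := enorm_add_le _ _
                _ ≤ _ := by gcongr
          _ = _ := by
              rw [lintegral_add_right _ measurable_const]
              simp [Real.volume_ball]
      by_contra! hcon
      refine absurd h (not_lt.2 (h3.trans ?_))
      calc _ ≤ l * ENNReal.ofReal (2 * r') + 2 * l * ENNReal.ofReal (2 * r') := by gcongr
        _ = _ := by ring
    have hwt := maximal_weak_type (B.indicator fun x => ‖F x - w‖ₑ) l
    rw [lintegral_indicator measurableSet_ball] at hwt
    refine (ENNReal.mul_le_mul_iff_right hl0 hl).1 ?_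
    calc l * volume (E ∩ ball (c a) (6 * r a)) ≤ _ := mul_le_mul_right (measure_mono hsub) l
      _ ≤ 6 * (L * (g * l)) := hwt.trans (by gcongr)
      _ = _ := by
        rw [hL, show 2 * (30 * r a) = 30 * (2 * r a) by ring, hlin 30 _ (by norm_num)]
        simp only [ENNReal.ofReal_ofNat]; ring
  have hEsub : E ⊆ ⋃ a ∈ T, (E ∩ ball (c a) (6 * r a)) := by
    intro y hy
    have : y ∈ {x | l < hlMaximal (fun x => ‖F x‖ₑ) x} :=
      lt_of_le_of_lt (by simpa using mul_le_mul_left (show (1 : ℝ≥0∞) ≤ 3 by norm_num) l) hy.1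
    have := hcov this
    simp only [Set.mem_iUnion] at this ⊢
    obtain ⟨a, ha, h⟩ := this
    exact ⟨a, ha, hy, h⟩
  calc volume E ≤ volume (⋃ a ∈ T, (E ∩ ball (c a) (6 * r a))) := measure_mono hEsub
    _ ≤ ∑' a : T, volume (E ∩ ball (c a) (6 * r a)) := measure_biUnion_le _ hT _
    _ ≤ ∑' a : T, 180 * g * ENNReal.ofReal (2 * r a) := by
        gcongr with a; exact hmain a a.2
    _ = 180 * g * ∑' a : T, ENNReal.ofReal (2 * r a) := ENNReal.tsum_mul_left
    _ ≤ _ := by gcongr; exact tsum_volume_ball_le hT hd fun a ha => (hst a ha).2.1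

theorem locallyIntegrable_of_lintegral_rpow {F : ℝ → ℂ} (hF : AEStronglyMeasurable F) {p : ℝ}
    (hp : 1 ≤ p) (h : ∫⁻ x, ‖F x‖ₑ ^ p ≠ ∞) : LocallyIntegrable F := by
  have hp0 : 0 < p := by linarith
  have : MemLp F (ENNReal.ofReal p) := by
    refine ⟨hF, ?_⟩
    rw [eLpNorm_lt_top_iff_lintegral_rpow_enorm_lt_top (by simpa using hp0) (by simp)]
    rw [ENNReal.toReal_ofReal hp0.le]
    exact lt_top_iff_ne_top.2 h
  exact this.locallyIntegrable (by simpa using hp)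

/-- The Fefferman-Stein inequality. -/
theorem fefferman_stein {p : ℝ} (hp : 1 < p) :
    ∃ C : ℝ≥0, ∀ F : ℝ → ℂ, AEStronglyMeasurable F → ∫⁻ x, ‖F x‖ₑ ^ p ≠ ∞ →
      ∀ G : ℝ → ℝ≥0∞, Measurable G → (∀ c r, 0 < r → ∃ a : ℂ, ∀ y ∈ ball c r,
        ∫⁻ x in ball c r, ‖F x - a‖ₑ ≤ ENNReal.ofReal (2 * r) * G y) →
      ∫⁻ x, ‖F x‖ₑ ^ p ≤ C * ∫⁻ x, G x ^ p := by
  have hp0 : 0 < p := by linarith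
  obtain ⟨C, hC⟩ := exists_maximal_strong_type hp
  -- Chosen so that `180 γ` is half of `3 ^ (-p)`, the factor lost in passing from the maximal
  -- function to a third of it.
  set γ : ℝ := (3 : ℝ) ^ (-p) / 360 with hγ
  have h3p : 0 < (3 : ℝ) ^ (-p) := by positivity
  have hγ0 : 0 < γ := by positivity
  have hγ1 : γ ≤ 1 := by
    have : (3 : ℝ) ^ (-p) ≤ 1 := Real.rpow_le_one_of_one_le_of_nonpos (by norm_num) (by linarith)
    rw [hγ]; linarith
  refine ⟨Real.toNNReal (2 * 3 ^ p * (γ⁻¹) ^ p), fun F hF hFp G hGm hG => ?_⟩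
  set M := hlMaximal (fun x => ‖F x‖ₑ) with hM
  have hMm : Measurable M := measurable_maximal _
  -- A priori finiteness, which legitimizes the absorption in `e4` and makes the level sets finite
  -- in measure.
  have hX : ∫⁻ x, M x ^ p ≠ ∞ :=
    ((hC _ hF.enorm).trans_lt (ENNReal.mul_lt_top (by simp) (lt_top_iff_ne_top.2 hFp))).ne
  have hfin : ∀ t : ℝ, 0 < t → volume {x | ENNReal.ofReal t < M x} ≠ ∞ := by
    intro t ht hcon
    refine hX (eq_top_iff.2 ?_)
    have h0 : (ENNReal.ofReal t) ^ p ≠ 0 := by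
      simp [ENNReal.rpow_eq_zero_iff, ht]
    have h1 := mul_meas_ge_le_lintegral₀ (hMm.pow_const p).aemeasurable (ENNReal.ofReal t ^ p)
      (μ := volume)
    refine le_trans ?_ h1
    have : volume {x | ENNReal.ofReal t ^ p ≤ M x ^ p} = ∞ := by
      refine measure_mono_top (fun x hx => ?_) hcon
      exact ENNReal.rpow_le_rpow (le_of_lt hx) hp0.le
    rw [this, ENNReal.mul_top h0]
  have e1 : ∫⁻ x, (M x / 3) ^ p ≤ ENNReal.ofReal (180 * γ) * (∫⁻ x, M x ^ p) +
      ∫⁻ x, (G x / ENNReal.ofReal γ) ^ p := by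
    rw [lintegral_rpow_layercake hp0 (hMm.div_const 3), lintegral_rpow_layercake hp0 hMm,
      lintegral_rpow_layercake hp0 (hGm.div_const _),
      ← lintegral_const_mul' _ _ ENNReal.ofReal_ne_top, ← lintegral_add_left']
    · refine lintegral_Ioi_le_of_forall_pos fun t ht => ?_
      rw [mul_left_comm, ← mul_add]
      gcongr
      have hsub : {x | ENNReal.ofReal t < M x / 3} ⊆
          {y | 3 * ENNReal.ofReal t < M y ∧ G y ≤ ENNReal.ofReal γ * ENNReal.ofReal t} ∪
          {x | ENNReal.ofReal t < G x / ENNReal.ofReal γ} := by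
        intro x hx
        by_cases h : ENNReal.ofReal t < G x / ENNReal.ofReal γ
        · exact Or.inr h
        · refine Or.inl ⟨?_, ?_⟩
          · have := (ENNReal.lt_div_iff_mul_lt (by simp) (by simp)).1 hx
            rwa [mul_comm]
          · rw [mul_comm]
            exact (ENNReal.div_le_iff_le_mul (by simp [hγ0]) (by simp)).1 (not_lt.1 h)
      refine (measure_mono hsub).trans ((measure_union_le _ _).trans ?_)
      gcongr
      rw [ENNReal.ofReal_mul (by norm_num)]
      simpa using good_lambda hF hG (l := ENNReal.ofReal t) (g := ENNReal.ofReal γ)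
        (by simpa using ht) (by simp) (by simpa using hγ1) (hfin t ht)
    · have hanti : Antitone fun t : ℝ => volume {x | ENNReal.ofReal t < M x} :=
        fun s t hst => measure_mono fun x hx => (ENNReal.ofReal_le_ofReal hst).trans_lt hx
      have := hanti.measurable
      fun_prop
  set X := ∫⁻ x, M x ^ p with hXdef
  have e2 : ∫⁻ x, (M x / 3) ^ p = ENNReal.ofReal ((3 : ℝ) ^ (-p)) * X := by
    rw [hXdef, ← lintegral_const_mul' _ _ ENNReal.ofReal_ne_top]
    refine lintegral_congr fun x => ?_
    rw [ENNReal.div_rpow_of_nonneg _ _ hp0.le, ← ENNReal.ofReal_rpow_of_pos (by norm_num),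
      ENNReal.rpow_neg, div_eq_mul_inv, mul_comm]
    simp
  have e3 : ∫⁻ x, (G x / ENNReal.ofReal γ) ^ p =
      ENNReal.ofReal (γ⁻¹ ^ p) * ∫⁻ x, G x ^ p := by
    rw [← lintegral_const_mul' _ _ ENNReal.ofReal_ne_top]
    refine lintegral_congr fun x => ?_
    rw [div_eq_mul_inv, ENNReal.mul_rpow_of_nonneg _ _ hp0.le, mul_comm,
      ← ENNReal.ofReal_inv_of_pos hγ0, ENNReal.ofReal_rpow_of_nonneg (by positivity) hp0.le]
  rw [e2, e3] at e1
  have hhalf : ENNReal.ofReal ((3 : ℝ) ^ (-p)) = ENNReal.ofReal (180 * γ) +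
      ENNReal.ofReal (180 * γ) := by
    rw [← ENNReal.ofReal_add (by positivity) (by positivity)]; congr 1; rw [hγ]; ring
  rw [hhalf, add_mul] at e1
  have e4 : ENNReal.ofReal (180 * γ) * X ≤ ENNReal.ofReal (γ⁻¹ ^ p) * ∫⁻ x, G x ^ p :=
    (ENNReal.add_le_add_iff_left (ENNReal.mul_ne_top ENNReal.ofReal_ne_top hX)).1 e1
  have hle : ∫⁻ x, ‖F x‖ₑ ^ p ≤ X := by
    refine lintegral_mono_ae ?_
    filter_upwards [enorm_le_maximal_ae
      (locallyIntegrable_of_lintegral_rpow hF hp.le hFp)] with x hx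
    exact ENNReal.rpow_le_rpow hx hp0.le
  refine hle.trans ?_
  have hone : ENNReal.ofReal (2 * 3 ^ p) * ENNReal.ofReal (180 * γ) = 1 := by
    rw [← ENNReal.ofReal_mul (by positivity), ← ENNReal.ofReal_one]
    congr 1
    rw [hγ, Real.rpow_neg (by norm_num)]
    have : (0 : ℝ) < 3 ^ p := by positivity
    field_simp; norm_num
  calc X = ENNReal.ofReal (2 * 3 ^ p) * (ENNReal.ofReal (180 * γ) * X) := by
        rw [← mul_assoc, hone, one_mul]
    _ ≤ ENNReal.ofReal (2 * 3 ^ p) * (ENNReal.ofReal (γ⁻¹ ^ p) * ∫⁻ x, G x ^ p) := by gcongr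
    _ = _ := by
        rw [← mul_assoc, ← ENNReal.ofReal_mul (by positivity)]; rfl

/-! ### Mean oscillation and the John-Nirenberg inequality. -/

/-- The average of `b` over the interval of centre `c` and radius `r`. -/
noncomputable def ballAvg (b : ℝ → ℂ) (c r : ℝ) : ℂ := ⨍ y in ball c r, b y

/-- `b` is locally integrable with mean oscillation at most `β` on every interval. -/
structure OscBound (b : ℝ → ℂ) (β : ℝ≥0) : Prop where
  locInt : LocallyIntegrable b
  osc : ∀ c r : ℝ, 0 < r → ∫⁻ x in ball c r, ‖b x - ballAvg b c r‖ₑ ≤ ENNReal.ofReal (2 * r) * β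

theorem MeasureTheory.LocallyIntegrable.integrableOn_ball {b : ℝ → ℂ} (hb : LocallyIntegrable b)
    (c r : ℝ) : IntegrableOn b (ball c r) :=
  (hb.integrableOn_isCompact (isCompact_closedBall c r)).mono_set ball_subset_closedBall

theorem enorm_ballAvg_sub_le {b : ℝ → ℂ} (hb : LocallyIntegrable b) {c r : ℝ} (hr : 0 < r) (w : ℂ) :
    ENNReal.ofReal (2 * r) * ‖ballAvg b c r - w‖ₑ ≤ ∫⁻ x in ball c r, ‖b x - w‖ₑ := by
  have h1 : ∫ x in ball c r, (b x - w) = (2 * r) • (ballAvg b c r - w) := by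
    have hi := hb.integrableOn_ball c r
    rw [integral_sub hi (integrableOn_const (by rw [Real.volume_ball]; exact ENNReal.ofReal_ne_top))]
    rw [ballAvg, smul_sub, average_eq]
    simp only [measureReal_restrict_apply_univ, Real.volume_real_ball hr.le, integral_const]
    rw [smul_smul, mul_inv_cancel₀ (by positivity), one_smul]
  have h2 : ENNReal.ofReal (2 * r) * ‖ballAvg b c r - w‖ₑ = ‖∫ x in ball c r, (b x - w)‖ₑ := by
    rw [h1, enorm_smul, Real.enorm_of_nonneg (by positivity)]
  rw [h2]
  exact enorm_integral_le_lintegral_enorm _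

theorem lintegral_ball_le_of_subset {b : ℝ → ℂ} {β : ℝ≥0} (hb : OscBound b β) {c r c' r' : ℝ}
    (hr : 0 < r) (hr' : 0 < r') (hsub : ball c' r' ⊆ ball c r) :
    ENNReal.ofReal (2 * r') * ‖ballAvg b c' r' - ballAvg b c r‖ₑ ≤ ENNReal.ofReal (2 * r) * β :=
  (enorm_ballAvg_sub_le hb.locInt hr' _).trans
    ((lintegral_mono_set hsub).trans (hb.osc c r hr))

theorem enorm_ballAvg_double_sub_le {b : ℝ → ℂ} {β : ℝ≥0} (hb : OscBound b β) {c r : ℝ}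
    (hr : 0 < r) : ‖ballAvg b c r - ballAvg b c (2 * r)‖ₑ ≤ 2 * β := by
  have h := lintegral_ball_le_of_subset hb (c := c) (c' := c) (r := 2 * r) (r' := r)
    (by positivity) hr (ball_subset_ball (by linarith))
  rw [ENNReal.ofReal_mul (p := 2) (q := 2 * r) (by norm_num), ENNReal.ofReal_ofNat, mul_comm 2
    (ENNReal.ofReal _), mul_assoc] at h
  refine (ENNReal.mul_le_mul_iff_right (a := ENNReal.ofReal (2 * r)) ?_ ENNReal.ofReal_ne_top).1 h
  exact (ENNReal.ofReal_pos.2 (by positivity)).ne'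

/-- Telescoping over successive doublings. The growth is linear in `k`, hence negligible against
geometric decay of kernels. -/
theorem enorm_ballAvg_dilate_sub_le {b : ℝ → ℂ} {β : ℝ≥0} (hb : OscBound b β) {c r : ℝ}
    (hr : 0 < r) (k : ℕ) : ‖ballAvg b c (2 ^ k * r) - ballAvg b c r‖ₑ ≤ 2 * k * β := by
  induction k with
  | zero => simp
  | succ k ih =>
    have h := enorm_ballAvg_double_sub_le hb (c := c) (r := 2 ^ k * r) (by positivity)
    rw [← mul_assoc, ← pow_succ', enorm_sub_rev] at h
    calc _ = ‖(ballAvg b c (2 ^ (k + 1) * r) - ballAvg b c (2 ^ k * r)) +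
            (ballAvg b c (2 ^ k * r) - ballAvg b c r)‖ₑ := by rw [sub_add_sub_cancel]
      _ ≤ 2 * β + 2 * k * β := (enorm_add_le _ _).trans (add_le_add h ih)
      _ = _ := by push_cast; ring

theorem lintegral_double_ball_le {b : ℝ → ℂ} {β : ℝ≥0} (hb : OscBound b β) {c r : ℝ}
    (hr : 0 < r) : ∫⁻ x in ball c (2 * r), ‖b x - ballAvg b c r‖ₑ ≤
      ENNReal.ofReal (2 * r) * (6 * β) := by
  calc ∫⁻ x in ball c (2 * r), ‖b x - ballAvg b c r‖ₑ
      ≤ ∫⁻ x in ball c (2 * r), (‖b x - ballAvg b c (2 * r)‖ₑ + 2 * β) := by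
        refine lintegral_mono fun x => ?_
        calc _ = ‖(b x - ballAvg b c (2 * r)) + (ballAvg b c (2 * r) - ballAvg b c r)‖ₑ := by
              rw [sub_add_sub_cancel]
          _ ≤ _ := enorm_add_le _ _
          _ ≤ _ := by
            gcongr
            rw [enorm_sub_rev]; exact enorm_ballAvg_double_sub_le hb hr
    _ ≤ ENNReal.ofReal (2 * (2 * r)) * β + 2 * β * ENNReal.ofReal (2 * (2 * r)) := by
        rw [lintegral_add_right _ measurable_const]
        gcongr
        · exact hb.osc _ _ (by positivity)
        · simp [Real.volume_ball]
    _ = _ := by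
        rw [ENNReal.ofReal_mul (p := 2) (q := 2 * r) (by norm_num), ENNReal.ofReal_ofNat]; ring

/-- Stopping intervals are chosen where the mean of `b - w` exceeds `K β`. Off them the modulus of
`b - w` is at most `K β`; on each of them the average of `b` has moved by at most `K β`, and the
remaining oscillation is again measured by `Φ`. Their sixfold enlargements have total length at most
`36 / K` times that of the ball, and with the convexity factor `2 ^ (q - 1)` the choice of `K` makes
the coefficient of `Φ` equal to `1 / 2`. The cut-off at `N` is there to make the best `Φ` finite. -/
theorem john_nirenberg_step {b : ℝ → ℂ} {β : ℝ≥0} (hb : OscBound b β) (hβ : β ≠ 0) {q : ℝ}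
    (hq : 1 ≤ q) (N K : ℝ≥0) (hK : K = 36 * 2 ^ q) (Φ : ℝ≥0∞)
    (hΦ : ∀ c r : ℝ, 0 < r → ∫⁻ x in ball c r, (min ‖b x - ballAvg b c r‖ₑ N) ^ q ≤
      ENNReal.ofReal (2 * r) * Φ) {c r : ℝ} (hr : 0 < r) :
    ∫⁻ x in ball c r, (min ‖b x - ballAvg b c r‖ₑ N) ^ q ≤
      ENNReal.ofReal (2 * r) * ((K * β) ^ q + 2⁻¹ * ((K * β) ^ q + Φ)) := by
  have hq0 : 0 ≤ q := by linarith
  have hK72 : (72 : ℝ≥0) ≤ K := by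
    rw [hK]
    have : (2 : ℝ≥0) ^ (1 : ℝ) ≤ 2 ^ q := NNReal.rpow_le_rpow_of_exponent_le (by norm_num) hq
    rw [NNReal.rpow_one] at this
    calc (72 : ℝ≥0) = 36 * 2 := by norm_num
      _ ≤ _ := by gcongr
  have hK0 : (K : ℝ≥0∞) ≠ 0 := by
    have : K ≠ 0 := fun h => by rw [h] at hK72; norm_num at hK72
    simpa using this
  have hKβ0 : (K : ℝ≥0∞) * β ≠ 0 := mul_ne_zero hK0 (by simpa using hβ)
  have hKβt : (K : ℝ≥0∞) * β ≠ ∞ := ENNReal.mul_ne_top (by simp) (by simp)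
  set w := ballAvg b c r with hw
  -- Only radii below `r` are admitted, so the selected balls stay in the ball of radius `2 r`,
  -- where `lintegral_double_ball_le` applies.
  set P : ℝ → Set ℝ := fun x => {s | 0 < s ∧ s < r ∧
    K * β * ENNReal.ofReal (2 * s) < ∫⁻ y in ball x s, ‖b y - w‖ₑ} with hP
  set E := {x ∈ ball c r | (P x).Nonempty} with hE
  have H : ∀ x ∈ E, ∃ s, s ∈ P x ∧ ∀ s' ∈ P x, s' < 2 * s := fun x hx =>
    exists_near_sup hx.2 ⟨r, fun s hs => hs.2.1.le⟩ fun s hs => hs.1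
  choose! ρ hρ hmax using H
  obtain ⟨T, hTE, hT, hd, hc⟩ := exists_countable_disjoint_balls (S := E) (fun x => x) ρ r
    (fun x hx => (hρ x hx).1) fun x hx => (hρ x hx).2.1.le
  have hsum : K * ∑' a : T, ENNReal.ofReal (2 * ρ a) ≤ 6 * ENNReal.ofReal (2 * r) := by
    have h1 : K * β * ∑' a : T, ENNReal.ofReal (2 * ρ a) ≤ ENNReal.ofReal (2 * r) * (6 * β) := by
      calc _ = ∑' a : T, K * β * ENNReal.ofReal (2 * ρ a) := ENNReal.tsum_mul_left.symm
        _ ≤ ∑' a : T, ∫⁻ y in ball (a : ℝ) (ρ a), ‖b y - w‖ₑ := by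
            gcongr with a; exact (hρ a (hTE a.2)).2.2.le
        _ = ∫⁻ y in ⋃ a ∈ T, ball a (ρ a), ‖b y - w‖ₑ :=
            (lintegral_biUnion hT (fun _ _ => measurableSet_ball) hd _).symm
        _ ≤ ∫⁻ y in ball c (2 * r), ‖b y - w‖ₑ := by
            refine lintegral_mono_set (Set.iUnion₂_subset fun a ha => ?_)
            have h1 := (hTE ha).1
            have h2 := (hρ a (hTE ha)).2.1
            refine ball_subset_ball' ?_
            rw [mem_ball] at h1
            linarith
        _ ≤ _ := lintegral_double_ball_le hb hr
    have h2 : (β : ℝ≥0∞) * (K * ∑' a : T, ENNReal.ofReal (2 * ρ a)) ≤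
        β * (6 * ENNReal.ofReal (2 * r)) := by
      convert! h1 using 1 <;> ring
    exact (ENNReal.mul_le_mul_iff_right (by simpa using hβ) (by simp)).1 h2
  -- Since `K` is at least 72, the bound on the total length gives `12 ρ ≤ r`. The enlarged radius
  -- `6 ρ` is thus still below `r`, and near-maximality of `ρ` can be invoked there.
  have hsmall : ∀ a ∈ T, 6 * ρ a < r := by
    intro a ha
    have h1 : K * ENNReal.ofReal (2 * ρ a) ≤ 6 * ENNReal.ofReal (2 * r) :=
      le_trans (mul_le_mul_right (ENNReal.le_tsum (⟨a, ha⟩ : T)) _) hsum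
    have h2 : ENNReal.ofReal (72 * (2 * ρ a)) ≤ ENNReal.ofReal (6 * (2 * r)) := by
      rw [ENNReal.ofReal_mul (p := 72) (by norm_num), ENNReal.ofReal_mul (p := 6) (by norm_num),
        ENNReal.ofReal_ofNat, ENNReal.ofReal_ofNat]
      refine le_trans ?_ h1
      gcongr
      exact_mod_cast hK72
    rw [ENNReal.ofReal_le_ofReal_iff (by positivity)] at h2
    linarith
  have hJ : ∀ a ∈ T, ‖ballAvg b a (6 * ρ a) - w‖ₑ ≤ K * β := by
    intro a ha
    have h0 := (hρ a (hTE ha)).1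
    have h1 : ∫⁻ y in ball a (6 * ρ a), ‖b y - w‖ₑ ≤ K * β * ENNReal.ofReal (2 * (6 * ρ a)) := by
      by_contra! hcon
      have := hmax a (hTE ha) (6 * ρ a) ⟨by positivity, hsmall a ha, hcon⟩
      linarith
    have h2 := (enorm_ballAvg_sub_le hb.locInt (c := a) (r := 6 * ρ a) (by positivity) w).trans h1
    rw [mul_comm] at h2
    exact (ENNReal.mul_le_mul_iff_left (by simpa using h0) ENNReal.ofReal_ne_top).1 h2
  set U := ⋃ a ∈ T, ball a (6 * ρ a) with hU
  have hUm : MeasurableSet U := (isOpen_biUnion fun _ _ => isOpen_ball).measurableSet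
  have hEU : E ⊆ U := fun x hx => by
    obtain ⟨a, ha, h⟩ := hc x hx
    exact Set.mem_biUnion ha (h (mem_ball_self (hρ x hx).1))
  set u : ℝ → ℝ≥0∞ := fun x => (min ‖b x - w‖ₑ N) ^ q with hu
  have hout : ∫⁻ x in ball c r \ U, u x ≤ ENNReal.ofReal (2 * r) * (K * β) ^ q := by
    have hli : LocallyIntegrable fun x => b x - w := hb.locInt.sub (locallyIntegrable_const w)
    calc _ ≤ ∫⁻ x in ball c r \ U, (K * β) ^ q := by
          refine setLIntegral_mono_ae' (measurableSet_ball.diff hUm) ?_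
          filter_upwards [ae_enorm_le_of_small_balls hli] with x hx hxU
          have : ‖b x - w‖ₑ ≤ K * β := by
            refine hx _ r hr fun s hs hsr => ?_
            by_contra! hcon
            exact hxU.2 (hEU ⟨hxU.1, s, hs, hsr, hcon⟩)
          exact ENNReal.rpow_le_rpow ((min_le_left _ _).trans this) hq0
      _ ≤ ∫⁻ x in ball c r, (K * β) ^ q := lintegral_mono_set Set.sdiff_subset
      _ = _ := by simp [Real.volume_ball, mul_comm]
  have hin : ∀ a ∈ T, ∫⁻ x in ball a (6 * ρ a), u x ≤
      ENNReal.ofReal (2 * ρ a) * (6 * (2 ^ (q - 1) * ((K * β) ^ q + Φ))) := by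
    intro a ha
    have h0 := (hρ a (hTE ha)).1
    calc _ ≤ ∫⁻ x in ball a (6 * ρ a), 2 ^ (q - 1) *
          ((K * β) ^ q + (min ‖b x - ballAvg b a (6 * ρ a)‖ₑ N) ^ q) := by
          refine lintegral_mono fun x => ?_
          refine le_trans ?_ (ENNReal.rpow_add_le_mul_rpow_add_rpow _ _ hq)
          refine ENNReal.rpow_le_rpow ?_ hq0
          have : ‖b x - w‖ₑ ≤ K * β + ‖b x - ballAvg b a (6 * ρ a)‖ₑ := by
            calc _ = ‖(ballAvg b a (6 * ρ a) - w) + (b x - ballAvg b a (6 * ρ a))‖ₑ := by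
                  congr 1; ring
              _ ≤ _ := (enorm_add_le _ _).trans (by gcongr; exact hJ a ha)
          rw [← min_add_add_left]
          exact min_le_min this le_add_self
      _ ≤ 2 ^ (q - 1) * ((K * β) ^ q * ENNReal.ofReal (2 * (6 * ρ a)) +
            ENNReal.ofReal (2 * (6 * ρ a)) * Φ) := by
          rw [lintegral_const_mul' _ _
            (ENNReal.rpow_ne_top_of_nonneg (by linarith) (by simp)),
            lintegral_add_left measurable_const]
          gcongr
          · simp [Real.volume_ball]
          · exact hΦ _ _ (by positivity)
      _ = _ := by
          rw [show 2 * (6 * ρ a) = 6 * (2 * ρ a) by ring, ENNReal.ofReal_mul (by norm_num)]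
          simp only [ENNReal.ofReal_ofNat]; ring
  have hinU : ∫⁻ x in U, u x ≤ ENNReal.ofReal (2 * r) * (2⁻¹ * ((K * β) ^ q + Φ)) := by
    have hUeq : U = ⋃ a : T, ball (a : ℝ) (6 * ρ a) := by rw [hU, Set.biUnion_eq_iUnion]
    have := hT.to_subtype
    have e2 : (2 : ℝ≥0∞) ^ (q - 1) * 72 = K := by
      have : (2 : ℝ≥0∞) ^ q = 2 ^ (q - 1) * 2 := by
        conv_lhs => rw [← sub_add_cancel q 1]
        rw [ENNReal.rpow_add _ _ (by norm_num) (by simp), ENNReal.rpow_one]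
      have h2 : (K : ℝ≥0∞) = 36 * 2 ^ q := by
        rw [hK, ENNReal.coe_mul, ENNReal.coe_rpow_of_nonneg _ hq0]; rfl
      rw [h2, this, show (72 : ℝ≥0∞) = 36 * 2 by norm_num]; ring
    have e3 : (2 : ℝ≥0∞) ^ (q - 1) * 36 = 2⁻¹ * K := by
      rw [← e2, show (72 : ℝ≥0∞) = 2 * 36 by norm_num,
        show ∀ z : ℝ≥0∞, 2⁻¹ * (z * (2 * 36)) = (2⁻¹ * 2) * (z * 36) from fun z => by ring,
        ENNReal.inv_mul_cancel (by norm_num) (by norm_num), one_mul]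
    calc _ ≤ ∑' a : T, ∫⁻ x in ball (a : ℝ) (6 * ρ a), u x := by
          rw [hUeq]; exact lintegral_iUnion_le _ _
      _ ≤ ∑' a : T, ENNReal.ofReal (2 * ρ a) * (6 * (2 ^ (q - 1) * ((K * β) ^ q + Φ))) := by
          gcongr with a; exact hin a a.2
      _ = (∑' a : T, ENNReal.ofReal (2 * ρ a)) * (6 * (2 ^ (q - 1) * ((K * β) ^ q + Φ))) :=
          ENNReal.tsum_mul_right
      _ ≤ _ := by
          refine (ENNReal.mul_le_mul_iff_right hK0 (by simp)).1 ?_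
          rw [← mul_assoc]
          refine (mul_le_mul_left hsum _).trans (le_of_eq ?_)
          rw [show ∀ a b s : ℝ≥0∞, 6 * a * (6 * (b * s)) = a * ((b * 36) * s) from
            fun a b s => by ring, e3]
          ring
  calc ∫⁻ x in ball c r, u x ≤ ∫⁻ x in (ball c r \ U) ∪ U, u x :=
        lintegral_mono_set (by rw [Set.sdiff_union_self]; exact Set.subset_union_left)
    _ ≤ _ := lintegral_union_le _ _ _
    _ ≤ _ := by rw [mul_add]; exact add_le_add hout hinU

/-- The John-Nirenberg inequality in its `L^q` form. -/
theorem john_nirenberg {q : ℝ} (hq : 1 ≤ q) :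
    ∃ C : ℝ≥0, ∀ (b : ℝ → ℂ) (β : ℝ≥0), OscBound b β → ∀ c r : ℝ, 0 < r →
      ∫⁻ x in ball c r, ‖b x - ballAvg b c r‖ₑ ^ q ≤ ENNReal.ofReal (2 * r) * (C * β ^ q) := by
  have hq0 : 0 < q := by linarith
  set K : ℝ≥0 := 36 * 2 ^ q with hK
  refine ⟨3 * K ^ q, fun b β hb c r hr => ?_⟩
  have hbm : AEMeasurable b := hb.locInt.aestronglyMeasurable.aemeasurable
  -- The stopping argument cancels a factor `β`; for `β = 0` the function equals its average almost
  -- everywhere.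
  rcases eq_or_ne β 0 with rfl | hβ
  · have h := hb.osc c r hr
    simp only [ENNReal.coe_zero, mul_zero, nonpos_iff_eq_zero] at h
    rw [lintegral_eq_zero_iff' (hbm.restrict.sub_const _).enorm] at h
    rw [lintegral_congr_ae (g := fun _ => 0)]
    · simp
    · filter_upwards [h] with x hx
      rw [hx, Pi.zero_apply, ENNReal.zero_rpow_of_pos hq0]
  have hN : ∀ N : ℝ≥0, ∀ c r : ℝ, 0 < r → ∫⁻ x in ball c r, (min ‖b x - ballAvg b c r‖ₑ N) ^ q ≤
      ENNReal.ofReal (2 * r) * (((3 * K ^ q : ℝ≥0) : ℝ≥0∞) * β ^ q) := by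
    intro N
    set Φ : ℝ≥0∞ := ⨆ (c : ℝ) (r : ℝ) (_ : 0 < r),
      (∫⁻ x in ball c r, (min ‖b x - ballAvg b c r‖ₑ N) ^ q) / ENNReal.ofReal (2 * r) with hΦ
    have hΦle : ∀ c r : ℝ, 0 < r → ∫⁻ x in ball c r, (min ‖b x - ballAvg b c r‖ₑ N) ^ q ≤
        ENNReal.ofReal (2 * r) * Φ := by
      intro c r hr
      rw [mul_comm, ← ENNReal.div_le_iff (by simpa using hr) ENNReal.ofReal_ne_top]
      exact le_iSup_of_le c (le_iSup_of_le r (le_iSup_of_le hr le_rfl))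
    -- This uses the cut-off at `N`, and it is what allows half of `Φ` to be absorbed. The resulting
    -- bound does not involve `N`.
    have hΦt : Φ ≠ ∞ := by
      refine ((iSup_le fun c => iSup_le fun r => iSup_le fun hr => ?_ : Φ ≤ (N : ℝ≥0∞) ^ q).trans_lt
        (ENNReal.rpow_lt_top_of_nonneg hq0.le (by simp))).ne
      refine ENNReal.div_le_of_le_mul ?_
      calc _ ≤ ∫⁻ x in ball c r, (N : ℝ≥0∞) ^ q :=
            lintegral_mono fun x => ENNReal.rpow_le_rpow (min_le_right _ _) hq0.le
        _ = _ := by simp [Real.volume_ball]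
    have hΦ2 : Φ ≤ (K * β) ^ q + 2⁻¹ * ((K * β) ^ q + Φ) := by
      refine iSup_le fun c => iSup_le fun r => iSup_le fun hr => ?_
      refine ENNReal.div_le_of_le_mul ?_
      rw [mul_comm]
      exact john_nirenberg_step hb hβ hq N K hK Φ hΦle hr
    have hΦ3 : Φ ≤ 3 * (K * β) ^ q := by
      set A := ((K : ℝ≥0∞) * β) ^ q
      have h1 : 2 * Φ ≤ 3 * A + Φ := by
        calc 2 * Φ ≤ 2 * (A + 2⁻¹ * (A + Φ)) := by gcongr
          _ = 2 * A + (2 * 2⁻¹) * (A + Φ) := by ring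
          _ = 3 * A + Φ := by
            rw [ENNReal.mul_inv_cancel (by norm_num) (by norm_num)]; ring
      rw [two_mul] at h1
      exact (ENNReal.add_le_add_iff_right hΦt).1 h1
    intro c r hr
    refine (hΦle c r hr).trans ?_
    gcongr
    refine hΦ3.trans (le_of_eq ?_)
    rw [ENNReal.mul_rpow_of_nonneg _ _ hq0.le, ENNReal.coe_mul 3, ENNReal.coe_rpow_of_nonneg _ hq0.le,
      ← mul_assoc]
    rfl
  refine le_of_tendsto' (lintegral_tendsto_of_tendsto_of_monotone
    (f := fun (n : ℕ) x => (min ‖b x - ballAvg b c r‖ₑ (n : ℝ≥0)) ^ q) ?_ ?_ ?_)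
    (fun n => hN n c r hr)
  · intro n
    exact ((hbm.restrict.sub_const _).enorm.min aemeasurable_const).pow_const q
  · refine Eventually.of_forall fun x m n hmn => ENNReal.rpow_le_rpow ?_ hq0.le
    exact min_le_min le_rfl (by exact_mod_cast hmn)
  · refine Eventually.of_forall fun x => ?_
    refine (tendsto_const_nhds.congr' ?_)
    obtain ⟨n, hn⟩ := exists_nat_ge ‖b x - ballAvg b c r‖₊
    filter_upwards [eventually_ge_atTop n] with m hm
    rw [min_eq_left]
    rw [enorm_eq_nnnorm]
    exact_mod_cast hn.trans (by exact_mod_cast hm)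

/-- John-Nirenberg on the dilated interval, plus the linear drift of the averages: the loss is only
polynomial in `k`. -/
theorem john_nirenberg_dilate {q : ℝ} (hq : 1 ≤ q) :
    ∃ C : ℝ≥0, ∀ (b : ℝ → ℂ) (β : ℝ≥0), OscBound b β → ∀ c r : ℝ, 0 < r → ∀ k : ℕ,
      ∫⁻ x in ball c (2 ^ k * r), ‖b x - ballAvg b c r‖ₑ ^ q ≤
        ENNReal.ofReal (2 * (2 ^ k * r)) * (C * β ^ q * ((k : ℝ≥0∞) + 1) ^ q) := by
  have hq0 : 0 < q := by linarith
  obtain ⟨C, hC⟩ := john_nirenberg hq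
  refine ⟨2 ^ (q - 1) * (C + 2 ^ q), fun b β hb c r hr k => ?_⟩
  have hone : (1 : ℝ≥0∞) ≤ ((k : ℝ≥0∞) + 1) ^ q := ENNReal.one_le_rpow (by simp) hq0
  calc _ ≤ ∫⁻ x in ball c (2 ^ k * r), 2 ^ (q - 1) *
        (‖b x - ballAvg b c (2 ^ k * r)‖ₑ ^ q + (2 * k * β) ^ q) := by
        refine lintegral_mono fun x => ?_
        refine le_trans ?_ (ENNReal.rpow_add_le_mul_rpow_add_rpow _ _ hq)
        refine ENNReal.rpow_le_rpow ?_ hq0.le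
        calc _ = ‖(b x - ballAvg b c (2 ^ k * r)) + (ballAvg b c (2 ^ k * r) - ballAvg b c r)‖ₑ := by
              rw [sub_add_sub_cancel]
          _ ≤ _ := (enorm_add_le _ _).trans (by gcongr; exact enorm_ballAvg_dilate_sub_le hb hr k)
    _ ≤ 2 ^ (q - 1) * (ENNReal.ofReal (2 * (2 ^ k * r)) * (C * β ^ q) +
          (2 * k * β) ^ q * ENNReal.ofReal (2 * (2 ^ k * r))) := by
        rw [lintegral_const_mul' _ _ (ENNReal.rpow_ne_top_of_nonneg (by linarith) (by simp)),
            lintegral_add_right _ measurable_const]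
        gcongr
        · exact hC b β hb _ _ (by positivity)
        · simp [Real.volume_ball]
    _ ≤ 2 ^ (q - 1) * (ENNReal.ofReal (2 * (2 ^ k * r)) * (C * β ^ q * ((k : ℝ≥0∞) + 1) ^ q) +
          (2 ^ q * ((k : ℝ≥0∞) + 1) ^ q * β ^ q) * ENNReal.ofReal (2 * (2 ^ k * r))) := by
        refine mul_le_mul_right (add_le_add (mul_le_mul_right ?_ _) (mul_le_mul_left ?_ _)) _
        · exact le_mul_of_one_le_right' hone
        · rw [ENNReal.mul_rpow_of_nonneg _ _ hq0.le, ENNReal.mul_rpow_of_nonneg _ _ hq0.le]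
          exact mul_le_mul_left (mul_le_mul_right (ENNReal.rpow_le_rpow le_self_add hq0.le) _) _
    _ = _ := by
        rw [ENNReal.coe_mul, ENNReal.coe_add, ENNReal.coe_rpow_of_nonneg _ hq0.le,
          ENNReal.coe_rpow_of_nonneg _ (by linarith : 0 ≤ q - 1)]
        simp only [ENNReal.coe_ofNat]
        ring

/-! ### Dyadic sums, weighted oscillation and Poisson averages. -/

/-- For the least `k` with `|s| < 2 ^ k r`, the larger of `r` and `|s|` is at least half of `2 ^ k
r`, so that single term already dominates. -/
theorem rpow_max_le_tsum {η : ℝ} (hη : 0 ≤ η) {r : ℝ} (hr : 0 < r) (s : ℝ) :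
    ENNReal.ofReal (max r |s| ^ (-η)) ≤ ∑' k : ℕ, ENNReal.ofReal ((2 ^ k * r / 2) ^ (-η)) *
      (ball (0 : ℝ) (2 ^ k * r)).indicator 1 s := by
  have hex : ∃ k : ℕ, |s| < 2 ^ k * r := by
    obtain ⟨k, hk⟩ := pow_unbounded_of_one_lt (|s| / r) (one_lt_two)
    exact ⟨k, by rwa [div_lt_iff₀ hr] at hk⟩
  classical
  refine le_trans ?_ (ENNReal.le_tsum (Nat.find hex))
  have hmem : s ∈ ball (0 : ℝ) (2 ^ Nat.find hex * r) := by
    rw [mem_ball, Real.dist_eq, sub_zero]; exact Nat.find_spec hex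
  rw [Set.indicator_of_mem hmem, Pi.one_apply, mul_one]
  refine ENNReal.ofReal_le_ofReal (Real.rpow_le_rpow_of_nonpos (by positivity) ?_ (by linarith))
  rcases h : Nat.find hex with _ | k
  · rw [pow_zero, one_mul]
    exact le_max_of_le_left (by linarith)
  · have := Nat.find_min hex (m := k) (by omega)
    refine le_max_of_le_right ?_
    rw [pow_succ]; linarith

theorem annulus_weight (η : ℝ) {r : ℝ} (hr : 0 < r) (k : ℕ) (z : ℝ) :
    (2 ^ k * r / 2) ^ (-η) * (2 * (2 ^ k * r)) * z =
      2 * 2 ^ η * (z * ((2 : ℝ) ^ (1 - η)) ^ k) * r ^ (1 - η) := by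
  have h2 : (0 : ℝ) < 2 := by norm_num
  have e1 : ((2 : ℝ) ^ (1 - η)) ^ k * r ^ (1 - η) = (2 ^ k * r) ^ (1 - η) := by
    rw [Real.mul_rpow (by positivity) hr.le, ← Real.rpow_natCast, ← Real.rpow_natCast,
      ← Real.rpow_mul h2.le, ← Real.rpow_mul h2.le, mul_comm (1 - η)]
  have e2 : ((2 : ℝ) ^ k * r) ^ (1 - η) = (2 ^ k * r) ^ (-η) * (2 ^ k * r) := by
    rw [sub_eq_neg_add, Real.rpow_add_one (by positivity)]
  have e3 : ((2 : ℝ) ^ k * r / 2) ^ (-η) = (2 ^ k * r) ^ (-η) * 2 ^ η := by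
    rw [Real.div_rpow (by positivity) h2.le, Real.rpow_neg h2.le, div_inv_eq_mul]
  calc _ = 2 * 2 ^ η * z * ((2 ^ k * r) ^ (-η) * (2 ^ k * r)) := by rw [e3]; ring
    _ = _ := by rw [← e2, ← e1]; ring

/-- Each dyadic interval contributes a polynomial in `k` times `2 ^ (k (1 - η))`, which is summable
as `η > 1`. The case `q = 0` serves maximal functions, positive `q` serves oscillation. -/
theorem annuli_bound {η : ℝ} (hη : 1 < η) (q : ℝ) :
    ∃ C : ℝ≥0, ∀ c r : ℝ, 0 < r → ∀ (v : ℝ → ℝ≥0∞), AEMeasurable v → ∀ A : ℝ≥0∞,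
      (∀ k : ℕ, ∫⁻ t in ball c (2 ^ k * r), v t ≤
        ENNReal.ofReal (2 * (2 ^ k * r)) * (A * ((k : ℝ≥0∞) + 1) ^ q)) →
      ∫⁻ t, v t * ENNReal.ofReal (max r |t - c| ^ (-η)) ≤
        C * ENNReal.ofReal (r ^ (1 - η)) * A := by
  -- A natural exponent above `q`, so that the series is a polynomial times a geometric one.
  set n := ⌈q⌉₊
  set a : ℕ → ℝ := fun k => 2 * 2 ^ η * (((k : ℝ) + 1) ^ n * ((2 : ℝ) ^ (1 - η)) ^ k) with ha
  have ha0 : ∀ k, 0 ≤ a k := fun k => by positivity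
  have hx1 : (2 : ℝ) ^ (1 - η) < 1 := Real.rpow_lt_one_of_one_lt_of_neg (by norm_num) (by linarith)
  have hx0 : 0 < (2 : ℝ) ^ (1 - η) := by positivity
  have hsum : Summable a := by
    refine Summable.mul_left _ ?_
    have h := (summable_nat_add_iff 1).2 (summable_pow_mul_geometric_of_norm_lt_one n
      (r := (2 : ℝ) ^ (1 - η)) (by rwa [Real.norm_of_nonneg hx0.le]))
    have h2 := h.mul_left ((2 : ℝ) ^ (1 - η))⁻¹
    refine h2.congr fun k => ?_
    push_cast
    field_simp
    ring
  refine ⟨Real.toNNReal (∑' k, a k), fun c r hr v hv A hA => ?_⟩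
  have hmeas : ∀ k : ℕ, AEMeasurable fun t => v t * (ENNReal.ofReal ((2 ^ k * r / 2) ^ (-η)) *
      (ball (0 : ℝ) (2 ^ k * r)).indicator 1 (t - c)) := by
    intro k
    refine hv.mul (Measurable.aemeasurable ?_)
    refine Measurable.const_mul ?_ _
    exact (measurable_one.indicator measurableSet_ball).comp (measurable_id.sub_const c)
  calc ∫⁻ t, v t * ENNReal.ofReal (max r |t - c| ^ (-η))
      ≤ ∫⁻ t, ∑' k : ℕ, v t * (ENNReal.ofReal ((2 ^ k * r / 2) ^ (-η)) *
          (ball (0 : ℝ) (2 ^ k * r)).indicator 1 (t - c)) := by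
        refine lintegral_mono fun t => ?_
        rw [ENNReal.tsum_mul_left]
        exact mul_le_mul_right (rpow_max_le_tsum (by linarith) hr _) _
    _ = ∑' k : ℕ, ∫⁻ t, v t * (ENNReal.ofReal ((2 ^ k * r / 2) ^ (-η)) *
          (ball (0 : ℝ) (2 ^ k * r)).indicator 1 (t - c)) := lintegral_tsum hmeas
    _ = ∑' k : ℕ, ENNReal.ofReal ((2 ^ k * r / 2) ^ (-η)) * ∫⁻ t in ball c (2 ^ k * r), v t := by
        refine tsum_congr fun k => ?_
        rw [← lintegral_const_mul' _ _ ENNReal.ofReal_ne_top,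
          ← lintegral_indicator measurableSet_ball]
        refine lintegral_congr fun t => ?_
        by_cases h : t ∈ ball c (2 ^ k * r)
        · have h' : t - c ∈ ball (0 : ℝ) (2 ^ k * r) := by
            simpa [Real.dist_eq] using h
          rw [Set.indicator_of_mem h, Set.indicator_of_mem h']
          simp [mul_comm]
        · have h' : t - c ∉ ball (0 : ℝ) (2 ^ k * r) := by
            simpa [Real.dist_eq] using h
          rw [Set.indicator_of_notMem h, Set.indicator_of_notMem h']
          simp
    _ ≤ ∑' k : ℕ, ENNReal.ofReal (a k) * (ENNReal.ofReal (r ^ (1 - η)) * A) := by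
        refine ENNReal.tsum_le_tsum fun k => ?_
        refine (mul_le_mul_right (hA k) _).trans ?_
        have e1 : ((k : ℝ≥0∞) + 1) ^ q ≤ ENNReal.ofReal (((k : ℝ) + 1) ^ n) := by
          calc ((k : ℝ≥0∞) + 1) ^ q ≤ ((k : ℝ≥0∞) + 1) ^ (n : ℝ) :=
                ENNReal.rpow_le_rpow_of_exponent_le (by simp) (Nat.le_ceil q)
            _ = _ := by
                rw [ENNReal.rpow_natCast, ENNReal.ofReal_pow (by positivity),
                  ENNReal.ofReal_add (by positivity) (by norm_num)]
                simp
        calc _ ≤ ENNReal.ofReal ((2 ^ k * r / 2) ^ (-η)) * (ENNReal.ofReal (2 * (2 ^ k * r)) *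
              (A * ENNReal.ofReal (((k : ℝ) + 1) ^ n))) := by gcongr
          _ = ENNReal.ofReal ((2 ^ k * r / 2) ^ (-η) * (2 * (2 ^ k * r)) * ((k : ℝ) + 1) ^ n) *
              A := by
              rw [ENNReal.ofReal_mul (q := ((k : ℝ) + 1) ^ n) (by positivity),
                ENNReal.ofReal_mul (q := 2 * (2 ^ k * r)) (by positivity)]
              ring
          _ = _ := by
              rw [← mul_assoc (ENNReal.ofReal (a k)), ← ENNReal.ofReal_mul (ha0 k)]
              congr 2
              exact annulus_weight η hr k _
    _ = _ := by
        rw [ENNReal.tsum_mul_right, ← ENNReal.ofReal_tsum_of_nonneg ha0 hsum, mul_assoc]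
        rfl

theorem lintegral_rpow_max_ne_top {η : ℝ} (hη : 1 < η) (c : ℝ) {r : ℝ} (hr : 0 < r) :
    ∫⁻ t, ENNReal.ofReal (max r |t - c| ^ (-η)) ≠ ∞ := by
  obtain ⟨C, hC⟩ := annuli_bound hη 0
  have h := hC c r hr 1 aemeasurable_const 1 fun k => by simp [Real.volume_ball]
  simp only [Pi.one_apply, one_mul, mul_one] at h
  exact (h.trans_lt (ENNReal.mul_lt_top (by simp) (by simp))).ne

/-- Weighted oscillation bounds for a function of bounded mean oscillation. -/
theorem osc_weighted_bound {η q : ℝ} (hη : 1 < η) (hq : 1 ≤ q) :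
    ∃ C : ℝ≥0, ∀ (b : ℝ → ℂ) (β : ℝ≥0), OscBound b β → ∀ c r : ℝ, 0 < r →
      ∫⁻ t, ‖b t - ballAvg b c r‖ₑ ^ q * ENNReal.ofReal (max r |t - c| ^ (-η)) ≤
        C * ENNReal.ofReal (r ^ (1 - η)) * β ^ q := by
  obtain ⟨C, hC⟩ := annuli_bound hη q
  obtain ⟨D, hD⟩ := john_nirenberg_dilate hq
  refine ⟨C * D, fun b β hb c r hr => ?_⟩
  have hbm : AEMeasurable b := hb.locInt.aestronglyMeasurable.aemeasurable
  refine (hC c r hr _ ((hbm.sub_const _).enorm.pow_const q) _ (hD b β hb c r hr)).trans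
    (le_of_eq ?_)
  push_cast
  ring

/-- The Poisson kernel of the half plane, up to the factor `π`. -/
noncomputable def poisson (d t : ℝ) : ℝ := d / (t ^ 2 + d ^ 2)

theorem poisson_nonneg {d : ℝ} (hd : 0 < d) (t : ℝ) : 0 ≤ poisson d t := by
  unfold poisson; positivity

theorem continuous_poisson {d : ℝ} (hd : 0 < d) : Continuous (poisson d) := by
  unfold poisson
  exact continuous_const.div (by fun_prop) fun t => by positivity

theorem poisson_le_rpow {d : ℝ} (hd : 0 < d) (t : ℝ) :
    poisson d t ≤ d * max d |t| ^ (-2 : ℝ) := by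
  have hm : 0 < max d |t| := lt_max_of_lt_left hd
  rw [Real.rpow_neg hm.le, Real.rpow_two, poisson, div_eq_mul_inv]
  gcongr
  rcases le_total d |t| with h | h
  · rw [max_eq_right h, sq_abs]; nlinarith
  · rw [max_eq_left h]; nlinarith [sq_nonneg t]

/-- The maximal function may be taken at any point `y` of the interval because all concentric
dilates of the interval contain `y`. -/
theorem poisson_le_maximal : ∃ C : ℝ≥0, ∀ (u : ℝ → ℝ≥0∞), AEMeasurable u → ∀ c r y : ℝ,
    y ∈ ball c r → ∫⁻ t, u t * ENNReal.ofReal (poisson r (t - c)) ≤ C * hlMaximal u y := by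
  obtain ⟨C, hC⟩ := annuli_bound (η := 2) (by norm_num) 0
  refine ⟨C, fun u hu c r y hy => ?_⟩
  have hr : 0 < r := pos_of_mem_ball hy
  have h := hC c r hr u hu (hlMaximal u y) fun k => by
    simp only [ENNReal.rpow_zero, mul_one]
    refine lintegral_ball_le_maximal u (ball_subset_ball ?_ hy)
    exact le_mul_of_one_le_left hr.le (one_le_pow₀ (by norm_num))
  calc ∫⁻ t, u t * ENNReal.ofReal (poisson r (t - c))
      ≤ ∫⁻ t, ENNReal.ofReal r * (u t * ENNReal.ofReal (max r |t - c| ^ (-2 : ℝ))) := by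
        refine lintegral_mono fun t => ?_
        rw [mul_left_comm, ← ENNReal.ofReal_mul hr.le]
        gcongr
        exact poisson_le_rpow hr _
    _ = ENNReal.ofReal r * ∫⁻ t, u t * ENNReal.ofReal (max r |t - c| ^ (-2 : ℝ)) :=
        lintegral_const_mul' _ _ ENNReal.ofReal_ne_top
    _ ≤ ENNReal.ofReal r * (C * ENNReal.ofReal (r ^ (1 - 2 : ℝ)) * hlMaximal u y) := by gcongr
    _ = _ := by
        rw [show (1 - 2 : ℝ) = -1 by norm_num, Real.rpow_neg_one,
          show ∀ a b c d : ℝ≥0∞, a * (b * c * d) = (a * c) * (b * d) from fun a b c d => by ring,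
          ← ENNReal.ofReal_mul hr.le, mul_inv_cancel₀ hr.ne', ENNReal.ofReal_one, one_mul]

theorem osc_poisson_bound {q : ℝ} (hq : 1 ≤ q) :
    ∃ C : ℝ≥0, ∀ (b : ℝ → ℂ) (β : ℝ≥0), OscBound b β → ∀ c r : ℝ, 0 < r →
      ∫⁻ t, ‖b t - ballAvg b c r‖ₑ ^ q * ENNReal.ofReal (poisson r (t - c)) ≤ C * β ^ q := by
  obtain ⟨C, hC⟩ := osc_weighted_bound (η := 2) (by norm_num) hq
  refine ⟨C, fun b β hb c r hr => ?_⟩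
  calc _ ≤ ∫⁻ t, ENNReal.ofReal r * (‖b t - ballAvg b c r‖ₑ ^ q *
          ENNReal.ofReal (max r |t - c| ^ (-2 : ℝ))) := by
        refine lintegral_mono fun t => ?_
        rw [mul_left_comm, ← ENNReal.ofReal_mul hr.le]
        gcongr
        exact poisson_le_rpow hr _
    _ = _ := lintegral_const_mul' _ _ ENNReal.ofReal_ne_top
    _ ≤ ENNReal.ofReal r * (C * ENNReal.ofReal (r ^ (1 - 2 : ℝ)) * β ^ q) := by
        gcongr; exact hC b β hb c r hr
    _ = _ := by
        rw [show (1 - 2 : ℝ) = -1 by norm_num, Real.rpow_neg_one,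
          show ∀ a b c d : ℝ≥0∞, a * (b * c * d) = (a * c) * (b * d) from fun a b c d => by ring,
          ← ENNReal.ofReal_mul hr.le, mul_inv_cancel₀ hr.ne', ENNReal.ofReal_one, one_mul]

theorem indicator_ball_le_poisson {c r : ℝ} (hr : 0 < r) (k : ℝ) (hk : 0 < k) {t : ℝ}
    (ht : t ∈ ball c (k * r)) :
    1 ≤ ENNReal.ofReal ((k ^ 2 + 1) * r) * ENNReal.ofReal (poisson r (t - c)) := by
  rw [← ENNReal.ofReal_mul (by positivity), ENNReal.one_le_ofReal, poisson, mul_div_assoc',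
    le_div_iff₀ (by positivity)]
  rw [mem_ball, Real.dist_eq] at ht
  have : (t - c) ^ 2 ≤ (k * r) ^ 2 := by
    rw [← sq_abs]; exact pow_le_pow_left₀ (abs_nonneg _) ht.le 2
  nlinarith

theorem setLIntegral_ball_le_poisson (u : ℝ → ℝ≥0∞) {c r : ℝ} (hr : 0 < r) (k : ℝ) (hk : 0 < k) :
    ∫⁻ t in ball c (k * r), u t ≤ ENNReal.ofReal ((k ^ 2 + 1) * r) *
      ∫⁻ t, u t * ENNReal.ofReal (poisson r (t - c)) := by
  rw [← lintegral_const_mul' _ _ ENNReal.ofReal_ne_top, ← lintegral_indicator measurableSet_ball]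
  refine lintegral_mono fun t => ?_
  by_cases ht : t ∈ ball c (k * r)
  · rw [Set.indicator_of_mem ht, mul_left_comm]
    exact le_mul_of_one_le_right' (indicator_ball_le_poisson hr k hk ht)
  · rw [Set.indicator_of_notMem ht]; exact zero_le

/-! ### The Cauchy and Poisson kernels and their convolutions. -/

/-- The Cauchy kernel `1 / (t + i d)`. -/
noncomputable def cauchyKer (d t : ℝ) : ℂ := ((t : ℂ) + d * Complex.I)⁻¹

theorem add_mul_I_ne_zero {d : ℝ} (hd : d ≠ 0) (t : ℝ) : (t : ℂ) + d * Complex.I ≠ 0 := fun h => by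
  have := congrArg Complex.im h
  simp at this
  exact hd this

theorem continuous_cauchyKer {d : ℝ} (hd : d ≠ 0) : Continuous (cauchyKer d) := by
  unfold cauchyKer
  exact Continuous.inv₀ (by fun_prop) fun t => add_mul_I_ne_zero hd t

theorem norm_add_mul_I_sq (t d : ℝ) : ‖(t : ℂ) + d * Complex.I‖ ^ 2 = t ^ 2 + d ^ 2 := by
  rw [← Complex.normSq_eq_norm_sq, Complex.normSq_add_mul_I]

theorem norm_cauchyKer_sq (d t : ℝ) : ‖cauchyKer d t‖ ^ 2 = (t ^ 2 + d ^ 2)⁻¹ := by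
  rw [cauchyKer, norm_inv, inv_pow, norm_add_mul_I_sq]

theorem norm_cauchyKer_le {d : ℝ} (hd : d ≠ 0) (t : ℝ) :
    ‖cauchyKer d t‖ ≤ max |d| |t| ^ (-1 : ℝ) := by
  have hm : 0 < max |d| |t| := lt_max_of_lt_left (abs_pos.2 hd)
  have h1 : |d| ≤ ‖(t : ℂ) + d * Complex.I‖ := by
    simpa using Complex.abs_im_le_norm ((t : ℂ) + d * Complex.I)
  have h2 : |t| ≤ ‖(t : ℂ) + d * Complex.I‖ := by
    simpa using Complex.abs_re_le_norm ((t : ℂ) + d * Complex.I)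
  rw [Real.rpow_neg_one, cauchyKer, norm_inv]
  exact inv_anti₀ hm (max_le h1 h2)

theorem conj_cauchyKer (d t : ℝ) : (starRingEnd ℂ) (cauchyKer d t) = cauchyKer (-d) t := by
  simp [cauchyKer]

theorem cauchyKer_neg_neg (d t : ℝ) : cauchyKer (-d) (-t) = -cauchyKer d t := by
  rw [cauchyKer, cauchyKer, ← inv_neg]
  congr 1
  push_cast; ring

theorem cauchyKer_im (d t : ℝ) : (cauchyKer d t).im = -poisson d t := by
  rw [cauchyKer, Complex.inv_im, Complex.normSq_add_mul_I, poisson]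
  simp [neg_div]

theorem integrable_poisson {d : ℝ} (hd : 0 < d) : Integrable (poisson d) := by
  have h := (integrable_inv_one_add_sq.comp_div hd.ne').const_mul d⁻¹
  refine h.congr (Eventually.of_forall fun t => ?_)
  simp only [poisson]
  field_simp
  ring

theorem integral_poisson {d : ℝ} (hd : 0 < d) : ∫ t, poisson d t = Real.pi := by
  have h : poisson d = fun t => d⁻¹ * (1 + (t / d) ^ 2)⁻¹ := by
    ext t
    simp only [poisson]
    field_simp
    ring
  rw [h, integral_const_mul, Measure.integral_comp_div (fun t : ℝ => (1 + t ^ 2)⁻¹),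
    integral_univ_inv_one_add_sq, smul_eq_mul, abs_of_pos hd, inv_mul_cancel_left₀ hd.ne']

theorem lintegral_poisson {d : ℝ} (hd : 0 < d) :
    ∫⁻ t, ENNReal.ofReal (poisson d t) = ENNReal.ofReal Real.pi := by
  rw [← ofReal_integral_eq_lintegral_ofReal (integrable_poisson hd)
    (Eventually.of_forall (poisson_nonneg hd)), integral_poisson hd]

theorem lintegral_poisson_sub {d : ℝ} (hd : 0 < d) (x : ℝ) :
    ∫⁻ t, ENNReal.ofReal (poisson d (t - x)) = ENNReal.ofReal Real.pi := by
  rw [lintegral_sub_right_eq_self (fun t => ENNReal.ofReal (poisson d t)), lintegral_poisson hd]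

theorem integrable_norm_cauchyKer_sq {d : ℝ} (hd : d ≠ 0) :
    Integrable fun t => ‖cauchyKer d t‖ ^ 2 := by
  have hd' : 0 < |d| := abs_pos.2 hd
  refine ((integrable_poisson hd').const_mul |d|⁻¹).congr (Eventually.of_forall fun t => ?_)
  simp only [norm_cauchyKer_sq, poisson, sq_abs]
  field_simp

theorem integrable_cauchyKer_mul {d e : ℝ} (hd : d ≠ 0) (he : e ≠ 0) (x : ℝ) :
    Integrable fun t => cauchyKer d (x - t) * cauchyKer e t := by
  have hi := (((integrable_norm_cauchyKer_sq hd).comp_sub_left x).add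
    (integrable_norm_cauchyKer_sq he))
  refine hi.mono' (Continuous.aestronglyMeasurable ?_) (Eventually.of_forall fun t => ?_)
  · have := continuous_cauchyKer hd
    have := continuous_cauchyKer he
    fun_prop
  · rw [norm_mul]
    simp only [Pi.add_apply]
    nlinarith [sq_nonneg (‖cauchyKer d (x - t)‖ - ‖cauchyKer e t‖),
      sq_nonneg (‖cauchyKer d (x - t)‖), sq_nonneg (‖cauchyKer e t‖)]

theorem tendsto_log_add_sub_log (w : ℂ) :
    Tendsto (fun t : ℝ => Complex.log (t + w) - Real.log t) atTop (𝓝 0) := by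
  have h1 : Tendsto (fun t : ℝ => 1 + w * ((t⁻¹ : ℝ) : ℂ)) atTop (𝓝 1) := by
    have := (Complex.continuous_ofReal.tendsto 0).comp (tendsto_inv_atTop_zero (𝕜 := ℝ))
    simpa using (this.const_mul w).const_add 1
  have h2 : Tendsto (fun t : ℝ => Complex.log (1 + w * ((t⁻¹ : ℝ) : ℂ))) atTop (𝓝 0) := by
    have hc : ContinuousAt Complex.log 1 := continuousAt_clog Complex.one_mem_slitPlane
    have h3 := hc.tendsto.comp h1
    rwa [Complex.log_one] at h3
  refine h2.congr' ?_
  have hne : ∀ᶠ t : ℝ in atTop, (1 + w * ((t⁻¹ : ℝ) : ℂ)) ≠ 0 :=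
    h1.eventually_ne one_ne_zero
  filter_upwards [hne, eventually_gt_atTop 0] with t ht ht0
  have ht' : (t : ℂ) ≠ 0 := by exact_mod_cast ht0.ne'
  have e : (t : ℂ) + w = (t : ℂ) * (1 + w * ((t⁻¹ : ℝ) : ℂ)) := by
    push_cast; field_simp
  rw [e, Complex.log_ofReal_mul ht0 ht]
  simp

/-- Moves the logarithm across its branch cut, so that the behaviour along lines going to `-∞` can
be read off from the right half plane. -/
theorem log_eq_log_neg_add {w : ℂ} (hw : 0 < w.im) :
    Complex.log w = Complex.log (-w) + Real.pi * Complex.I := by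
  simp only [Complex.log, norm_neg, Complex.arg_neg_eq_arg_sub_pi_of_im_pos hw]
  push_cast; ring

theorem log_eq_log_neg_sub {w : ℂ} (hw : w.im < 0) :
    Complex.log w = Complex.log (-w) - Real.pi * Complex.I := by
  simp only [Complex.log, norm_neg, Complex.arg_neg_eq_arg_add_pi_of_im_neg hw]
  push_cast; ring

theorem tendsto_log_sub_log (v w : ℂ) :
    Tendsto (fun t : ℝ => Complex.log (t + v) - Complex.log (t + w)) atTop (𝓝 0) := by
  have := (tendsto_log_add_sub_log v).sub (tendsto_log_add_sub_log w)
  simpa using this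

theorem hasDerivAt_log_line {e : ℝ} (he : e ≠ 0) (t : ℝ) :
    HasDerivAt (fun t : ℝ => Complex.log ((t : ℂ) + e * Complex.I)) (cauchyKer e t) t := by
  have h1 : HasDerivAt (fun t : ℝ => (t : ℂ) + e * Complex.I) 1 t :=
    (Complex.ofRealCLM.hasDerivAt (x := t)).add_const _
  have h2 := h1.clog_real (x := t) (Or.inr (by simpa using he))
  rwa [one_div] at h2

theorem hasDerivAt_log_line_sub {e : ℝ} (he : e ≠ 0) (x t : ℝ) :
    HasDerivAt (fun t : ℝ => Complex.log (((x - t : ℝ) : ℂ) + e * Complex.I))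
      (-cauchyKer e (x - t)) t := by
  have := (hasDerivAt_log_line he (x - t)).scomp t ((hasDerivAt_id t).const_sub x)
  rw [neg_one_smul] at this
  exact this

theorem cauchyKer_partial_fractions {d e x t : ℝ} (hd : d ≠ 0) (he : e ≠ 0)
    (hz : (x : ℂ) + ((d + e : ℝ) : ℂ) * Complex.I ≠ 0) :
    cauchyKer (d + e) x * (cauchyKer e t - -cauchyKer d (x - t)) =
      cauchyKer d (x - t) * cauchyKer e t := by
  have h1 := add_mul_I_ne_zero he t
  have h2 := add_mul_I_ne_zero hd (x - t)
  simp only [cauchyKer]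
  rw [sub_neg_eq_add, inv_add_inv h1 h2]
  have h3 : (t : ℂ) + e * Complex.I + (((x - t : ℝ) : ℂ) + d * Complex.I) =
      (x : ℂ) + ((d + e : ℝ) : ℂ) * Complex.I := by push_cast; ring
  rw [h3, ← mul_div_assoc, inv_mul_cancel₀ hz, ← mul_inv, one_div, mul_comm]

theorem tendsto_log_line_atBot {e : ℝ} (he : 0 < e) (d x : ℝ) :
    Tendsto (fun t : ℝ => Complex.log ((t : ℂ) + e * Complex.I) -
      Complex.log (((x - t : ℝ) : ℂ) + d * Complex.I)) atBot (𝓝 (Real.pi * Complex.I)) := by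
  have h := ((tendsto_log_sub_log (-(e * Complex.I)) (x + d * Complex.I)).comp
    tendsto_neg_atBot_atTop).add_const (Real.pi * Complex.I : ℂ)
  rw [zero_add] at h
  refine h.congr fun t => ?_
  simp only [Function.comp_apply]
  rw [log_eq_log_neg_add (w := (t : ℂ) + e * Complex.I) (by simpa using he)]
  rw [show ((-t : ℝ) : ℂ) + -(e * Complex.I) = -((t : ℂ) + e * Complex.I) by push_cast; ring,
    show ((-t : ℝ) : ℂ) + (x + d * Complex.I) = ((x - t : ℝ) : ℂ) + d * Complex.I by
      push_cast; ring]
  ring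

theorem tendsto_log_line_atTop_of_pos {d : ℝ} (hd : 0 < d) (e x : ℝ) :
    Tendsto (fun t : ℝ => Complex.log ((t : ℂ) + e * Complex.I) -
      Complex.log (((x - t : ℝ) : ℂ) + d * Complex.I)) atTop (𝓝 (-(Real.pi * Complex.I))) := by
  have h := (tendsto_log_sub_log (e * Complex.I) (-x - d * Complex.I)).sub_const
    (Real.pi * Complex.I : ℂ)
  rw [zero_sub] at h
  refine h.congr fun t => ?_
  rw [log_eq_log_neg_add (w := ((x - t : ℝ) : ℂ) + d * Complex.I) (by simpa using hd),
    show -(((x - t : ℝ) : ℂ) + d * Complex.I) = (t : ℂ) + (-x - d * Complex.I) by push_cast; ring]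
  ring

theorem tendsto_log_line_atTop_of_neg {d : ℝ} (hd : d < 0) (e x : ℝ) :
    Tendsto (fun t : ℝ => Complex.log ((t : ℂ) + e * Complex.I) -
      Complex.log (((x - t : ℝ) : ℂ) + d * Complex.I)) atTop (𝓝 (Real.pi * Complex.I)) := by
  have h := (tendsto_log_sub_log (e * Complex.I) (-x - d * Complex.I)).add_const
    (Real.pi * Complex.I : ℂ)
  rw [zero_add] at h
  refine h.congr fun t => ?_
  rw [log_eq_log_neg_sub (w := ((x - t : ℝ) : ℂ) + d * Complex.I) (by simpa using hd),
    show -(((x - t : ℝ) : ℂ) + d * Complex.I) = (t : ℂ) + (-x - d * Complex.I) by push_cast; ring]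
  ring

/-- Partial fractions write the product as a constant times the derivative of a difference of
logarithms, so only the limits at both ends count. The limit at `-∞` is `π i`; the one at `+∞`
depends on the sign of `d`, which decides the side of the cut along which `x - t + i d` escapes. -/
theorem integral_cauchyKer_mul_eq {d e x : ℝ} {L : ℂ} (hd : d ≠ 0) (he : 0 < e)
    (hz : (x : ℂ) + ((d + e : ℝ) : ℂ) * Complex.I ≠ 0)
    (hL : Tendsto (fun t : ℝ => Complex.log ((t : ℂ) + e * Complex.I) -
      Complex.log (((x - t : ℝ) : ℂ) + d * Complex.I)) atTop (𝓝 L)) :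
    ∫ t, cauchyKer d (x - t) * cauchyKer e t =
      cauchyKer (d + e) x * (L - Real.pi * Complex.I) := by
  have h := integral_of_hasDerivAt_of_tendsto
    (f := fun t : ℝ => cauchyKer (d + e) x * (Complex.log ((t : ℂ) + e * Complex.I) -
      Complex.log (((x - t : ℝ) : ℂ) + d * Complex.I)))
    (f' := fun t => cauchyKer d (x - t) * cauchyKer e t)
    (fun t => by
      rw [← cauchyKer_partial_fractions hd he.ne' hz]
      exact ((hasDerivAt_log_line he.ne' t).sub (hasDerivAt_log_line_sub hd x t)).const_mul _)
    (integrable_cauchyKer_mul hd he.ne' x)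
    ((tendsto_log_line_atBot he d x).const_mul _) (hL.const_mul _)
  rw [h]; ring

theorem integral_cauchyKer_mul {d e : ℝ} (hd : 0 < d) (he : 0 < e) (x : ℝ) :
    ∫ t, cauchyKer d (x - t) * cauchyKer e t = -2 * Real.pi * Complex.I * cauchyKer (d + e) x := by
  rw [integral_cauchyKer_mul_eq hd.ne' he (add_mul_I_ne_zero (by positivity) x)
    (tendsto_log_line_atTop_of_pos hd e x)]
  ring

/-- For opposite heights the two end limits agree. The condition `x ≠ 0` keeps the denominator `x +
i (e - d)` from vanishing when `d = e`; later it excludes a null set. -/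
theorem integral_cauchyKer_neg_mul {d e : ℝ} (hd : 0 < d) (he : 0 < e) {x : ℝ} (hx : x ≠ 0) :
    ∫ t, cauchyKer (-d) (x - t) * cauchyKer e t = 0 := by
  rw [integral_cauchyKer_mul_eq (neg_ne_zero.2 hd.ne') he (fun h => hx ?_)
    (tendsto_log_line_atTop_of_neg (neg_neg_of_pos hd) e x)]
  · ring
  · simpa using congrArg Complex.re h

theorem poisson_eq_cauchyKer (d t : ℝ) :
    (poisson d t : ℂ) = (cauchyKer (-d) t - cauchyKer d t) / (2 * Complex.I) := by
  rw [← conj_cauchyKer]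
  have h := Complex.sub_conj (cauchyKer d t)
  rw [← neg_sub, h, cauchyKer_im]
  have := Complex.I_ne_zero
  field_simp
  push_cast; ring

/-- The Poisson semigroup acts on the Cauchy kernels. -/
theorem integral_poisson_mul_cauchyKer {d e : ℝ} (hd : 0 < d) (he : 0 < e) {x : ℝ} (hx : x ≠ 0) :
    ∫ t, (poisson d (x - t) : ℂ) * cauchyKer e t = Real.pi * cauchyKer (d + e) x := by
  have e1 : (fun t => (poisson d (x - t) : ℂ) * cauchyKer e t) = fun t =>
      (cauchyKer (-d) (x - t) * cauchyKer e t - cauchyKer d (x - t) * cauchyKer e t) /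
        (2 * Complex.I) := by
    ext t
    rw [poisson_eq_cauchyKer]; ring
  rw [e1, integral_div, integral_sub (integrable_cauchyKer_mul (neg_ne_zero.2 hd.ne') he.ne' x)
    (integrable_cauchyKer_mul hd.ne' he.ne' x), integral_cauchyKer_neg_mul hd he hx,
    integral_cauchyKer_mul hd he]
  have := Complex.I_ne_zero
  field_simp
  ring

/-! ### Cauchy integrals: decay, transposition, composition and the `L²` bound. -/

/-- The Cauchy integral along the line at height `d`. -/
noncomputable def cauchyOp (d : ℝ) (f : ℝ → ℂ) (x : ℝ) : ℂ := ∫ t, cauchyKer d (x - t) * f t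

theorem lintegral_cauchyKer_rpow_ne_top {d : ℝ} (hd : d ≠ 0) {q : ℝ} (hq : 1 < q) :
    ∫⁻ t, ‖cauchyKer d t‖ₑ ^ q ≠ ∞ := by
  have h := lintegral_rpow_max_ne_top hq 0 (abs_pos.2 hd)
  refine ((lintegral_mono fun t => ?_).trans_lt (lt_top_iff_ne_top.2 h)).ne
  have hm : 0 < max |d| |t| := lt_max_of_lt_left (abs_pos.2 hd)
  rw [← ofReal_norm, ENNReal.ofReal_rpow_of_nonneg (norm_nonneg _) (by linarith), sub_zero]
  refine ENNReal.ofReal_le_ofReal ?_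
  calc ‖cauchyKer d t‖ ^ q ≤ (max |d| |t| ^ (-1 : ℝ)) ^ q :=
        Real.rpow_le_rpow (norm_nonneg _) (norm_cauchyKer_le hd t) (by linarith)
    _ = _ := by rw [← Real.rpow_mul hm.le, neg_one_mul]

theorem lintegral_cauchyKer_mul_le {d : ℝ} (hd : d ≠ 0) {p q : ℝ} (hpq : p.HolderConjugate q)
    {f : ℝ → ℂ} (hf : AEStronglyMeasurable f) (x : ℝ) :
    ∫⁻ t, ‖cauchyKer d (x - t)‖ₑ * ‖f t‖ₑ ≤
      (∫⁻ t, ‖cauchyKer d t‖ₑ ^ q) ^ (1 / q) * (∫⁻ t, ‖f t‖ₑ ^ p) ^ (1 / p) := by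
  have hc : Continuous fun t => cauchyKer d (x - t) :=
    (continuous_cauchyKer hd).comp (continuous_const.sub continuous_id)
  have h := ENNReal.lintegral_mul_le_Lp_mul_Lq volume hpq.symm
    (hc.aestronglyMeasurable.enorm) hf.enorm
  rwa [lintegral_sub_left_eq_self (fun t => ‖cauchyKer d t‖ₑ ^ q)] at h

theorem lintegral_cauchyKer_mul_ne_top {d : ℝ} (hd : d ≠ 0) {p : ℝ} (hp : 1 < p)
    {f : ℝ → ℂ} (hf : AEStronglyMeasurable f) (hfp : ∫⁻ t, ‖f t‖ₑ ^ p ≠ ∞) :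
    ∃ K : ℝ≥0, ∀ x, ∫⁻ t, ‖cauchyKer d (x - t)‖ₑ * ‖f t‖ₑ ≤ K := by
  have hpq := Real.HolderConjugate.conjExponent hp
  have h1 : (∫⁻ t, ‖cauchyKer d t‖ₑ ^ p.conjExponent) ^ (1 / p.conjExponent) ≠ ∞ :=
    ENNReal.rpow_ne_top_of_nonneg (by have := hpq.symm.pos; positivity)
      (lintegral_cauchyKer_rpow_ne_top hd hpq.symm.lt)
  have h2 : (∫⁻ t, ‖f t‖ₑ ^ p) ^ (1 / p) ≠ ∞ :=
    ENNReal.rpow_ne_top_of_nonneg (by have := hpq.pos; positivity) hfp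
  refine ⟨(_ : ℝ≥0∞).toNNReal, fun x => (lintegral_cauchyKer_mul_le hd hpq hf x).trans
    (ENNReal.coe_toNNReal (ENNReal.mul_ne_top h1 h2)).ge⟩

theorem integrable_mul_of_lintegral {k f : ℝ → ℂ} (hk : AEStronglyMeasurable k)
    (hf : AEStronglyMeasurable f) (h : ∫⁻ t, ‖k t‖ₑ * ‖f t‖ₑ ≠ ∞) :
    Integrable fun t => k t * f t := by
  refine ⟨hk.mul hf, ?_⟩
  rw [hasFiniteIntegral_iff_enorm]
  simpa only [enorm_mul] using lt_top_iff_ne_top.2 h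

theorem continuous_cauchyKer_sub {d : ℝ} (hd : d ≠ 0) (x : ℝ) :
    Continuous fun t => cauchyKer d (x - t) :=
  (continuous_cauchyKer hd).comp (continuous_const.sub continuous_id)

theorem integrable_cauchyKer_mul_of_rpow {d : ℝ} (hd : d ≠ 0) {p : ℝ} (hp : 1 < p)
    {f : ℝ → ℂ} (hf : AEStronglyMeasurable f) (hfp : ∫⁻ t, ‖f t‖ₑ ^ p ≠ ∞) (x : ℝ) :
    Integrable fun t => cauchyKer d (x - t) * f t := by
  obtain ⟨K, hK⟩ := lintegral_cauchyKer_mul_ne_top hd hp hf hfp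
  exact integrable_mul_of_lintegral (continuous_cauchyKer_sub hd x).aestronglyMeasurable hf
    ((hK x).trans_lt ENNReal.coe_lt_top).ne

theorem enorm_cauchyOp_le (d : ℝ) (f : ℝ → ℂ) (x : ℝ) :
    ‖cauchyOp d f x‖ₑ ≤ ∫⁻ t, ‖cauchyKer d (x - t)‖ₑ * ‖f t‖ₑ := by
  simp only [← enorm_mul]
  exact enorm_integral_le_lintegral_enorm _

theorem aestronglyMeasurable_convKer {k : ℝ → ℂ} (hk : Continuous k) {f : ℝ → ℂ}
    (hf : AEStronglyMeasurable f) :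
    AEStronglyMeasurable (fun z : ℝ × ℝ => k (z.1 - z.2) * f z.2) (volume.prod volume) :=
  (hk.comp (continuous_fst.sub continuous_snd)).aestronglyMeasurable.mul hf.comp_snd

theorem aestronglyMeasurable_conv {k : ℝ → ℂ} (hk : Continuous k) {f : ℝ → ℂ}
    (hf : AEStronglyMeasurable f) : AEStronglyMeasurable fun x => ∫ t, k (x - t) * f t :=
  (aestronglyMeasurable_convKer hk hf).integral_prod_right'

theorem aestronglyMeasurable_cauchyOp {d : ℝ} (hd : d ≠ 0) {f : ℝ → ℂ}
    (hf : AEStronglyMeasurable f) : AEStronglyMeasurable (cauchyOp d f) :=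
  aestronglyMeasurable_conv (continuous_cauchyKer hd) hf

theorem cauchyOp_conj (d : ℝ) (f : ℝ → ℂ) (x : ℝ) :
    cauchyOp (-d) (fun t => (starRingEnd ℂ) (f t)) x = (starRingEnd ℂ) (cauchyOp d f x) := by
  simp only [cauchyOp]
  rw [← integral_conj]
  simp only [map_mul, conj_cauchyKer]

/-- Bounded functions vanishing outside a bounded interval. -/
structure BoundedSupp (f : ℝ → ℂ) (R N : ℝ) : Prop where
  meas : AEStronglyMeasurable f
  bound : ∀ x, ‖f x‖ ≤ N
  supp : ∀ x, x ∉ ball (0 : ℝ) R → f x = 0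

theorem BoundedSupp.nonneg {f : ℝ → ℂ} {R N : ℝ} (hf : BoundedSupp f R N) : 0 ≤ N :=
  (norm_nonneg _).trans (hf.bound 0)

theorem BoundedSupp.enorm_le {f : ℝ → ℂ} {R N : ℝ} (hf : BoundedSupp f R N) (x : ℝ) :
    ‖f x‖ₑ ≤ (ball (0 : ℝ) R).indicator (fun _ => ENNReal.ofReal N) x := by
  by_cases hx : x ∈ ball (0 : ℝ) R
  · rw [Set.indicator_of_mem hx, ← ofReal_norm]
    exact ENNReal.ofReal_le_ofReal (hf.bound x)
  · rw [Set.indicator_of_notMem hx, hf.supp x hx]; simp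

theorem BoundedSupp.lintegral_rpow_ne_top {f : ℝ → ℂ} {R N : ℝ} (hf : BoundedSupp f R N) {p : ℝ}
    (hp : 0 < p) : ∫⁻ x, ‖f x‖ₑ ^ p ≠ ∞ := by
  have h : ∫⁻ x, ‖f x‖ₑ ^ p ≤ ∫⁻ x in ball (0 : ℝ) R, ENNReal.ofReal N ^ p := by
    rw [← lintegral_indicator measurableSet_ball]
    refine lintegral_mono fun x => ?_
    refine (ENNReal.rpow_le_rpow (hf.enorm_le x) hp.le).trans ?_
    by_cases hx : x ∈ ball (0 : ℝ) R
    · simp [hx]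
    · simp [Set.indicator_of_notMem hx, hp]
  refine (h.trans_lt ?_).ne
  rw [lintegral_const, Measure.restrict_apply_univ, Real.volume_ball]
  exact ENNReal.mul_lt_top (ENNReal.rpow_lt_top_of_nonneg hp.le (by simp)) ENNReal.ofReal_lt_top

theorem BoundedSupp.mono {f g : ℝ → ℂ} {R N : ℝ} (hf : BoundedSupp f R N)
    (hg : AEStronglyMeasurable g) (h : ∀ x, ‖g x‖ ≤ ‖f x‖) : BoundedSupp g R N :=
  ⟨hg, fun x => (h x).trans (hf.bound x), fun x hx => by
    have := h x
    rw [hf.supp x hx, norm_zero] at this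
    exact norm_le_zero_iff.1 this⟩

theorem BoundedSupp.indicator {f : ℝ → ℂ} {R N : ℝ} (hf : BoundedSupp f R N) {s : Set ℝ}
    (hs : MeasurableSet s) : BoundedSupp (s.indicator f) R N :=
  hf.mono (hf.meas.indicator hs) fun x => norm_indicator_le_norm_self f x

/-- Decay of the Cauchy integral of a boundedly supported bounded function. -/
theorem BoundedSupp.lintegral_cauchyKer_le {f : ℝ → ℂ} {R N : ℝ} (hf : BoundedSupp f R N)
    {d : ℝ} (hd : d ≠ 0) : ∃ D : ℝ≥0, ∀ x,
      ∫⁻ t, ‖cauchyKer d (x - t)‖ₑ * ‖f t‖ₑ ≤ D * ENNReal.ofReal (max 1 |x| ^ (-1 : ℝ)) := by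
  have hd' : 0 < |d| := abs_pos.2 hd
  set K : ℝ := (1 + |R|) / |d| + 1 with hK
  have hK0 : 0 < K := by positivity
  refine ⟨Real.toNNReal (K * N * (2 * |R|)), fun x => ?_⟩
  have hx0 : 0 < max 1 |x| := lt_max_of_lt_left one_pos
  have hker : ∀ t ∈ ball (0 : ℝ) R, ‖cauchyKer d (x - t)‖ ≤ K * max 1 |x| ^ (-1 : ℝ) := by
    intro t ht
    have hm : 0 < max |d| |x - t| := lt_max_of_lt_left hd'
    refine (norm_cauchyKer_le hd _).trans ?_
    rw [Real.rpow_neg_one, Real.rpow_neg_one, ← div_eq_mul_inv, inv_le_comm₀ hm (by positivity),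
      inv_div, div_le_iff₀ hK0]
    have ht' : |t| < R := by simpa using ht
    have hR : |t| < |R| := ht'.trans_le (le_abs_self R)
    have h1 : |x| ≤ |x - t| + |t| := by simpa using abs_add_le (x - t) t
    have h2 : 1 + |R| ≤ max |d| |x - t| * ((1 + |R|) / |d|) := by
      rw [mul_div_assoc', le_div_iff₀ hd', mul_comm]
      gcongr
      exact le_max_left _ _
    have h3 := le_max_right |d| |x - t|
    rw [hK, mul_add, mul_one]
    refine max_le ?_ ?_
    · linarith [abs_nonneg R]
    · linarith
  calc ∫⁻ t, ‖cauchyKer d (x - t)‖ₑ * ‖f t‖ₑ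
      ≤ ∫⁻ t in ball (0 : ℝ) |R|, ENNReal.ofReal (K * max 1 |x| ^ (-1 : ℝ) * N) := by
        rw [← lintegral_indicator measurableSet_ball]
        refine lintegral_mono fun t => ?_
        by_cases ht : t ∈ ball (0 : ℝ) R
        · rw [Set.indicator_of_mem (ball_subset_ball (le_abs_self R) ht), ← enorm_mul,
            ← ofReal_norm, norm_mul]
          refine ENNReal.ofReal_le_ofReal ?_
          have := hf.nonneg
          gcongr
          · exact hker t ht
          · exact hf.bound t
        · rw [hf.supp t ht]; simp
    _ = _ := by
        have := hf.nonneg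
        rw [lintegral_const, Measure.restrict_apply_univ, Real.volume_ball,
          ← ENNReal.ofReal_mul (by positivity)]
        rw [show K * max 1 |x| ^ (-1 : ℝ) * N * (2 * |R|) =
          K * N * (2 * |R|) * max 1 |x| ^ (-1 : ℝ) by ring, ENNReal.ofReal_mul (by positivity)]
        rfl

theorem lintegral_decay_mul_ne_top {D E : ℝ≥0} {f g : ℝ → ℝ≥0∞}
    (hf : ∀ x, f x ≤ D * ENNReal.ofReal (max 1 |x| ^ (-1 : ℝ)))
    (hg : ∀ x, g x ≤ E * ENNReal.ofReal (max 1 |x| ^ (-1 : ℝ))) : ∫⁻ x, f x * g x ≠ ∞ := by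
  have h2 := lintegral_rpow_max_ne_top (η := 2) (by norm_num) 0 one_pos
  have h : ∫⁻ x, f x * g x ≤ ((D * E : ℝ≥0) : ℝ≥0∞) *
      ∫⁻ t, ENNReal.ofReal (max 1 |t - 0| ^ (-2 : ℝ)) := by
    rw [← lintegral_const_mul' _ _ ENNReal.coe_ne_top]
    refine lintegral_mono fun x => (mul_le_mul' (hf x) (hg x)).trans (le_of_eq ?_)
    have hx0 : 0 < max 1 |x| := lt_max_of_lt_left one_pos
    rw [sub_zero, mul_mul_mul_comm, ← ENNReal.ofReal_mul (by positivity), ← Real.rpow_add hx0,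
      ENNReal.coe_mul]
    norm_num
  exact (h.trans_lt (ENNReal.mul_lt_top ENNReal.coe_lt_top (lt_top_iff_ne_top.2 h2))).ne

theorem BoundedSupp.enorm_le_decay {f : ℝ → ℂ} {R N : ℝ} (hf : BoundedSupp f R N) :
    ∃ D : ℝ≥0, ∀ x, ‖f x‖ₑ ≤ D * ENNReal.ofReal (max 1 |x| ^ (-1 : ℝ)) := by
  refine ⟨Real.toNNReal (N * (1 + |R|)), fun x => (hf.enorm_le x).trans ?_⟩
  have hN := hf.nonneg
  by_cases hx : x ∈ ball (0 : ℝ) R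
  · have hx0 : 0 < max 1 |x| := lt_max_of_lt_left one_pos
    rw [Set.indicator_of_mem hx]
    change _ ≤ ENNReal.ofReal _ * _
    rw [← ENNReal.ofReal_mul (by positivity)]
    refine ENNReal.ofReal_le_ofReal ?_
    have hx' : |x| < R := by simpa using hx
    rw [Real.rpow_neg_one, ← div_eq_mul_inv, le_div_iff₀ hx0]
    gcongr
    exact max_le (by linarith [abs_nonneg R]) (by linarith [le_abs_self R])
  · rw [Set.indicator_of_notMem hx]; exact zero_le

theorem lintegral_decay_rpow_ne_top {D : ℝ≥0} {f : ℝ → ℝ≥0∞}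
    (hf : ∀ x, f x ≤ D * ENNReal.ofReal (max 1 |x| ^ (-1 : ℝ))) {p : ℝ} (hp : 1 < p) :
    ∫⁻ x, f x ^ p ≠ ∞ := by
  have h2 := lintegral_rpow_max_ne_top hp 0 one_pos
  have hp0 : 0 ≤ p := by linarith
  have h : ∫⁻ x, f x ^ p ≤ (D : ℝ≥0∞) ^ p * ∫⁻ t, ENNReal.ofReal (max 1 |t - 0| ^ (-p)) := by
    rw [← lintegral_const_mul' _ _ (ENNReal.rpow_ne_top_of_nonneg hp0 (by simp))]
    refine lintegral_mono fun x => (ENNReal.rpow_le_rpow (hf x) hp0).trans (le_of_eq ?_)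
    have hx0 : 0 < max 1 |x| := lt_max_of_lt_left one_pos
    rw [sub_zero, ENNReal.mul_rpow_of_nonneg _ _ hp0,
      ENNReal.ofReal_rpow_of_nonneg (by positivity) hp0, ← Real.rpow_mul hx0.le, neg_one_mul]
  exact (h.trans_lt (ENNReal.mul_lt_top (ENNReal.rpow_lt_top_of_nonneg hp0 (by simp))
    (lt_top_iff_ne_top.2 h2))).ne

/-- Fubini, with `cauchyKer_neg_neg`. The pairing is bilinear, so no conjugate appears: the
transpose is minus the operator at the opposite height. -/
theorem integral_cauchyOp_mul {f g : ℝ → ℂ} (hf : AEStronglyMeasurable f)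
    (hg : AEStronglyMeasurable g) {d : ℝ} (hd : d ≠ 0)
    (hfin : ∫⁻ x, (∫⁻ t, ‖cauchyKer d (x - t)‖ₑ * ‖f t‖ₑ) * ‖g x‖ₑ ≠ ∞) :
    ∫ x, cauchyOp d f x * g x = -∫ x, f x * cauchyOp (-d) g x := by
  have hm : AEStronglyMeasurable (fun z : ℝ × ℝ => cauchyKer d (z.1 - z.2) * f z.2 * g z.1)
      (volume.prod volume) :=
    (aestronglyMeasurable_convKer (continuous_cauchyKer hd) hf).mul hg.comp_fst
  have hi : Integrable (fun z : ℝ × ℝ => cauchyKer d (z.1 - z.2) * f z.2 * g z.1)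
      (volume.prod volume) := by
    refine ⟨hm, ?_⟩
    rw [hasFiniteIntegral_iff_enorm, lintegral_prod _ hm.enorm]
    refine lt_top_iff_ne_top.2 ?_
    simp only [enorm_mul]
    convert! hfin using 4 with x
    rw [lintegral_mul_const']
    exact enorm_ne_top
  calc ∫ x, cauchyOp d f x * g x = ∫ x, ∫ t, cauchyKer d (x - t) * f t * g x := by
        simp only [cauchyOp, integral_mul_const]
    _ = ∫ t, ∫ x, cauchyKer d (x - t) * f t * g x := integral_integral_swap hi
    _ = ∫ t, -(f t * cauchyOp (-d) g t) := by
        congr 1; ext t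
        rw [cauchyOp, ← integral_const_mul, ← integral_neg]
        congr 1; ext x
        rw [← neg_sub x t, cauchyKer_neg_neg]; ring
    _ = _ := integral_neg _

/-- Associativity of convolution by Fubini. The integrability hypothesis is left to each
application, where it has a different source. -/
theorem conv_conv {k₁ k₂ : ℝ → ℂ} (h₁ : Continuous k₁) (h₂ : Continuous k₂) {f : ℝ → ℂ}
    (hf : AEStronglyMeasurable f) (x : ℝ)
    (hfin : ∫⁻ s, ‖k₁ (x - s)‖ₑ * ∫⁻ t, ‖k₂ (s - t)‖ₑ * ‖f t‖ₑ ≠ ∞) :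
    ∫ s, k₁ (x - s) * ∫ t, k₂ (s - t) * f t =
      ∫ t, (∫ u, k₁ (x - t - u) * k₂ u) * f t := by
  have hm : AEStronglyMeasurable (fun z : ℝ × ℝ => k₁ (x - z.1) * (k₂ (z.1 - z.2) * f z.2))
      (volume.prod volume) :=
    (h₁.comp (continuous_const.sub continuous_fst)).aestronglyMeasurable.mul
      (aestronglyMeasurable_convKer h₂ hf)
  have hi : Integrable (fun z : ℝ × ℝ => k₁ (x - z.1) * (k₂ (z.1 - z.2) * f z.2))
      (volume.prod volume) := by
    refine ⟨hm, ?_⟩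
    rw [hasFiniteIntegral_iff_enorm, lintegral_prod _ hm.enorm]
    refine lt_top_iff_ne_top.2 ?_
    simp only [enorm_mul]
    convert! hfin using 3 with s
    rw [lintegral_const_mul' _ _ enorm_ne_top]
  calc ∫ s, k₁ (x - s) * ∫ t, k₂ (s - t) * f t
      = ∫ s, ∫ t, k₁ (x - s) * (k₂ (s - t) * f t) := by simp only [integral_const_mul]
    _ = ∫ t, ∫ s, k₁ (x - s) * (k₂ (s - t) * f t) := integral_integral_swap hi
    _ = _ := by
        congr 1; ext t
        simp only [← mul_assoc]
        rw [integral_mul_const]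
        congr 1
        rw [← integral_add_right_eq_self (fun s => k₁ (x - s) * k₂ (s - t)) t]
        congr 1; ext u
        rw [add_sub_cancel_right, sub_sub, add_comm t u]

/-- The kernel identity `integral_cauchyKer_mul` at equal heights. Fubini is justified by
Cauchy-Schwarz, the kernel and the inner integral both being square integrable. -/
theorem BoundedSupp.cauchyOp_cauchyOp {f : ℝ → ℂ} {R N : ℝ} (hf : BoundedSupp f R N)
    {d : ℝ} (hd : 0 < d) (x : ℝ) :
    cauchyOp d (cauchyOp d f) x = -2 * Real.pi * Complex.I * cauchyOp (d + d) f x := by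
  obtain ⟨D, hD⟩ := hf.lintegral_cauchyKer_le hd.ne'
  have hfin : ∫⁻ s, ‖cauchyKer d (x - s)‖ₑ * ∫⁻ t, ‖cauchyKer d (s - t)‖ₑ * ‖f t‖ₑ ≠ ∞ := by
    have hpq : (2 : ℝ).HolderConjugate 2 := by
      rw [Real.holderConjugate_iff]; norm_num
    have hm : AEMeasurable fun s => ∫⁻ t, ‖cauchyKer d (s - t)‖ₑ * ‖f t‖ₑ := by
      have := (aestronglyMeasurable_convKer (continuous_cauchyKer hd.ne') hf.meas).enorm
      simp only [enorm_mul] at this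
      exact this.lintegral_prod_right'
    refine ((ENNReal.lintegral_mul_le_Lp_mul_Lq volume hpq
      (continuous_cauchyKer_sub hd.ne' x).aestronglyMeasurable.enorm hm).trans_lt ?_).ne
    rw [lintegral_sub_left_eq_self (fun t => ‖cauchyKer d t‖ₑ ^ (2 : ℝ))]
    refine ENNReal.mul_lt_top ?_ ?_
    · exact ENNReal.rpow_lt_top_of_nonneg (by norm_num)
        (lintegral_cauchyKer_rpow_ne_top hd.ne' (by norm_num))
    · exact ENNReal.rpow_lt_top_of_nonneg (by norm_num)
        (lintegral_decay_rpow_ne_top hD (by norm_num))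
  have h := conv_conv (continuous_cauchyKer hd.ne') (continuous_cauchyKer hd.ne') hf.meas x hfin
  simp only [cauchyOp] at h ⊢
  rw [h]
  simp only [integral_cauchyKer_mul hd hd]
  rw [← integral_const_mul]
  simp only [mul_assoc]

theorem cauchyOp_im_of_real {f : ℝ → ℂ} (hreal : ∀ x, (starRingEnd ℂ) (f x) = f x) {d : ℝ} {x : ℝ}
    (hi : Integrable fun t => cauchyKer d (x - t) * f t) :
    (cauchyOp d f x).im = -∫ t, poisson d (x - t) * (f t).re := by
  rw [cauchyOp, ← RCLike.im_eq_complex_im, ← integral_im hi, ← integral_neg]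
  congr 1; ext t
  have : (f t).im = 0 := Complex.conj_eq_iff_im.1 (hreal t)
  simp [this, cauchyKer_im]

theorem poisson_neg (d t : ℝ) : poisson d (-t) = poisson d t := by simp [poisson]

theorem ENNReal.two_mul_le_add_sq (a b : ℝ≥0∞) : 2 * a * b ≤ a ^ 2 + b ^ 2 := by
  induction a with
  | top => simp
  | coe a =>
    induction b with
    | top => simp
    | coe b => exact_mod_cast _root_.two_mul_le_add_sq a b

/-- Schur's test: bound `2 u(x) u(t)` by the sum of the squares and integrate each square against
`k`. -/
theorem lintegral_mul_conv_le {u k : ℝ → ℝ≥0∞} (hu : AEMeasurable u) (hk : Measurable k) {A : ℝ≥0∞}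
    (hA : ∫⁻ t, k t = A) :
    ∫⁻ x, u x * ∫⁻ t, k (x - t) * u t ≤ A * ∫⁻ x, u x ^ 2 := by
  have hk2 : Measurable fun z : ℝ × ℝ => k (z.1 - z.2) :=
    hk.comp (measurable_fst.sub measurable_snd)
  have hkx : ∀ x, Measurable fun t => k (x - t) := fun x => hk.comp (measurable_const.sub measurable_id)
  have hkt : ∀ t, Measurable fun x => k (x - t) := fun t => hk.comp (measurable_id.sub measurable_const)
  have hu2 : AEMeasurable fun x => u x ^ 2 := hu.pow_const _
  have hm : AEMeasurable (fun z : ℝ × ℝ => k (z.1 - z.2) * u z.2 ^ 2) (volume.prod volume) :=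
    hk2.aemeasurable.mul (hu2.comp_snd (ν := volume))
  have hm1 : AEMeasurable fun x => ∫⁻ t, k (x - t) * u t ^ 2 := hm.lintegral_prod_right'
  have hP : ∀ x, ∫⁻ t, k (x - t) = A := fun x => by
    rw [lintegral_sub_left_eq_self k, hA]
  have e1 : ∫⁻ x, ∫⁻ t, k (x - t) * u x ^ 2 = A * ∫⁻ x, u x ^ 2 := by
    rw [← lintegral_const_mul'' _ hu2]
    refine lintegral_congr fun x => ?_
    rw [lintegral_mul_const _ (hkx x), hP]
  have e2 : ∫⁻ x, ∫⁻ t, k (x - t) * u t ^ 2 = A * ∫⁻ x, u x ^ 2 := by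
    rw [lintegral_lintegral_swap hm, ← lintegral_const_mul'' _ hu2]
    refine lintegral_congr fun t => ?_
    rw [lintegral_mul_const _ (hkt t), lintegral_sub_right_eq_self k, hA]
  have e3 : ∀ x, 2 * (u x * ∫⁻ t, k (x - t) * u t) ≤
      (∫⁻ t, k (x - t) * u x ^ 2) + ∫⁻ t, k (x - t) * u t ^ 2 := by
    intro x
    have hkm : AEMeasurable fun t => k (x - t) * u t := (hkx x).aemeasurable.mul hu
    rw [← lintegral_add_left ((hkx x).mul_const _), ← mul_assoc, ← lintegral_const_mul'' _ hkm]
    refine lintegral_mono fun t => ?_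
    rw [← mul_add]
    calc _ = k (x - t) * (2 * u x * u t) := by ring
      _ ≤ _ := mul_le_mul_right (ENNReal.two_mul_le_add_sq _ _) _
  have h2 : 2 * ∫⁻ x, u x * ∫⁻ t, k (x - t) * u t ≤ 2 * (A * ∫⁻ x, u x ^ 2) := by
    rw [← lintegral_const_mul' _ _ (by simp)]
    refine (lintegral_mono e3).trans ?_
    rw [lintegral_add_right' _ hm1, e1, e2, two_mul]
  exact (ENNReal.mul_le_mul_iff_right (by simp) (by simp)).1 h2

theorem BoundedSupp.cauchyOp_enorm_le {f : ℝ → ℂ} {R N : ℝ} (hf : BoundedSupp f R N)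
    {d : ℝ} (hd : d ≠ 0) :
    ∃ D : ℝ≥0, ∀ x, ‖cauchyOp d f x‖ₑ ≤ D * ENNReal.ofReal (max 1 |x| ^ (-1 : ℝ)) := by
  obtain ⟨D, hD⟩ := hf.lintegral_cauchyKer_le hd
  exact ⟨D, fun x => (enorm_cauchyOp_le d f x).trans (hD x)⟩

theorem BoundedSupp.cauchyOp_rpow_ne_top {f : ℝ → ℂ} {R N : ℝ} (hf : BoundedSupp f R N)
    {d : ℝ} (hd : d ≠ 0) {p : ℝ} (hp : 1 < p) : ∫⁻ x, ‖cauchyOp d f x‖ₑ ^ p ≠ ∞ := by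
  obtain ⟨D, hD⟩ := hf.cauchyOp_enorm_le hd
  exact lintegral_decay_rpow_ne_top hD hp

theorem BoundedSupp.integrable_cauchyKer_mul {f : ℝ → ℂ} {R N : ℝ} (hf : BoundedSupp f R N)
    {d : ℝ} (hd : d ≠ 0) (x : ℝ) : Integrable fun t => cauchyKer d (x - t) * f t :=
  integrable_cauchyKer_mul_of_rpow hd (p := 2) (by norm_num) hf.meas
    (hf.lintegral_rpow_ne_top (by norm_num)) x

/-- The `L²` bound for the Cauchy integral of a real function. -/
theorem BoundedSupp.cauchyOp_L2_real {f : ℝ → ℂ} {R N : ℝ} (hf : BoundedSupp f R N)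
    (hreal : ∀ x, (starRingEnd ℂ) (f x) = f x) {d : ℝ} (hd : 0 < d) :
    ∫⁻ x, ‖cauchyOp d f x‖ₑ ^ (2 : ℝ) ≤
      ENNReal.ofReal (2 * Real.pi * Real.pi) * ∫⁻ x, ‖f x‖ₑ ^ (2 : ℝ) := by
  have hd2 : 0 < d + d := by positivity
  have hfr : (fun t => (starRingEnd ℂ) (f t)) = f := funext hreal
  have hconj : ∀ e x, cauchyOp (-e) f x = (starRingEnd ℂ) (cauchyOp e f x) := fun e x => by
    rw [← cauchyOp_conj, hfr]
  obtain ⟨D, hD⟩ := hf.lintegral_cauchyKer_le hd.ne'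
  obtain ⟨E, hE⟩ := hf.cauchyOp_enorm_le (neg_ne_zero.2 hd.ne')
  -- With `F` the Cauchy integral at height `d`, conjugation and composition turn this into: the
  -- integral of `|F|²` equals minus that of `f` times `2πi` times the conjugate of the Cauchy
  -- integral at height `2d`. The real part involves only the imaginary part of the latter, which is
  -- minus a Poisson integral of `f`.
  have key := integral_cauchyOp_mul hf.meas
    (aestronglyMeasurable_cauchyOp (neg_ne_zero.2 hd.ne') hf.meas) hd.ne'
    (lintegral_decay_mul_ne_top hD hE)
  have h1 : ∀ x, cauchyOp d f x * cauchyOp (-d) f x = ((‖cauchyOp d f x‖ ^ 2 : ℝ) : ℂ) := by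
    intro x
    rw [hconj, Complex.mul_conj, Complex.normSq_eq_norm_sq]
  have h2 : ∀ x, cauchyOp (-d) (cauchyOp (-d) f) x =
      2 * Real.pi * Complex.I * (starRingEnd ℂ) (cauchyOp (d + d) f x) := by
    intro x
    have : cauchyOp (-d) f = fun x => (starRingEnd ℂ) (cauchyOp d f x) := funext (hconj d)
    rw [this, cauchyOp_conj, hf.cauchyOp_cauchyOp hd]
    simp only [map_mul, map_neg, Complex.conj_ofReal, Complex.conj_I, Complex.conj_ofNat]
    ring
  simp only [h1, h2] at key
  rw [integral_complex_ofReal] at key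
  have hre := congrArg Complex.re key
  have h3 : ∫⁻ x, ‖cauchyOp d f x‖ₑ ^ (2 : ℝ) =
      ENNReal.ofReal (∫ x, ‖cauchyOp d f x‖ ^ 2) := by
    have hfin := hf.cauchyOp_rpow_ne_top hd.ne' (p := 2) (by norm_num)
    have hmeas := aestronglyMeasurable_cauchyOp hd.ne' hf.meas
    rw [ofReal_integral_eq_lintegral_ofReal]
    · refine lintegral_congr fun x => ?_
      rw [ENNReal.ofReal_pow (norm_nonneg _), ofReal_norm, ENNReal.rpow_two]
    · refine ⟨(hmeas.norm.pow 2), ?_⟩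
      rw [hasFiniteIntegral_iff_enorm]
      refine lt_top_iff_ne_top.2 ?_
      convert! hfin using 3 with x
      rw [enorm_pow, enorm_norm, ENNReal.rpow_two]
    · exact Eventually.of_forall fun x => by positivity
  obtain ⟨E₂, hE₂⟩ := hf.cauchyOp_enorm_le hd2.ne'
  obtain ⟨F₂, hF₂⟩ := hf.enorm_le_decay
  have hi : Integrable fun x => f x *
      (2 * Real.pi * Complex.I * (starRingEnd ℂ) (cauchyOp (d + d) f x)) := by
    have hm := Complex.continuous_conj.comp_aestronglyMeasurable
      (aestronglyMeasurable_cauchyOp hd2.ne' hf.meas)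
    have := (integrable_mul_of_lintegral hf.meas hm (by
      simpa [← ofReal_norm] using lintegral_decay_mul_ne_top hF₂ hE₂)).const_mul
      (2 * Real.pi * Complex.I)
    refine this.congr (Eventually.of_forall fun x => ?_)
    simp only
    ring
  have h5 : ∀ x, ‖(f x * (2 * Real.pi * Complex.I * (starRingEnd ℂ) (cauchyOp (d + d) f x))).re‖ₑ ≤
      ENNReal.ofReal (2 * Real.pi) * (‖f x‖ₑ *
        ∫⁻ t, ENNReal.ofReal (poisson (d + d) (x - t)) * ‖f t‖ₑ) := by
    intro x
    have him := cauchyOp_im_of_real hreal (hf.integrable_cauchyKer_mul hd2.ne' x)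
    have hfx : (f x).im = 0 := Complex.conj_eq_iff_im.1 (hreal x)
    have e : (f x * (2 * Real.pi * Complex.I * (starRingEnd ℂ) (cauchyOp (d + d) f x))).re =
        2 * Real.pi * ((f x).re * (cauchyOp (d + d) f x).im) := by
      simp [hfx]; ring
    rw [e, enorm_mul, enorm_mul (f x).re, Real.enorm_of_nonneg (by positivity)]
    refine mul_le_mul_right (mul_le_mul' ?_ ?_) _
    · rw [← ofReal_norm, ← ofReal_norm]
      exact ENNReal.ofReal_le_ofReal (Complex.abs_re_le_norm _)
    · rw [him, enorm_neg]
      refine (enorm_integral_le_lintegral_enorm _).trans (lintegral_mono fun t => ?_)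
      rw [enorm_mul, Real.enorm_of_nonneg (poisson_nonneg hd2 _), ← ofReal_norm (f t),
        ← ofReal_norm (f t).re]
      gcongr
      exact Complex.abs_re_le_norm _
  rw [h3]
  rw [Complex.ofReal_re, Complex.neg_re, ← RCLike.re_eq_complex_re, ← integral_re hi,
    ← integral_neg] at hre
  rw [hre]
  calc _ ≤ ENNReal.ofReal ‖∫ x, -(f x * (2 * Real.pi * Complex.I *
          (starRingEnd ℂ) (cauchyOp (d + d) f x))).re‖ :=
        ENNReal.ofReal_le_ofReal (le_abs_self _)
    _ ≤ ∫⁻ x, ‖-(f x * (2 * Real.pi * Complex.I *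
          (starRingEnd ℂ) (cauchyOp (d + d) f x))).re‖ₑ := by
        rw [ofReal_norm]; exact enorm_integral_le_lintegral_enorm _
    _ ≤ ∫⁻ x, ENNReal.ofReal (2 * Real.pi) * (‖f x‖ₑ *
          ∫⁻ t, ENNReal.ofReal (poisson (d + d) (x - t)) * ‖f t‖ₑ) :=
        lintegral_mono fun x => by rw [enorm_neg]; exact h5 x
    _ ≤ ENNReal.ofReal (2 * Real.pi) * (ENNReal.ofReal Real.pi * ∫⁻ x, ‖f x‖ₑ ^ 2) := by
        rw [lintegral_const_mul' _ _ ENNReal.ofReal_ne_top]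
        exact mul_le_mul_right (lintegral_mul_conv_le hf.meas.enorm
          (continuous_poisson hd2).measurable.ennreal_ofReal (lintegral_poisson hd2)) _
    _ = _ := by
        rw [← mul_assoc, ← ENNReal.ofReal_mul (by positivity)]
        simp only [ENNReal.rpow_ofNat]

theorem cauchyOp_add {f g : ℝ → ℂ} {d x : ℝ} (hf : Integrable fun t => cauchyKer d (x - t) * f t)
    (hg : Integrable fun t => cauchyKer d (x - t) * g t) :
    cauchyOp d (fun t => f t + g t) x = cauchyOp d f x + cauchyOp d g x := by
  simp only [cauchyOp, mul_add]
  exact integral_add hf hg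

theorem cauchyOp_const_mul (a : ℂ) (f : ℝ → ℂ) (d x : ℝ) :
    cauchyOp d (fun t => a * f t) x = a * cauchyOp d f x := by
  simp only [cauchyOp, mul_left_comm _ a]
  exact integral_const_mul _ _

/-- The `L²` bound for the Cauchy integral. -/
theorem BoundedSupp.cauchyOp_L2 {f : ℝ → ℂ} {R N : ℝ} (hf : BoundedSupp f R N)
    {d : ℝ} (hd : 0 < d) :
    ∫⁻ x, ‖cauchyOp d f x‖ₑ ^ (2 : ℝ) ≤
      ((8 * NNReal.pi * NNReal.pi : ℝ≥0) : ℝ≥0∞) * ∫⁻ x, ‖f x‖ₑ ^ (2 : ℝ) := by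
  -- Real and imaginary parts are treated separately; `8π²` is the convexity factor 2 times two
  -- copies of `2π²`.
  have hre : BoundedSupp (fun x => ((f x).re : ℂ)) R N :=
    hf.mono (Complex.continuous_ofReal.comp_aestronglyMeasurable
      (Complex.continuous_re.comp_aestronglyMeasurable hf.meas)) fun x => by
        simpa using Complex.abs_re_le_norm (f x)
  have him : BoundedSupp (fun x => ((f x).im : ℂ)) R N :=
    hf.mono (Complex.continuous_ofReal.comp_aestronglyMeasurable
      (Complex.continuous_im.comp_aestronglyMeasurable hf.meas)) fun x => by
        simpa using Complex.abs_im_le_norm (f x)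
  have hsplit : ∀ x, cauchyOp d f x = cauchyOp d (fun x => ((f x).re : ℂ)) x +
      Complex.I * cauchyOp d (fun x => ((f x).im : ℂ)) x := by
    intro x
    rw [← cauchyOp_const_mul, ← cauchyOp_add (hre.integrable_cauchyKer_mul hd.ne' x)]
    · congr 1; ext t; rw [mul_comm, Complex.re_add_im]
    · refine ((him.integrable_cauchyKer_mul hd.ne' x).const_mul Complex.I).congr
        (Eventually.of_forall fun t => ?_)
      simp only; ring
  have hmono : ∀ g : ℝ → ℂ, (∀ x, ‖g x‖ ≤ ‖f x‖) →
      ∫⁻ x, ‖g x‖ₑ ^ (2 : ℝ) ≤ ∫⁻ x, ‖f x‖ₑ ^ (2 : ℝ) := fun g hg => by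
    refine lintegral_mono fun x => ENNReal.rpow_le_rpow ?_ (by norm_num)
    rw [← ofReal_norm, ← ofReal_norm]
    exact ENNReal.ofReal_le_ofReal (hg x)
  have hmeas := aestronglyMeasurable_cauchyOp hd.ne' hre.meas
  calc ∫⁻ x, ‖cauchyOp d f x‖ₑ ^ (2 : ℝ)
      ≤ ∫⁻ x, 2 * (‖cauchyOp d (fun x => ((f x).re : ℂ)) x‖ₑ ^ (2 : ℝ) +
          ‖cauchyOp d (fun x => ((f x).im : ℂ)) x‖ₑ ^ (2 : ℝ)) := by
        refine lintegral_mono fun x => ?_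
        have h := ENNReal.rpow_add_le_mul_rpow_add_rpow
          ‖cauchyOp d (fun x => ((f x).re : ℂ)) x‖ₑ ‖cauchyOp d (fun x => ((f x).im : ℂ)) x‖ₑ
          (p := 2) (by norm_num)
        norm_num at h
        simp only [ENNReal.rpow_ofNat]
        refine le_trans ?_ h
        gcongr
        rw [hsplit]
        refine (enorm_add_le _ _).trans ?_
        rw [enorm_mul]
        simp [← ofReal_norm]
    _ ≤ 2 * (ENNReal.ofReal (2 * Real.pi * Real.pi) * (∫⁻ x, ‖f x‖ₑ ^ (2 : ℝ)) +
          ENNReal.ofReal (2 * Real.pi * Real.pi) * ∫⁻ x, ‖f x‖ₑ ^ (2 : ℝ)) := by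
        rw [lintegral_const_mul' _ _ (by simp), lintegral_add_left' (hmeas.enorm.pow_const _)]
        gcongr
        · refine (hre.cauchyOp_L2_real (fun x => by simp) hd).trans ?_
          exact mul_le_mul_right (hmono _ fun x => by simpa using Complex.abs_re_le_norm (f x)) _
        · refine (him.cauchyOp_L2_real (fun x => by simp) hd).trans ?_
          exact mul_le_mul_right (hmono _ fun x => by simpa using Complex.abs_im_le_norm (f x)) _
    _ = _ := by
        have : ENNReal.ofReal (2 * Real.pi * Real.pi) =
            ((2 * NNReal.pi * NNReal.pi : ℝ≥0) : ℝ≥0∞) := by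
          rw [← ENNReal.ofReal_coe_nnreal]; simp
        rw [this]
        push_cast
        ring

/-! ### Uniform `L^p` bounds for the Cauchy integrals. -/

/-- Truncation of a function to a bounded function of bounded support. -/
noncomputable def truncSupp (f : ℝ → ℂ) (n : ℕ) : ℝ → ℂ :=
  ({x | ‖f x‖ ≤ n} ∩ ball 0 n).indicator f

theorem norm_truncSupp_le (f : ℝ → ℂ) (n : ℕ) (x : ℝ) : ‖truncSupp f n x‖ ≤ ‖f x‖ :=
  norm_indicator_le_norm_self f x

theorem enorm_truncSupp_le (f : ℝ → ℂ) (n : ℕ) (x : ℝ) : ‖truncSupp f n x‖ₑ ≤ ‖f x‖ₑ :=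
  enorm_indicator_le_enorm_self f x

theorem boundedSupp_truncSupp {f : ℝ → ℂ} (hf : AEStronglyMeasurable f) (n : ℕ) :
    BoundedSupp (truncSupp f n) n n := by
  refine ⟨?_, fun x => ?_, fun x hx => ?_⟩
  · exact hf.indicator₀ ((nullMeasurableSet_le hf.norm.aemeasurable aemeasurable_const).inter
      measurableSet_ball.nullMeasurableSet)
  · by_cases h : x ∈ {x | ‖f x‖ ≤ n} ∩ ball 0 (n : ℝ)
    · rw [truncSupp, Set.indicator_of_mem h]; exact h.1
    · rw [truncSupp, Set.indicator_of_notMem h]; simp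
  · exact Set.indicator_of_notMem (fun h => hx h.2) _

theorem tendsto_truncSupp (f : ℝ → ℂ) (x : ℝ) :
    Tendsto (fun n => truncSupp f n x) atTop (𝓝 (f x)) := by
  refine tendsto_const_nhds.congr' ?_
  obtain ⟨m, hm⟩ := exists_nat_gt (max ‖f x‖ |x|)
  filter_upwards [eventually_ge_atTop m] with n hn
  have hmn : (m : ℝ) ≤ n := by exact_mod_cast hn
  rw [truncSupp, Set.indicator_of_mem]
  refine ⟨?_, ?_⟩
  · exact ((le_max_left _ _).trans hm.le).trans hmn
  · rw [mem_ball, dist_zero_right, Real.norm_eq_abs]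
    exact ((le_max_right _ _).trans_lt hm).trans_le hmn

theorem tendsto_cauchyOp_of_le {d : ℝ} (hd : d ≠ 0) {f : ℝ → ℂ} {g : ℕ → ℝ → ℂ} {h : ℝ → ℝ} {x : ℝ}
    (hg : ∀ n, AEStronglyMeasurable (g n)) (hle : ∀ n t, ‖g n t‖ ≤ h t)
    (hi : Integrable fun t => ‖cauchyKer d (x - t)‖ * h t)
    (hlim : ∀ t, Tendsto (fun n => g n t) atTop (𝓝 (f t))) :
    Tendsto (fun n => cauchyOp d (g n) x) atTop (𝓝 (cauchyOp d f x)) := by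
  refine tendsto_integral_of_dominated_convergence _
    (fun n => (continuous_cauchyKer_sub hd x).aestronglyMeasurable.mul (hg n)) hi
    (fun n => Eventually.of_forall fun t => ?_) (Eventually.of_forall fun t => ?_)
  · rw [norm_mul]; gcongr; exact hle n t
  · exact (hlim t).const_mul _

/-- Fatou's lemma in the form used for every limit passage in a norm bound: truncation of `f`,
cut-off of `b`, and descent to height zero. -/
theorem lintegral_rpow_le_of_tendsto {p : ℝ} {F : ℝ → ℂ} {G : ℕ → ℝ → ℂ}
    (hG : ∀ n, AEStronglyMeasurable (G n))
    (hlim : ∀ᵐ x, Tendsto (fun n => G n x) atTop (𝓝 (F x))) {A : ℝ≥0∞}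
    (hA : ∀ n, ∫⁻ x, ‖G n x‖ₑ ^ p ≤ A) : ∫⁻ x, ‖F x‖ₑ ^ p ≤ A := by
  calc ∫⁻ x, ‖F x‖ₑ ^ p ≤ ∫⁻ x, liminf (fun n => ‖G n x‖ₑ ^ p) atTop := by
        refine lintegral_mono_ae (hlim.mono fun x hx => ?_)
        have : Tendsto (fun n => ‖G n x‖ₑ ^ p) atTop (𝓝 (‖F x‖ₑ ^ p)) :=
          (ENNReal.continuous_rpow_const.tendsto _).comp hx.enorm
        exact this.liminf_eq.ge
    _ ≤ liminf (fun n => ∫⁻ x, ‖G n x‖ₑ ^ p) atTop :=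
        lintegral_liminf_le' fun n => (hG n).enorm.pow_const p
    _ ≤ A := liminf_le_of_le (by isBoundedDefault) fun b hb => by
        obtain ⟨n, hn⟩ := hb.exists
        exact hn.trans (hA n)

theorem cauchyOp_Lp_extend {p : ℝ} (hp : 1 < p) {d : ℝ} (hd : d ≠ 0) {K : ℝ≥0}
    (h : ∀ (f : ℝ → ℂ) (R N : ℝ), BoundedSupp f R N →
      ∫⁻ x, ‖cauchyOp d f x‖ₑ ^ p ≤ K * ∫⁻ x, ‖f x‖ₑ ^ p)
    {f : ℝ → ℂ} (hf : AEStronglyMeasurable f) (hfp : ∫⁻ x, ‖f x‖ₑ ^ p ≠ ∞) :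
    ∫⁻ x, ‖cauchyOp d f x‖ₑ ^ p ≤ K * ∫⁻ x, ‖f x‖ₑ ^ p := by
  refine lintegral_rpow_le_of_tendsto (G := fun n => cauchyOp d (truncSupp f n))
    (fun n => aestronglyMeasurable_cauchyOp hd (boundedSupp_truncSupp hf n).meas)
    (Eventually.of_forall fun x => ?_) fun n => ?_
  · refine tendsto_cauchyOp_of_le hd (fun n => (boundedSupp_truncSupp hf n).meas)
      (norm_truncSupp_le f) ?_ (tendsto_truncSupp f)
    simpa only [norm_mul] using (integrable_cauchyKer_mul_of_rpow hd hp hf hfp x).norm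
  · refine (h _ _ _ (boundedSupp_truncSupp hf n)).trans (mul_le_mul_right ?_ _)
    exact lintegral_mono fun x => ENNReal.rpow_le_rpow (enorm_truncSupp_le f n x) (by linarith)

/-- Regularity of the kernel with a bound free of `d`: off the doubled ball `|x - t|` is at least
half of `|t - c|`. The Poisson form of the bound makes the far part of any Cauchy integral a Poisson
average at the scale of the interval. -/
theorem norm_cauchyKer_sub_le {d : ℝ} (hd : 0 < d) {c r x t : ℝ} (hr : 0 < r)
    (hx : x ∈ ball c r) (ht : t ∉ ball c (2 * r)) :
    ‖cauchyKer d (x - t) - cauchyKer d (c - t)‖ ≤ 3 * poisson r (t - c) := by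
  rw [mem_ball, Real.dist_eq] at hx
  rw [mem_ball, Real.dist_eq, not_lt] at ht
  have h1 := add_mul_I_ne_zero hd.ne' (x - t)
  have h2 := add_mul_I_ne_zero hd.ne' (c - t)
  have hxt : |t - c| / 2 ≤ |x - t| := by
    have : |t - c| ≤ |x - t| + |x - c| := by
      have := abs_add_le (t - x) (x - c)
      rwa [sub_add_sub_cancel, abs_sub_comm t x] at this
    linarith
  have hn1 : |x - t| ≤ ‖((x - t : ℝ) : ℂ) + d * Complex.I‖ := by
    simpa using Complex.abs_re_le_norm (((x - t : ℝ) : ℂ) + d * Complex.I)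
  have hn2 : |t - c| ≤ ‖((c - t : ℝ) : ℂ) + d * Complex.I‖ := by
    rw [abs_sub_comm]
    simpa using Complex.abs_re_le_norm (((c - t : ℝ) : ℂ) + d * Complex.I)
  have hT : 0 < |t - c| := by linarith
  rw [cauchyKer, cauchyKer, inv_sub_inv h1 h2, norm_div, norm_mul]
  have hnum : ‖((c - t : ℝ) : ℂ) + d * Complex.I - (((x - t : ℝ) : ℂ) + d * Complex.I)‖ ≤ r := by
    rw [show ((c - t : ℝ) : ℂ) + d * Complex.I - (((x - t : ℝ) : ℂ) + d * Complex.I) =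
      ((c - x : ℝ) : ℂ) by push_cast; ring, Complex.norm_real, Real.norm_eq_abs, abs_sub_comm]
    exact hx.le
  calc _ ≤ r / ((|t - c| / 2) * |t - c|) := by
        gcongr
        exact hxt.trans hn1
    _ ≤ 3 * poisson r (t - c) := by
        rw [poisson, mul_div_assoc', div_le_div_iff₀ (by positivity) (by positivity)]
        have h3 : (2 * r) ^ 2 ≤ |t - c| ^ 2 := pow_le_pow_left₀ (by positivity) ht 2
        have h4 := sq_abs (t - c)
        nlinarith [mul_pos hr hr]

theorem enorm_cauchyOp_sub_le {d : ℝ} (hd : 0 < d) {c r x : ℝ} (hr : 0 < r) (hx : x ∈ ball c r)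
    {f : ℝ → ℂ} (hsupp : ∀ t ∈ ball c (2 * r), f t = 0)
    (hix : Integrable fun t => cauchyKer d (x - t) * f t)
    (hic : Integrable fun t => cauchyKer d (c - t) * f t) :
    ‖cauchyOp d f x - cauchyOp d f c‖ₑ ≤
      3 * ∫⁻ t, ‖f t‖ₑ * ENNReal.ofReal (poisson r (t - c)) := by
  rw [cauchyOp, cauchyOp, ← integral_sub hix hic, ← lintegral_const_mul' _ _ (by simp)]
  refine (enorm_integral_le_lintegral_enorm _).trans (lintegral_mono fun t => ?_)
  simp only
  rw [← sub_mul, enorm_mul]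
  by_cases ht : t ∈ ball c (2 * r)
  · rw [hsupp t ht]; simp
  · have h := norm_cauchyKer_sub_le hd hr hx ht
    calc _ ≤ ENNReal.ofReal (3 * poisson r (t - c)) * ‖f t‖ₑ := by
          rw [← ofReal_norm (cauchyKer _ _ - _)]; gcongr
      _ = _ := by
          rw [ENNReal.ofReal_mul (by norm_num), ENNReal.ofReal_ofNat]; ring

theorem setLIntegral_ball_le_of_rpow {u : ℝ → ℝ≥0∞} (hu : AEMeasurable u) {q : ℝ} (hq : 1 < q)
    {c r : ℝ} (hr : 0 < r) {A : ℝ≥0∞} (h : ∫⁻ x in ball c r, u x ^ q ≤ ENNReal.ofReal (2 * r) * A) :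
    ∫⁻ x in ball c r, u x ≤ ENNReal.ofReal (2 * r) * A ^ (1 / q) := by
  have hpq := Real.HolderConjugate.conjExponent hq
  have hq0 : 0 < q := by linarith
  have hne : ENNReal.ofReal (2 * r) ≠ 0 := by simpa using hr
  have h1 := ENNReal.lintegral_mul_le_Lp_mul_Lq (volume.restrict (ball c r)) hpq hu.restrict
    (g := fun _ => 1) aemeasurable_const
  simp only [Pi.mul_apply, mul_one, ENNReal.one_rpow, lintegral_const, one_mul,
    Measure.restrict_apply_univ, Real.volume_ball] at h1
  refine h1.trans ((mul_le_mul_left (ENNReal.rpow_le_rpow h (by positivity)) _).trans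
    (le_of_eq ?_))
  rw [ENNReal.mul_rpow_of_nonneg _ _ (by positivity), mul_right_comm,
    ← ENNReal.rpow_add _ _ hne ENNReal.ofReal_ne_top]
  have : 1 / q + 1 / q.conjExponent = 1 := by
    simpa only [one_div] using hpq.inv_add_inv_eq_one
  rw [this, ENNReal.rpow_one]

/-- The maximal function of exponent `s`. -/
noncomputable def hlMaximalPow (s : ℝ) (u : ℝ → ℝ≥0∞) (x : ℝ) : ℝ≥0∞ :=
  hlMaximal (fun t => u t ^ s) x ^ (1 / s)

theorem measurable_hlMaximalPow (s : ℝ) (u : ℝ → ℝ≥0∞) : Measurable (hlMaximalPow s u) :=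
  (measurable_maximal _).pow_const _

theorem hlMaximalPow_rpow {s : ℝ} (hs : 0 < s) (u : ℝ → ℝ≥0∞) (x : ℝ) :
    hlMaximalPow s u x ^ s = hlMaximal (fun t => u t ^ s) x := by
  rw [hlMaximalPow, ← ENNReal.rpow_mul, one_div, inv_mul_cancel₀ hs.ne', ENNReal.rpow_one]

theorem exists_maximalPow_strong_type {s p : ℝ} (hs : 0 < s) (hsp : s < p) :
    ∃ C : ℝ≥0, ∀ u : ℝ → ℝ≥0∞, AEMeasurable u →
      ∫⁻ x, hlMaximalPow s u x ^ p ≤ C * ∫⁻ x, u x ^ p := by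
  obtain ⟨C, hC⟩ := exists_maximal_strong_type (p := p / s) (by rwa [one_lt_div hs])
  refine ⟨C, fun u hu => ?_⟩
  have h := hC _ (hu.pow_const s)
  convert! h using 3 with x
  · rw [hlMaximalPow, ← ENNReal.rpow_mul]
    congr 1; ring
  · funext x
    rw [← ENNReal.rpow_mul]
    congr 1; field_simp

theorem lintegral_rpow_add_le {p : ℝ} (hp : 1 ≤ p) {u v : ℝ → ℝ≥0∞} (hu : AEMeasurable u) :
    ∫⁻ x, (u x + v x) ^ p ≤ 2 ^ (p - 1) * ((∫⁻ x, u x ^ p) + ∫⁻ x, v x ^ p) := by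
  rw [← lintegral_add_left' (hu.pow_const p), ← lintegral_const_mul' _ _
    (ENNReal.rpow_ne_top_of_nonneg (by linarith) (by simp))]
  exact lintegral_mono fun x => ENNReal.rpow_add_le_mul_rpow_add_rpow _ _ hp

theorem lintegral_const_mul_rpow {p : ℝ} (hp : 0 ≤ p) (K : ℝ≥0) (u : ℝ → ℝ≥0∞) :
    ∫⁻ x, (K * u x) ^ p = (K : ℝ≥0∞) ^ p * ∫⁻ x, u x ^ p := by
  rw [← lintegral_const_mul' _ _ (ENNReal.rpow_ne_top_of_nonneg hp (by simp))]
  exact lintegral_congr fun x => ENNReal.mul_rpow_of_nonneg _ _ hp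

/-- A linear combination of maximal functions of exponents below `p` is bounded on `L^p`. -/
theorem exists_maximalPow_add_bound {s p : ℝ} (hs : 0 < s) (hsp : s < p) (hp : 1 ≤ p) :
    ∃ C : ℝ≥0, ∀ (K : ℝ≥0) (u v : ℝ → ℝ≥0∞), AEMeasurable u → AEMeasurable v →
      ∫⁻ x, (K * (hlMaximalPow s u x + hlMaximalPow s v x)) ^ p ≤
        (K : ℝ≥0∞) ^ p * C * ((∫⁻ x, u x ^ p) + ∫⁻ x, v x ^ p) := by
  obtain ⟨C, hC⟩ := exists_maximalPow_strong_type hs hsp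
  refine ⟨2 ^ (p - 1) * C, fun K u v hu hv => ?_⟩
  rw [lintegral_const_mul_rpow (by linarith) K (fun x => hlMaximalPow s u x + hlMaximalPow s v x),
    mul_assoc]
  refine mul_le_mul_right ?_ _
  refine (lintegral_rpow_add_le hp (measurable_hlMaximalPow s u).aemeasurable).trans ?_
  rw [ENNReal.coe_mul, ENNReal.coe_rpow_of_nonneg _ (by linarith : 0 ≤ p - 1), mul_assoc,
    ENNReal.coe_ofNat]
  refine mul_le_mul_right ?_ _
  rw [mul_add]
  exact add_le_add (hC u hu) (hC v hv)

theorem poisson_le_maximalPow {s : ℝ} (hs : 1 ≤ s) : ∃ C : ℝ≥0, ∀ (u : ℝ → ℝ≥0∞), AEMeasurable u →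
    ∀ c r y : ℝ, y ∈ ball c r →
      ∫⁻ t, u t ^ s * ENNReal.ofReal (poisson r (t - c)) ≤ C * hlMaximalPow s u y ^ s := by
  obtain ⟨C, hC⟩ := poisson_le_maximal
  refine ⟨C, fun u hu c r y hy => ?_⟩
  rw [hlMaximalPow_rpow (by linarith)]
  exact hC _ (hu.pow_const s) c r y hy

/-- Hölder's inequality for the Poisson average. -/
theorem lintegral_mul_poisson_holder {p q : ℝ} (hpq : p.HolderConjugate q) {u v : ℝ → ℝ≥0∞}
    (hu : AEMeasurable u) (hv : AEMeasurable v) {c r : ℝ} (hr : 0 < r) :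
    ∫⁻ t, u t * v t * ENNReal.ofReal (poisson r (t - c)) ≤
      (∫⁻ t, u t ^ p * ENNReal.ofReal (poisson r (t - c))) ^ (1 / p) *
      (∫⁻ t, v t ^ q * ENNReal.ofReal (poisson r (t - c))) ^ (1 / q) := by
  set w : ℝ → ℝ≥0∞ := fun t => ENNReal.ofReal (poisson r (t - c)) with hw
  have hwm : Measurable w :=
    ((continuous_poisson hr).comp (continuous_id.sub continuous_const)).measurable.ennreal_ofReal
  have h := ENNReal.lintegral_mul_le_Lp_mul_Lq volume hpq
    (f := fun t => u t * w t ^ (1 / p)) (g := fun t => v t * w t ^ (1 / q))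
    (hu.mul (hwm.pow_const _).aemeasurable) (hv.mul (hwm.pow_const _).aemeasurable)
  have hp := hpq.pos
  have hq := hpq.symm.pos
  have hsum : 1 / p + 1 / q = 1 := by simpa only [one_div] using hpq.inv_add_inv_eq_one
  convert! h using 3
  · simp only [Pi.mul_apply]
    rw [mul_mul_mul_comm, ← ENNReal.rpow_add_of_nonneg _ _ (by positivity) (by positivity), hsum,
      ENNReal.rpow_one]
  · congr 1; funext t
    rw [ENNReal.mul_rpow_of_nonneg _ _ hp.le, ← ENNReal.rpow_mul, one_div, inv_mul_cancel₀ hp.ne',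
      ENNReal.rpow_one]
  · congr 1; funext t
    rw [ENNReal.mul_rpow_of_nonneg _ _ hq.le, ← ENNReal.rpow_mul, one_div, inv_mul_cancel₀ hq.ne',
      ENNReal.rpow_one]

theorem setLIntegral_indicator_ball (f : ℝ → ℂ) (c r : ℝ) {p : ℝ} (hp : 0 < p) :
    ∫⁻ x, ‖(ball c r).indicator f x‖ₑ ^ p = ∫⁻ x in ball c r, ‖f x‖ₑ ^ p := by
  rw [← lintegral_indicator measurableSet_ball]
  refine lintegral_congr fun x => ?_
  by_cases hx : x ∈ ball c r
  · simp [hx]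
  · simp [Set.indicator_of_notMem hx, hp]

/-- Mean oscillation of a Cauchy integral, the local part being controlled by a local `L^q`
estimate. -/
theorem cauchyOp_osc {d : ℝ} (hd : 0 < d) {c r : ℝ} (hr : 0 < r) {f : ℝ → ℂ}
    (hf : AEStronglyMeasurable f)
    (hi : ∀ x, Integrable fun t => cauchyKer d (x - t) * f t) {q : ℝ} (hq : 1 < q) {A : ℝ≥0∞}
    (hloc : ∫⁻ x in ball c r, ‖cauchyOp d ((ball c (2 * r)).indicator f) x‖ₑ ^ q ≤
      ENNReal.ofReal (2 * r) * A) :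
    ∃ a : ℂ, ∫⁻ x in ball c r, ‖cauchyOp d f x - a‖ₑ ≤ ENNReal.ofReal (2 * r) *
      (A ^ (1 / q) + 3 * ∫⁻ t, ‖f t‖ₑ * ENNReal.ofReal (poisson r (t - c))) := by
  set f₁ := (ball c (2 * r)).indicator f with hf₁
  set f₂ := (ball c (2 * r))ᶜ.indicator f with hf₂
  have hi₁ : ∀ x, Integrable fun t => cauchyKer d (x - t) * f₁ t := fun x => by
    refine ((hi x).indicator (measurableSet_ball (x := c) (ε := 2 * r))).congr
      (Eventually.of_forall fun t => ?_)
    simp only [hf₁, Set.indicator]; split_ifs <;> simp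
  have hi₂ : ∀ x, Integrable fun t => cauchyKer d (x - t) * f₂ t := fun x => by
    refine ((hi x).indicator (measurableSet_ball (x := c) (ε := 2 * r)).compl).congr
      (Eventually.of_forall fun t => ?_)
    simp only [hf₂, Set.indicator]; split_ifs <;> simp
  have hsplit : ∀ x, cauchyOp d f x = cauchyOp d f₁ x + cauchyOp d f₂ x := fun x => by
    rw [← cauchyOp_add (hi₁ x) (hi₂ x)]
    congr 1; ext t
    exact (congrFun (Set.indicator_self_add_compl (ball c (2 * r)) f) t).symm
  have hm₁ : AEMeasurable fun x => ‖cauchyOp d f₁ x‖ₑ :=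
    (aestronglyMeasurable_cauchyOp hd.ne' (hf.indicator measurableSet_ball)).enorm
  -- The comparison constant is the far part evaluated at the centre; the near part is left to
  -- `hloc`.
  refine ⟨cauchyOp d f₂ c, ?_⟩
  calc ∫⁻ x in ball c r, ‖cauchyOp d f x - cauchyOp d f₂ c‖ₑ
      ≤ ∫⁻ x in ball c r, (‖cauchyOp d f₁ x‖ₑ +
          3 * ∫⁻ t, ‖f t‖ₑ * ENNReal.ofReal (poisson r (t - c))) := by
        refine setLIntegral_mono' measurableSet_ball fun x hx => ?_
        rw [hsplit, add_sub_assoc]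
        refine (enorm_add_le _ _).trans ?_
        gcongr
        refine (enorm_cauchyOp_sub_le hd hr hx (fun t ht => ?_) (hi₂ x) (hi₂ c)).trans ?_
        · exact Set.indicator_of_notMem (not_not.2 ht) _
        · gcongr with t
          exact enorm_indicator_le_enorm_self f t
    _ = (∫⁻ x in ball c r, ‖cauchyOp d f₁ x‖ₑ) + ENNReal.ofReal (2 * r) *
          (3 * ∫⁻ t, ‖f t‖ₑ * ENNReal.ofReal (poisson r (t - c))) := by
        rw [lintegral_add_right _ measurable_const, lintegral_const, Measure.restrict_apply_univ,
          Real.volume_ball, mul_comm (3 * _)]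
    _ ≤ _ := by
        rw [mul_add]
        gcongr
        exact setLIntegral_ball_le_of_rpow hm₁ hq hr hloc

/-- The `L²` bound on the near part and kernel regularity on the far part bound the oscillation by
maximal functions of exponents 2 and 1, both bounded on `L^p` as `p > 2`. The a priori finiteness in
`fefferman_stein` comes from the decay of Cauchy integrals of boundedly supported functions. -/
theorem cauchyOp_Lp_of_two_lt {p : ℝ} (hp : 2 < p) :
    ∃ C : ℝ≥0, ∀ d : ℝ, 0 < d → ∀ (f : ℝ → ℂ) (R N : ℝ), BoundedSupp f R N →
      ∫⁻ x, ‖cauchyOp d f x‖ₑ ^ p ≤ C * ∫⁻ x, ‖f x‖ₑ ^ p := by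
  obtain ⟨C₁, hC₁⟩ := fefferman_stein (show 1 < p by linarith)
  obtain ⟨C₂, hC₂⟩ := exists_maximalPow_strong_type (s := 2) (p := p) (by norm_num) hp
  obtain ⟨C₃, hC₃⟩ := exists_maximal_strong_type (show 1 < p by linarith)
  obtain ⟨C₄, hC₄⟩ := poisson_le_maximal
  -- `8π²` is the `L²` constant, the factor 2 compares the doubled interval with the original, and
  -- the square root undoes the exponent 2.
  set K : ℝ≥0 := (2 * (8 * NNReal.pi * NNReal.pi)) ^ (1 / 2 : ℝ) with hK
  refine ⟨C₁ * (2 ^ (p - 1) * (K ^ p * C₂ + (3 * C₄) ^ p * C₃)), fun d hd f R N hf => ?_⟩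
  have hp0 : 0 ≤ p := by linarith
  have hfm := hf.meas.enorm
  set G : ℝ → ℝ≥0∞ := fun y => K * hlMaximalPow 2 (fun t => ‖f t‖ₑ) y +
    ((3 * C₄ : ℝ≥0) : ℝ≥0∞) * hlMaximal (fun t => ‖f t‖ₑ) y with hG
  have hGm : Measurable G :=
    ((measurable_hlMaximalPow _ _).const_mul _).add ((measurable_maximal _).const_mul _)
  have hosc : ∀ c r, 0 < r → ∃ a : ℂ, ∀ y ∈ ball c r,
      ∫⁻ x in ball c r, ‖cauchyOp d f x - a‖ₑ ≤ ENNReal.ofReal (2 * r) * G y := by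
    intro c r hr
    set A : ℝ≥0∞ := ((8 * NNReal.pi * NNReal.pi : ℝ≥0) : ℝ≥0∞) *
      ∫⁻ x in ball c (2 * r), ‖f x‖ₑ ^ (2 : ℝ) with hA
    have hr2 : ENNReal.ofReal (2 * r) ≠ 0 := by simpa using hr
    have hloc : ∫⁻ x in ball c r, ‖cauchyOp d ((ball c (2 * r)).indicator f) x‖ₑ ^ (2 : ℝ) ≤
        ENNReal.ofReal (2 * r) * (A / ENNReal.ofReal (2 * r)) := by
      rw [ENNReal.mul_div_cancel hr2 ENNReal.ofReal_ne_top]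
      refine (setLIntegral_le_lintegral _ _).trans
        (((hf.indicator measurableSet_ball).cauchyOp_L2 hd).trans ?_)
      rw [setLIntegral_indicator_ball f c (2 * r) (by norm_num)]
    obtain ⟨a, ha⟩ := cauchyOp_osc hd hr hf.meas (hf.integrable_cauchyKer_mul hd.ne')
      (by norm_num) hloc
    refine ⟨a, fun y hy => ha.trans (mul_le_mul_right (add_le_add ?_ ?_) _)⟩
    · have h1 : A / ENNReal.ofReal (2 * r) ≤ ((2 * (8 * NNReal.pi * NNReal.pi) : ℝ≥0) : ℝ≥0∞) *
          hlMaximal (fun t => ‖f t‖ₑ ^ (2 : ℝ)) y := by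
        refine ENNReal.div_le_of_le_mul ?_
        rw [hA]
        refine (mul_le_mul_right (lintegral_ball_le_maximal (fun x => ‖f x‖ₑ ^ (2 : ℝ))
          (ball_subset_ball (by linarith) hy)) _).trans (le_of_eq ?_)
        rw [ENNReal.ofReal_mul (p := 2) (q := 2 * r) (by norm_num), ENNReal.ofReal_ofNat]
        push_cast
        ring
      refine (ENNReal.rpow_le_rpow h1 (by norm_num)).trans (le_of_eq ?_)
      rw [ENNReal.mul_rpow_of_nonneg _ _ (by norm_num), hK, hlMaximalPow,
        ENNReal.coe_rpow_of_nonneg _ (by norm_num)]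
    · rw [ENNReal.coe_mul, mul_assoc, ENNReal.coe_ofNat]
      exact mul_le_mul_right (hC₄ _ hfm c r y hy) _
  refine (hC₁ _ (aestronglyMeasurable_cauchyOp hd.ne' hf.meas)
    (hf.cauchyOp_rpow_ne_top hd.ne' (by linarith)) G hGm hosc).trans ?_
  rw [ENNReal.coe_mul, mul_assoc]
  refine mul_le_mul_right ?_ _
  refine (lintegral_rpow_add_le (by linarith)
    ((measurable_hlMaximalPow _ _).const_mul _).aemeasurable).trans ?_
  rw [lintegral_const_mul_rpow hp0, lintegral_const_mul_rpow hp0,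
    ENNReal.coe_mul (2 ^ (p - 1)), ENNReal.coe_rpow_of_nonneg _ (by linarith : 0 ≤ p - 1), ENNReal.coe_ofNat, mul_assoc]
  refine mul_le_mul_right ?_ _
  rw [ENNReal.coe_add, ENNReal.coe_mul _ C₂, ENNReal.coe_mul _ C₃, ENNReal.coe_rpow_of_nonneg _ hp0,
    ENNReal.coe_rpow_of_nonneg _ hp0, add_mul, mul_assoc, mul_assoc]
  exact add_le_add (mul_le_mul_right (hC₂ _ hfm) _) (mul_le_mul_right (hC₃ _ hfm) _)

/-- With `F` the Cauchy integral of `f`, test against `g`, the conjugate of `F` times `|F| ^ (p -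
2)`, which lies in `L^q`. Transposing moves the operator onto `g`, and Hölder gives an inequality
for `X`, the integral of `|F| ^ p`, from which a power of `X` may be cancelled since `X` is known to
be finite. -/
theorem cauchyOp_Lp_dual {p q : ℝ} (hpq : p.HolderConjugate q) {K : ℝ≥0} {d : ℝ} (hd : 0 < d)
    (h : ∀ (f : ℝ → ℂ) (R N : ℝ), BoundedSupp f R N →
      ∫⁻ x, ‖cauchyOp d f x‖ₑ ^ q ≤ K * ∫⁻ x, ‖f x‖ₑ ^ q)
    (f : ℝ → ℂ) (R N : ℝ) (hf : BoundedSupp f R N) :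
    ∫⁻ x, ‖cauchyOp d f x‖ₑ ^ p ≤ ((K ^ (p / q) : ℝ≥0) : ℝ≥0∞) * ∫⁻ x, ‖f x‖ₑ ^ p := by
  have hp := hpq.pos
  have hq := hpq.symm.pos
  have hp1 := hpq.lt
  set F := cauchyOp d f with hF
  have hFm : AEStronglyMeasurable F := aestronglyMeasurable_cauchyOp hd.ne' hf.meas
  have hX := hf.cauchyOp_rpow_ne_top hd.ne' hp1
  set X := ∫⁻ x, ‖F x‖ₑ ^ p with hXdef
  set g : ℝ → ℂ := fun x => ((‖F x‖ ^ (p - 2) : ℝ) : ℂ) * (starRingEnd ℂ) (F x) with hg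
  have hgm : AEStronglyMeasurable g := by
    refine (Complex.continuous_ofReal.comp_aestronglyMeasurable ?_).mul
      (Complex.continuous_conj.comp_aestronglyMeasurable hFm)
    exact (hFm.norm.aemeasurable.pow_const _).aestronglyMeasurable
  have hgn : ∀ x, ‖g x‖ₑ = ‖F x‖ₑ ^ (p - 1) := by
    intro x
    rw [← ofReal_norm, ← ofReal_norm, ENNReal.ofReal_rpow_of_nonneg (norm_nonneg _) (by linarith)]
    congr 1
    rw [hg]
    simp only
    rw [norm_mul, RCLike.norm_conj, Complex.norm_real, Real.norm_of_nonneg (by positivity)]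
    rcases eq_or_ne ‖F x‖ 0 with h0 | h0
    · rw [h0, mul_zero, Real.zero_rpow (by linarith)]
    · rw [← Real.rpow_add_one h0]; congr 1; ring
  have hgq : ∫⁻ x, ‖g x‖ₑ ^ q = X := by
    refine lintegral_congr fun x => ?_
    rw [hgn, ← ENNReal.rpow_mul, hpq.sub_one_mul_conj]
  -- The transpose has height `-d`; conjugation returns it to height `d`, where the hypothesis
  -- holds. As `g` is neither bounded nor boundedly supported in general, the extended bound is
  -- used.
  have hcg : ∫⁻ x, ‖cauchyOp (-d) g x‖ₑ ^ q ≤ K * X := by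
    have hcm := Complex.continuous_conj.comp_aestronglyMeasurable hgm
    have h1 := cauchyOp_Lp_extend hpq.symm.lt hd.ne' h hcm (by
      simpa [← ofReal_norm] using hgq.trans_ne hX)
    have h2 : ∀ x, ‖cauchyOp (-d) g x‖ₑ = ‖cauchyOp d (fun x => (starRingEnd ℂ) (g x)) x‖ₑ := by
      intro x
      have := cauchyOp_conj d (fun x => (starRingEnd ℂ) (g x)) x
      simp only [Complex.conj_conj] at this
      rw [this]; simp [← ofReal_norm]
    simp only [h2]
    refine h1.trans (mul_le_mul_right (le_of_eq ?_) _)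
    rw [← hgq]
    simp [← ofReal_norm]
  obtain ⟨D, hD⟩ := hf.lintegral_cauchyKer_le hd.ne'
  have hAm : AEMeasurable fun s => ∫⁻ t, ‖cauchyKer d (s - t)‖ₑ * ‖f t‖ₑ := by
    have := (aestronglyMeasurable_convKer (continuous_cauchyKer hd.ne') hf.meas).enorm
    simp only [enorm_mul] at this
    exact this.lintegral_prod_right'
  have hfin : ∫⁻ x, (∫⁻ t, ‖cauchyKer d (x - t)‖ₑ * ‖f t‖ₑ) * ‖g x‖ₑ ≠ ∞ := by
    refine ((ENNReal.lintegral_mul_le_Lp_mul_Lq volume hpq hAm hgm.enorm).trans_lt ?_).ne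
    rw [hgq]
    refine ENNReal.mul_lt_top ?_ ?_
    · exact ENNReal.rpow_lt_top_of_nonneg (by positivity) (lintegral_decay_rpow_ne_top hD hp1)
    · exact ENNReal.rpow_lt_top_of_nonneg (by positivity) hX
  have hdual := integral_cauchyOp_mul hf.meas hgm hd.ne' hfin
  have hFg : ∀ x, F x * g x = ((‖F x‖ ^ p : ℝ) : ℂ) := by
    intro x
    rw [hg]
    simp only
    rw [mul_left_comm, Complex.mul_conj, Complex.normSq_eq_norm_sq, ← Complex.ofReal_mul]
    congr 1
    rcases eq_or_ne ‖F x‖ 0 with h0 | h0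
    · rw [h0, Real.zero_rpow hp.ne']; simp
    · rw [← Real.rpow_add_natCast h0]; congr 1; push_cast; ring
  have hXeq : X = ‖∫ x, F x * g x‖ₑ := by
    simp only [hFg]
    have hint : Integrable fun x => ‖F x‖ ^ p := by
      refine ⟨(hFm.norm.aemeasurable.pow_const _).aestronglyMeasurable, ?_⟩
      rw [hasFiniteIntegral_iff_enorm]
      refine lt_top_iff_ne_top.2 ?_
      convert! hX using 3 with x
      rw [Real.enorm_of_nonneg (by positivity), ← ENNReal.ofReal_rpow_of_nonneg (norm_nonneg _) hp.le,
        ofReal_norm]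
    rw [integral_complex_ofReal, ← ofReal_norm, Complex.norm_real,
      Real.norm_of_nonneg (integral_nonneg fun x => by positivity),
      ofReal_integral_eq_lintegral_ofReal hint (Eventually.of_forall fun x => by positivity)]
    refine lintegral_congr fun x => ?_
    rw [← ENNReal.ofReal_rpow_of_nonneg (norm_nonneg _) hp.le, ofReal_norm]
  set A := ∫⁻ x, ‖f x‖ₑ ^ p with hA
  have hle : X ≤ A ^ (1 / p) * (K * X) ^ (1 / q) := by
    conv_lhs => rw [hXeq, hdual, enorm_neg]
    refine (enorm_integral_le_lintegral_enorm _).trans ?_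
    simp only [enorm_mul]
    refine (ENNReal.lintegral_mul_le_Lp_mul_Lq volume hpq hf.meas.enorm
      (aestronglyMeasurable_cauchyOp (neg_ne_zero.2 hd.ne') hgm).enorm).trans ?_
    gcongr
  have hsum : 1 / p + 1 / q = 1 := by simpa only [one_div] using hpq.inv_add_inv_eq_one
  rcases eq_or_ne X 0 with h0 | h0
  · rw [h0]; exact zero_le
  have hXq : X ^ (1 / q) ≠ 0 := by simp [ENNReal.rpow_eq_zero_iff, h0, hX]
  have hXqt : X ^ (1 / q) ≠ ∞ := ENNReal.rpow_ne_top_of_nonneg (by positivity) hX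
  have hXp : X ^ (1 / p) ≤ A ^ (1 / p) * (K : ℝ≥0∞) ^ (1 / q) := by
    refine (ENNReal.mul_le_mul_iff_left hXq hXqt).1 ?_
    rw [← ENNReal.rpow_add _ _ h0 hX, hsum, ENNReal.rpow_one, mul_assoc,
      ← ENNReal.mul_rpow_of_nonneg _ _ (by positivity)]
    exact hle
  have := ENNReal.rpow_le_rpow hXp hp.le
  rw [← ENNReal.rpow_mul, ENNReal.mul_rpow_of_nonneg _ _ hp.le, ← ENNReal.rpow_mul,
    ← ENNReal.rpow_mul, one_div, inv_mul_cancel₀ hp.ne', ENNReal.rpow_one, ENNReal.rpow_one] at this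
  refine this.trans (le_of_eq ?_)
  rw [mul_comm, ENNReal.coe_rpow_of_nonneg _ (by positivity)]
  congr 2; ring

/-- The Cauchy integrals are bounded on `L^p`, uniformly in the height. -/
theorem cauchyOp_Lp {p : ℝ} (hp : 1 < p) :
    ∃ C : ℝ≥0, ∀ d : ℝ, 0 < d → ∀ f : ℝ → ℂ, AEStronglyMeasurable f →
      ∫⁻ x, ‖f x‖ₑ ^ p ≠ ∞ → ∫⁻ x, ‖cauchyOp d f x‖ₑ ^ p ≤ C * ∫⁻ x, ‖f x‖ₑ ^ p := by
  suffices h : ∃ C : ℝ≥0, ∀ d : ℝ, 0 < d → ∀ (f : ℝ → ℂ) (R N : ℝ), BoundedSupp f R N →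
      ∫⁻ x, ‖cauchyOp d f x‖ₑ ^ p ≤ C * ∫⁻ x, ‖f x‖ₑ ^ p by
    obtain ⟨C, hC⟩ := h
    exact ⟨C, fun d hd f hf hfp => cauchyOp_Lp_extend hp hd.ne' (hC d hd) hf hfp⟩
  rcases lt_trichotomy p 2 with h | rfl | h
  · have hpq := Real.HolderConjugate.conjExponent hp
    obtain ⟨C, hC⟩ := cauchyOp_Lp_of_two_lt (p := p.conjExponent) (by
      rw [Real.conjExponent, lt_div_iff₀ (by linarith)]; linarith)
    exact ⟨_, fun d hd f R N hf => cauchyOp_Lp_dual hpq hd (hC d hd) f R N hf⟩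
  · exact ⟨_, fun d hd f R N hf => hf.cauchyOp_L2 hd⟩
  · exact cauchyOp_Lp_of_two_lt h

/-! ### Poisson approximation and boundary values of Cauchy integrals. -/

theorem poisson_le_norm_cauchyKer {d : ℝ} (t : ℝ) : poisson d t ≤ ‖cauchyKer d t‖ := by
  have h := Complex.abs_im_le_norm (cauchyKer d t)
  rw [cauchyKer_im, abs_neg] at h
  exact (le_abs_self _).trans h

theorem poisson_sub_comm (d x t : ℝ) : poisson d (x - t) = poisson d (t - x) := by
  rw [← neg_sub, poisson_neg]

theorem measurable_poisson_sub {d : ℝ} (hd : 0 < d) (x : ℝ) :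
    Measurable fun t => ENNReal.ofReal (poisson d (t - x)) :=
  ((continuous_poisson hd).comp (continuous_id.sub continuous_const)).measurable.ennreal_ofReal

theorem lintegral_mul_poisson_ne_top {d : ℝ} {f : ℝ → ℂ} {x : ℝ}
    (hi : Integrable fun t => cauchyKer d (x - t) * f t) :
    ∫⁻ t, ‖f t‖ₑ * ENNReal.ofReal (poisson d (t - x)) ≠ ∞ := by
  have h := hi.hasFiniteIntegral
  rw [hasFiniteIntegral_iff_enorm] at h
  refine ((lintegral_mono fun t => ?_).trans_lt h).ne
  rw [enorm_mul, mul_comm, ← poisson_sub_comm, ← ofReal_norm (cauchyKer _ _)]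
  gcongr
  exact poisson_le_norm_cauchyKer _

theorem lintegral_sub_mul_poisson_le {d : ℝ} (hd : 0 < d) (f : ℝ → ℂ) (a : ℂ) (x : ℝ) :
    ∫⁻ t, ‖f t - a‖ₑ * ENNReal.ofReal (poisson d (t - x)) ≤
      (∫⁻ t, ‖f t‖ₑ * ENNReal.ofReal (poisson d (t - x))) + ‖a‖ₑ * ENNReal.ofReal Real.pi := by
  rw [← lintegral_poisson_sub hd x, ← lintegral_const_mul' _ _ enorm_ne_top,
    ← lintegral_add_right _ ((measurable_poisson_sub hd x).const_mul _)]
  refine lintegral_mono fun t => ?_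
  rw [← add_mul]
  gcongr
  exact enorm_sub_le

theorem poisson_le_of_far {d e s : ℝ} (hd : 0 < d) (he : 0 < e) (hs : d ≤ |s|) :
    poisson e s ≤ 2 * e / d * poisson d s := by
  have h : d ^ 2 ≤ s ^ 2 := by rw [← sq_abs s]; exact pow_le_pow_left₀ hd.le hs 2
  have hs2 : 0 < s ^ 2 := lt_of_lt_of_le (by positivity) h
  rw [poisson, poisson, div_mul_div_comm, div_le_div_iff₀ (by positivity) (by positivity)]
  nlinarith [mul_pos he hd, mul_pos (mul_pos he hd) hs2, mul_pos (mul_pos he hd) (mul_pos he he)]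

/-- Almost every point is a Lebesgue point for the Poisson kernels. -/
theorem ae_tendsto_lintegral_sub_poisson {f : ℝ → ℂ} (hf : LocallyIntegrable f) :
    ∀ᵐ x, (∀ d, 0 < d → ∫⁻ t, ‖f t‖ₑ * ENNReal.ofReal (poisson d (t - x)) ≠ ∞) →
      Tendsto (fun e => ∫⁻ t, ‖f t - f x‖ₑ * ENNReal.ofReal (poisson e (t - x)))
        (𝓝[>] 0) (𝓝 0) := by
  obtain ⟨C, hC⟩ := annuli_bound (η := 2) (by norm_num) 0
  filter_upwards [IsUnifLocDoublingMeasure.ae_tendsto_average_norm_sub volume hf 1] with x hx hfin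
  have hfm : AEMeasurable fun t => ‖f t - f x‖ₑ :=
    (hf.aestronglyMeasurable.sub aestronglyMeasurable_const).enorm
  have hli : LocallyIntegrable fun t => f t - f x := hf.sub (locallyIntegrable_const _)
  have hav := hx (fun _ => x) id (l := 𝓝[>] 0) tendsto_id
    (eventually_mem_nhdsWithin.mono fun s hs =>
      mem_closedBall_self (by simpa using (le_of_lt hs)))
  have hsmall : ∀ ε : ℝ≥0, 0 < ε → ∃ δ : ℝ, 0 < δ ∧ ∀ s, 0 < s → s ≤ δ →
      ∫⁻ t in ball x s, ‖f t - f x‖ₑ ≤ ENNReal.ofReal (2 * s) * ε := by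
    intro ε hε
    have h1 := (hav.eventually (gt_mem_nhds (show (0 : ℝ) < ε from hε)))
    rw [eventually_nhdsWithin_iff, Metric.eventually_nhds_iff] at h1
    obtain ⟨δ, hδ, h1⟩ := h1
    refine ⟨δ / 2, by positivity, fun s hs hsδ => ?_⟩
    have h2 := h1 (y := s) (by rw [dist_zero_right, Real.norm_of_nonneg hs.le]; linarith) hs
    simp only [id] at h2
    rw [Real.restrict_closedBall_eq_ball, average_eq] at h2
    simp only [measureReal_restrict_apply_univ, Real.volume_real_ball hs.le, smul_eq_mul] at h2
    rw [inv_mul_lt_iff₀ (by positivity)] at h2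
    rw [← ofReal_integral_norm_eq_lintegral_enorm (hli.integrableOn_ball x s),
      ← ENNReal.ofReal_coe_nnreal, ← ENNReal.ofReal_mul (by positivity)]
    exact ENNReal.ofReal_le_ofReal h2.le
  rw [ENNReal.tendsto_nhds_zero]
  intro ε' hε'
  obtain ⟨ε, hε, hεε'⟩ : ∃ ε : ℝ≥0, 0 < ε ∧ (C : ℝ≥0∞) * ε ≤ ε' / 2 := by
    have h2 : ε' / 2 ≠ 0 := by simpa using hε'.ne'
    obtain ⟨ε, hε, h⟩ := ENNReal.exists_nnreal_pos_mul_lt (a := C) (by simp) h2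
    exact ⟨ε, hε, by rw [mul_comm]; exact h.le⟩
  obtain ⟨δ, hδ, hball⟩ := hsmall ε hε
  -- A finite reference quantity at the fixed scale `δ`: away from the ball the kernel of scale `e`
  -- is at most `2 e / δ` times the one of scale `δ`.
  set A := ∫⁻ t, ‖f t - f x‖ₑ * ENNReal.ofReal (poisson δ (t - x)) with hA
  have hAt : A ≠ ∞ := ((lintegral_sub_mul_poisson_le hδ f (f x) x).trans_lt
    (ENNReal.add_lt_top.2 ⟨lt_top_iff_ne_top.2 (hfin δ hδ),
      ENNReal.mul_lt_top enorm_lt_top ENNReal.ofReal_lt_top⟩)).ne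
  -- Restricting to the ball of radius `δ` makes all dyadic averages at most `ε`: beyond `δ` the
  -- integral stops growing while the length increases.
  have hnear : ∀ e, 0 < e → ∫⁻ t, (ball x δ).indicator (fun t => ‖f t - f x‖ₑ) t *
      ENNReal.ofReal (poisson e (t - x)) ≤ ε' / 2 := by
    intro e he
    have h := hC x e he _ (hfm.indicator (measurableSet_ball (x := x) (ε := δ))) ε fun k => by
      have hk : 0 < 2 ^ k * e := by positivity
      rw [ENNReal.rpow_zero, mul_one]
      rcases le_total (2 ^ k * e) δ with h | h
      · refine le_trans (lintegral_mono fun t => ?_) (hball _ hk h)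
        exact Set.indicator_le_self _ _ t
      · refine (setLIntegral_le_lintegral _ _).trans ?_
        rw [lintegral_indicator measurableSet_ball]
        refine (hball δ hδ le_rfl).trans ?_
        gcongr
    refine le_trans ?_ hεε'
    calc _ ≤ ∫⁻ t, ENNReal.ofReal e * ((ball x δ).indicator (fun t => ‖f t - f x‖ₑ) t *
            ENNReal.ofReal (max e |t - x| ^ (-2 : ℝ))) := by
          refine lintegral_mono fun t => ?_
          rw [mul_left_comm, ← ENNReal.ofReal_mul he.le]
          gcongr
          exact poisson_le_rpow he _
      _ = _ := lintegral_const_mul' _ _ ENNReal.ofReal_ne_top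
      _ ≤ ENNReal.ofReal e * (C * ENNReal.ofReal (e ^ (1 - 2 : ℝ)) * ε) := mul_le_mul_right h _
      _ = _ := by
        rw [show (1 - 2 : ℝ) = -1 by norm_num, Real.rpow_neg_one,
          show ∀ a b c d : ℝ≥0∞, a * (b * c * d) = (a * c) * (b * d) from fun a b c d => by ring,
          ← ENNReal.ofReal_mul he.le, mul_inv_cancel₀ he.ne', ENNReal.ofReal_one, one_mul]
  have hfar : ∀ e, 0 < e → ∫⁻ t, (ball x δ)ᶜ.indicator (fun t => ‖f t - f x‖ₑ) t *
      ENNReal.ofReal (poisson e (t - x)) ≤ ENNReal.ofReal (2 * e / δ) * A := by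
    intro e he
    rw [hA, ← lintegral_const_mul' _ _ ENNReal.ofReal_ne_top]
    refine lintegral_mono fun t => ?_
    by_cases ht : t ∈ ball x δ
    · rw [Set.indicator_of_notMem (not_not.2 ht), zero_mul]; exact zero_le
    · rw [Set.indicator_of_mem (show t ∈ (ball x δ)ᶜ from ht), mul_left_comm,
        ← ENNReal.ofReal_mul (by positivity)]
      gcongr
      refine poisson_le_of_far hδ he ?_
      rw [mem_ball, Real.dist_eq, not_lt] at ht
      exact ht
  have hlim : Tendsto (fun e : ℝ => ENNReal.ofReal (2 * e / δ) * A) (𝓝[>] 0) (𝓝 0) := by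
    have h1 : Tendsto (fun e : ℝ => ENNReal.ofReal (2 * e / δ)) (𝓝[>] 0) (𝓝 0) := by
      have : Continuous fun e : ℝ => ENNReal.ofReal (2 * e / δ) := ENNReal.continuous_ofReal.comp (by fun_prop)
      have := (this.tendsto 0).mono_left (nhdsWithin_le_nhds (s := Set.Ioi 0))
      simpa using this
    have := ENNReal.Tendsto.mul_const h1 (Or.inr hAt)
    rwa [zero_mul] at this
  have hev := (ENNReal.tendsto_nhds_zero.1 hlim) (ε' / 2) (ENNReal.half_pos hε'.ne')
  filter_upwards [hev, eventually_mem_nhdsWithin] with e he1 he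
  have he0 : 0 < e := he
  calc ∫⁻ t, ‖f t - f x‖ₑ * ENNReal.ofReal (poisson e (t - x))
      = ∫⁻ t, ((ball x δ).indicator (fun t => ‖f t - f x‖ₑ) t *
          ENNReal.ofReal (poisson e (t - x)) + (ball x δ)ᶜ.indicator (fun t => ‖f t - f x‖ₑ) t *
          ENNReal.ofReal (poisson e (t - x))) := by
        refine lintegral_congr fun t => ?_
        rw [← add_mul, Set.indicator_self_add_compl_apply]
    _ = _ := lintegral_add_left'
        ((hfm.indicator measurableSet_ball).mul (measurable_poisson_sub he0 x).aemeasurable) _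
    _ ≤ ε' / 2 + ε' / 2 := add_le_add (hnear e he0) ((hfar e he0).trans he1)
    _ = ε' := ENNReal.add_halves ε'

/-- The Poisson integral, up to the factor `π`. -/
noncomputable def poissonOp (e : ℝ) (f : ℝ → ℂ) (x : ℝ) : ℂ := ∫ t, (poisson e (x - t) : ℂ) * f t

theorem continuous_poisson_ofReal {e : ℝ} (he : 0 < e) : Continuous fun t => (poisson e t : ℂ) :=
  Complex.continuous_ofReal.comp (continuous_poisson he)

theorem enorm_poisson_ofReal {e : ℝ} (he : 0 < e) (t : ℝ) :
    ‖(poisson e t : ℂ)‖ₑ = ENNReal.ofReal (poisson e t) := by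
  rw [← ofReal_norm, Complex.norm_real, Real.norm_of_nonneg (poisson_nonneg he t)]

theorem aestronglyMeasurable_poissonOp {e : ℝ} (he : 0 < e) {f : ℝ → ℂ}
    (hf : AEStronglyMeasurable f) : AEStronglyMeasurable (poissonOp e f) :=
  aestronglyMeasurable_conv (continuous_poisson_ofReal he) hf

theorem integrable_poisson_mul {e : ℝ} (he : 0 < e) {f : ℝ → ℂ} (hf : AEStronglyMeasurable f) {x : ℝ}
    (hfin : ∫⁻ t, ‖f t‖ₑ * ENNReal.ofReal (poisson e (t - x)) ≠ ∞) :
    Integrable fun t => (poisson e (x - t) : ℂ) * f t := by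
  refine integrable_mul_of_lintegral
    ((continuous_poisson_ofReal he).comp (continuous_const.sub continuous_id)).aestronglyMeasurable
    hf ?_
  simpa only [enorm_poisson_ofReal he, poisson_sub_comm e x, mul_comm] using hfin

theorem enorm_poissonOp_sub_le {e : ℝ} (he : 0 < e) {f : ℝ → ℂ} (hf : AEStronglyMeasurable f) {x : ℝ}
    (hfin : ∫⁻ t, ‖f t‖ₑ * ENNReal.ofReal (poisson e (t - x)) ≠ ∞) (a : ℂ) :
    ‖poissonOp e f x - Real.pi * a‖ₑ ≤
      ∫⁻ t, ‖f t - a‖ₑ * ENNReal.ofReal (poisson e (t - x)) := by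
  have hpi : ∫ t, (poisson e (x - t) : ℂ) = Real.pi := by
    rw [integral_complex_ofReal, integral_sub_left_eq_self (fun t => poisson e t),
      integral_poisson he]
  have hP : Integrable fun t => (poisson e (x - t) : ℂ) * a :=
    ((integrable_poisson he).comp_sub_left x).ofReal.mul_const a
  have h : poissonOp e f x - Real.pi * a = ∫ t, (poisson e (x - t) : ℂ) * (f t - a) := by
    simp only [mul_sub]
    rw [integral_sub (integrable_poisson_mul he hf hfin) hP, integral_mul_const, hpi]
    rfl
  rw [h]
  refine (enorm_integral_le_lintegral_enorm _).trans (lintegral_mono fun t => ?_)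
  simp only
  rw [enorm_mul, enorm_poisson_ofReal he, poisson_sub_comm, mul_comm]

theorem eLpNorm_ofReal_eq {α : Type*} [MeasureSpace α] {p : ℝ} (hp : 0 < p) (f : α → ℂ) :
    eLpNorm f (ENNReal.ofReal p) volume = (∫⁻ x, ‖f x‖ₑ ^ p) ^ (1 / p) := by
  rw [eLpNorm_eq_lintegral_rpow_enorm_toReal (by simpa using hp) ENNReal.ofReal_ne_top,
    ENNReal.toReal_ofReal hp.le]

theorem memLp_ofReal_iff {α : Type*} [MeasureSpace α] {p : ℝ} (hp : 0 < p) {f : α → ℂ} :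
    MemLp f (ENNReal.ofReal p) ↔ AEStronglyMeasurable f ∧ ∫⁻ x, ‖f x‖ₑ ^ p ≠ ∞ := by
  rw [MemLp, eLpNorm_ofReal_eq hp, lt_top_iff_ne_top, Ne, Ne, ENNReal.rpow_eq_top_iff_of_pos
    (by positivity)]

/-- Poisson smoothing adds its height to that of the Cauchy integral. The single point `t = x`,
where the kernel identity is not available, is a null set. -/
theorem poissonOp_cauchyOp {p : ℝ} (hp : 1 < p) {f : ℝ → ℂ} (hf : AEStronglyMeasurable f)
    (hfp : ∫⁻ x, ‖f x‖ₑ ^ p ≠ ∞) {d e : ℝ} (hd : 0 < d) (he : 0 < e) (x : ℝ) :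
    poissonOp e (cauchyOp d f) x = Real.pi * cauchyOp (e + d) f x := by
  obtain ⟨K, hK⟩ := lintegral_cauchyKer_mul_ne_top hd.ne' hp hf hfp
  have hfin : ∫⁻ s, ‖(poisson e (x - s) : ℂ)‖ₑ * ∫⁻ t, ‖cauchyKer d (s - t)‖ₑ * ‖f t‖ₑ ≠ ∞ := by
    have : ∫⁻ s, ‖(poisson e (x - s) : ℂ)‖ₑ * ∫⁻ t, ‖cauchyKer d (s - t)‖ₑ * ‖f t‖ₑ ≤
        ENNReal.ofReal Real.pi * K := by
      rw [← lintegral_poisson_sub he x, ← lintegral_mul_const' _ _ ENNReal.coe_ne_top]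
      refine lintegral_mono fun s => mul_le_mul' (le_of_eq ?_) (hK s)
      rw [enorm_poisson_ofReal he, poisson_sub_comm]
    exact (this.trans_lt (ENNReal.mul_lt_top ENNReal.ofReal_lt_top ENNReal.coe_lt_top)).ne
  have h := conv_conv (continuous_poisson_ofReal he) (continuous_cauchyKer hd.ne') hf x hfin
  simp only [poissonOp, cauchyOp] at h ⊢
  rw [h, ← integral_const_mul]
  refine integral_congr_ae ?_
  have hne : ∀ᵐ t : ℝ, t ≠ x := by simp [ae_iff]
  filter_upwards [hne] with t ht
  rw [integral_poisson_mul_cauchyKer he hd (sub_ne_zero.2 ht.symm), mul_assoc]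

theorem lintegral_mul_poisson_rpow_ne_top {p : ℝ} (hp : 1 < p) {f : ℝ → ℂ}
    (hf : AEStronglyMeasurable f) (hfp : ∫⁻ x, ‖f x‖ₑ ^ p ≠ ∞) {e : ℝ} (he : 0 < e) (x : ℝ) :
    ∫⁻ t, ‖f t‖ₑ * ENNReal.ofReal (poisson e (t - x)) ≠ ∞ :=
  lintegral_mul_poisson_ne_top (integrable_cauchyKer_mul_of_rpow he.ne' hp hf hfp x)

/-- The same shift with the smoothing done first. Absolute convergence now comes from the maximal
function, which dominates the Poisson integral of `|f|` and lies in `L^p`. -/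
theorem cauchyOp_poissonOp {p : ℝ} (hp : 1 < p) {f : ℝ → ℂ} (hf : AEStronglyMeasurable f)
    (hfp : ∫⁻ x, ‖f x‖ₑ ^ p ≠ ∞) {d e : ℝ} (hd : 0 < d) (he : 0 < e) (x : ℝ) :
    cauchyOp d (poissonOp e f) x = Real.pi * cauchyOp (d + e) f x := by
  obtain ⟨C, hC⟩ := poisson_le_maximal
  obtain ⟨M, hM⟩ := exists_maximal_strong_type hp
  have hp0 : 0 < p := by linarith
  have hfin : ∫⁻ s, ‖cauchyKer d (x - s)‖ₑ * ∫⁻ t, ‖(poisson e (s - t) : ℂ)‖ₑ * ‖f t‖ₑ ≠ ∞ := by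
    have hpq := Real.HolderConjugate.conjExponent hp
    have hle : ∀ s, ∫⁻ t, ‖(poisson e (s - t) : ℂ)‖ₑ * ‖f t‖ₑ ≤
        C * hlMaximal (fun t => ‖f t‖ₑ) s := fun s => by
      simpa only [enorm_poisson_ofReal he, poisson_sub_comm e s, mul_comm] using
        hC _ hf.enorm s e s (mem_ball_self he)
    have hMm : AEMeasurable fun s => (C : ℝ≥0∞) * hlMaximal (fun t => ‖f t‖ₑ) s :=
      ((measurable_maximal _).const_mul _).aemeasurable
    refine ((lintegral_mono fun s => mul_le_mul_right (hle s) _).trans_lt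
      ((ENNReal.lintegral_mul_le_Lp_mul_Lq volume hpq.symm
      (continuous_cauchyKer_sub hd.ne' x).aestronglyMeasurable.enorm hMm).trans_lt ?_)).ne
    rw [lintegral_sub_left_eq_self (fun t => ‖cauchyKer d t‖ₑ ^ p.conjExponent),
      lintegral_const_mul_rpow hp0.le]
    have hq := hpq.symm.pos
    refine ENNReal.mul_lt_top (ENNReal.rpow_lt_top_of_nonneg (by positivity)
      (lintegral_cauchyKer_rpow_ne_top hd.ne' hpq.symm.lt)) ?_
    refine ENNReal.rpow_lt_top_of_nonneg (by positivity) (ENNReal.mul_ne_top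
      (ENNReal.rpow_ne_top_of_nonneg hp0.le (by simp)) ?_)
    exact ((hM _ hf.enorm).trans_lt
      (ENNReal.mul_lt_top ENNReal.coe_lt_top (lt_top_iff_ne_top.2 hfp))).ne
  have h := conv_conv (continuous_cauchyKer hd.ne') (continuous_poisson_ofReal he) hf x hfin
  simp only [poissonOp, cauchyOp] at h ⊢
  rw [h, ← integral_const_mul]
  refine integral_congr_ae ?_
  have hne : ∀ᵐ t : ℝ, t ≠ x := by simp [ae_iff]
  filter_upwards [hne] with t ht
  rw [← integral_sub_left_eq_self _ _ (x - t)]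
  simp only [sub_sub_cancel]
  rw [← mul_assoc, add_comm d e, ← integral_poisson_mul_cauchyKer he hd (sub_ne_zero.2 ht.symm)]
  simp only [mul_comm]

/-- The Poisson integrals converge in `L^p`. -/
theorem tendsto_poissonOp_Lp {p : ℝ} (hp : 1 < p) {f : ℝ → ℂ} (hf : AEStronglyMeasurable f)
    (hfp : ∫⁻ x, ‖f x‖ₑ ^ p ≠ ∞) :
    Tendsto (fun e => ∫⁻ x, ‖poissonOp e f x - Real.pi * f x‖ₑ ^ p) (𝓝[>] 0) (𝓝 0) := by
  obtain ⟨C, hC⟩ := poisson_le_maximal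
  obtain ⟨M, hM⟩ := exists_maximal_strong_type hp
  have hp0 : 0 < p := by linarith
  have hli := locallyIntegrable_of_lintegral_rpow hf hp.le hfp
  refine tendsto_of_seq_tendsto fun u hu => ?_
  rw [tendsto_nhdsWithin_iff] at hu
  obtain ⟨hu0, hupos⟩ := hu
  have hu' : Tendsto u atTop (𝓝[>] 0) := tendsto_nhdsWithin_iff.2 ⟨hu0, hupos⟩
  obtain ⟨n₀, hn₀⟩ := eventually_atTop.1 hupos
  rw [← tendsto_add_atTop_iff_nat n₀]
  have hupos' : ∀ n, 0 < u (n + n₀) := fun n => hn₀ _ (by omega)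
  have hu'' := (tendsto_add_atTop_iff_nat n₀).2 hu'
  set K : ℝ≥0 := C + NNReal.pi with hK
  have hlim0 : ∀ᵐ x, Tendsto (fun n => ‖poissonOp (u (n + n₀)) f x - Real.pi * f x‖ₑ ^ p) atTop
      (𝓝 0) := by
    filter_upwards [ae_tendsto_lintegral_sub_poisson hli] with x hx
    have h1 := (hx fun d hd => lintegral_mul_poisson_rpow_ne_top hp hf hfp hd x).comp hu''
    have h2 : Tendsto (fun n => ‖poissonOp (u (n + n₀)) f x - Real.pi * f x‖ₑ) atTop (𝓝 0) :=
      tendsto_of_tendsto_of_tendsto_of_le_of_le tendsto_const_nhds h1 (fun _ => zero_le)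
        fun n => enorm_poissonOp_sub_le (hupos' n) hf
          (lintegral_mul_poisson_rpow_ne_top hp hf hfp (hupos' n) x) (f x)
    have h3 := ((ENNReal.continuous_rpow_const (y := p)).tendsto 0).comp h2
    rwa [ENNReal.zero_rpow_of_pos hp0] at h3
  have hbound : ∀ n, ∀ᵐ x, ‖poissonOp (u (n + n₀)) f x - Real.pi * f x‖ₑ ^ p ≤
      (K * hlMaximal (fun t => ‖f t‖ₑ) x) ^ p := by
    intro n
    filter_upwards [enorm_le_maximal_ae hli] with x hx
    refine ENNReal.rpow_le_rpow ?_ hp0.le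
    refine (enorm_poissonOp_sub_le (hupos' n) hf
      (lintegral_mul_poisson_rpow_ne_top hp hf hfp (hupos' n) x) (f x)).trans
      ((lintegral_sub_mul_poisson_le (hupos' n) f (f x) x).trans ?_)
    rw [hK, ENNReal.coe_add, add_mul]
    refine add_le_add (hC _ hf.enorm x _ x (mem_ball_self (hupos' n))) ?_
    rw [mul_comm]
    refine mul_le_mul' (le_of_eq ?_) hx
    rw [← ENNReal.ofReal_coe_nnreal]; rfl
  have h := tendsto_lintegral_of_dominated_convergence'
    (fun x => ((K : ℝ≥0∞) * hlMaximal (fun t => ‖f t‖ₑ) x) ^ p)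
    (fun n => (((aestronglyMeasurable_poissonOp (hupos' n) hf).sub
      (hf.const_mul _)).enorm.pow_const p)) hbound ?_ hlim0
  · simpa using h
  · rw [lintegral_const_mul_rpow hp0.le]
    refine ENNReal.mul_ne_top (ENNReal.rpow_ne_top_of_nonneg hp0.le (by simp)) ?_
    exact ((hM _ hf.enorm).trans_lt
      (ENNReal.mul_lt_top ENNReal.coe_lt_top (lt_top_iff_ne_top.2 hfp))).ne

theorem poissonOp_rpow_ne_top {p : ℝ} (hp : 1 < p) {f : ℝ → ℂ} (hf : AEStronglyMeasurable f)
    (hfp : ∫⁻ x, ‖f x‖ₑ ^ p ≠ ∞) {e : ℝ} (he : 0 < e) : ∫⁻ x, ‖poissonOp e f x‖ₑ ^ p ≠ ∞ := by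
  obtain ⟨C, hC⟩ := poisson_le_maximal
  obtain ⟨M, hM⟩ := exists_maximal_strong_type hp
  have hp0 : 0 < p := by linarith
  have h : ∫⁻ x, ‖poissonOp e f x‖ₑ ^ p ≤ ∫⁻ x, (C * hlMaximal (fun t => ‖f t‖ₑ) x) ^ p := by
    refine lintegral_mono fun x => ENNReal.rpow_le_rpow ?_ hp0.le
    have := enorm_poissonOp_sub_le he hf (lintegral_mul_poisson_rpow_ne_top hp hf hfp he x) 0
    simp only [mul_zero, sub_zero] at this
    exact this.trans (hC _ hf.enorm x e x (mem_ball_self he))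
  rw [lintegral_const_mul_rpow hp0.le] at h
  refine (h.trans_lt (ENNReal.mul_lt_top (ENNReal.rpow_lt_top_of_nonneg hp0.le (by simp)) ?_)).ne
  exact (hM _ hf.enorm).trans_lt
    (ENNReal.mul_lt_top ENNReal.coe_lt_top (lt_top_iff_ne_top.2 hfp))

/-- By `cauchyOp_poissonOp` the difference is `1 / π` times the Cauchy integral at height `d` of the
Poisson error. The bound is therefore independent of `d`, which yields the Cauchy property as the
heights go to zero. -/
theorem cauchyOp_height_sub {p : ℝ} (hp : 1 < p) :
    ∃ C : ℝ≥0, ∀ f : ℝ → ℂ, AEStronglyMeasurable f → ∫⁻ x, ‖f x‖ₑ ^ p ≠ ∞ →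
      ∀ d e : ℝ, 0 < d → 0 < e → ∫⁻ x, ‖cauchyOp (d + e) f x - cauchyOp d f x‖ₑ ^ p ≤
        C * ∫⁻ x, ‖poissonOp e f x - Real.pi * f x‖ₑ ^ p := by
  obtain ⟨C, hC⟩ := cauchyOp_Lp hp
  have hp0 : 0 < p := by linarith
  refine ⟨(NNReal.pi⁻¹) ^ p * C, fun f hf hfp d e hd he => ?_⟩
  have hPm := aestronglyMeasurable_poissonOp he hf
  have hPp := poissonOp_rpow_ne_top hp hf hfp he
  have hfπ : ∫⁻ x, ‖-(Real.pi : ℂ) * f x‖ₑ ^ p ≠ ∞ := by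
    have := lintegral_const_mul_rpow hp0.le ‖-(Real.pi : ℂ)‖₊ fun x => ‖f x‖ₑ
    simp only [enorm_mul]
    refine this.trans_ne (ENNReal.mul_ne_top (ENNReal.rpow_ne_top_of_nonneg hp0.le (by simp)) hfp)
  set g : ℝ → ℂ := fun x => poissonOp e f x + -(Real.pi : ℂ) * f x with hg
  have hgm : AEStronglyMeasurable g := hPm.add (hf.const_mul _)
  have hgp : ∫⁻ x, ‖g x‖ₑ ^ p ≠ ∞ := by
    refine ((lintegral_mono fun x => ENNReal.rpow_le_rpow (enorm_add_le _ _) hp0.le).trans_lt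
      ((lintegral_rpow_add_le hp.le hPm.enorm).trans_lt ?_)).ne
    refine ENNReal.mul_lt_top (ENNReal.rpow_lt_top_of_nonneg (by linarith) (by simp))
      (ENNReal.add_lt_top.2 ⟨lt_top_iff_ne_top.2 hPp, lt_top_iff_ne_top.2 hfπ⟩)
  have heq : ∀ x, cauchyOp (d + e) f x - cauchyOp d f x = (Real.pi : ℂ)⁻¹ * cauchyOp d g x := by
    intro x
    have hpi : (Real.pi : ℂ) ≠ 0 := by exact_mod_cast Real.pi_ne_zero
    rw [hg, cauchyOp_add (integrable_cauchyKer_mul_of_rpow hd.ne' hp hPm hPp x)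
      (integrable_cauchyKer_mul_of_rpow hd.ne' hp (hf.const_mul _) hfπ x), cauchyOp_const_mul,
      cauchyOp_poissonOp hp hf hfp hd he]
    field_simp
    ring
  have h := hC d hd g hgm hgp
  have e1 : ∫⁻ x, ‖cauchyOp (d + e) f x - cauchyOp d f x‖ₑ ^ p =
      ((NNReal.pi⁻¹ : ℝ≥0) : ℝ≥0∞) ^ p * ∫⁻ x, ‖cauchyOp d g x‖ₑ ^ p := by
    rw [← lintegral_const_mul_rpow hp0.le]
    refine lintegral_congr fun x => ?_
    rw [heq, enorm_mul]
    congr 2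
    rw [← ofReal_norm, norm_inv, Complex.norm_real, Real.norm_of_nonneg Real.pi_pos.le,
      ← ENNReal.ofReal_coe_nnreal]
    rfl
  rw [e1, ENNReal.coe_mul, ENNReal.coe_rpow_of_nonneg _ hp0.le, mul_assoc]
  refine mul_le_mul_right (h.trans (le_of_eq ?_)) _
  simp only [hg, neg_mul, sub_eq_add_neg]

theorem norm_cauchyKer_anti {d e : ℝ} (hd : 0 < d) (h : d ≤ e) (t : ℝ) :
    ‖cauchyKer e t‖ ≤ ‖cauchyKer d t‖ := by
  rw [← sq_le_sq₀ (norm_nonneg _) (norm_nonneg _), norm_cauchyKer_sq, norm_cauchyKer_sq]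
  exact inv_anti₀ (by positivity) (by gcongr)

theorem tendsto_cauchyOp_height {e : ℝ} (he : 0 < e) {f : ℝ → ℂ} {x : ℝ} {δ : ℕ → ℝ}
    (hδ : ∀ n, 0 < δ n) (hδlim : Tendsto δ atTop (𝓝 0)) (hf : AEStronglyMeasurable f)
    (hi : Integrable fun t => cauchyKer e (x - t) * f t) :
    Tendsto (fun n => cauchyOp (e + δ n) f x) atTop (𝓝 (cauchyOp e f x)) := by
  refine tendsto_integral_of_dominated_convergence _ (fun n =>
    (continuous_cauchyKer_sub (by linarith [hδ n]) x).aestronglyMeasurable.mul hf) hi.norm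
    (fun n => Eventually.of_forall fun t => ?_) (Eventually.of_forall fun t => ?_)
  · rw [norm_mul, norm_mul]
    exact mul_le_mul_of_nonneg_right (norm_cauchyKer_anti he (by linarith [hδ n]) _) (norm_nonneg _)
  · refine Tendsto.mul_const _ ?_
    unfold cauchyKer
    refine Tendsto.inv₀ ?_ (add_mul_I_ne_zero he.ne' _)
    have h : Tendsto (fun n => e + δ n) atTop (𝓝 e) := by simpa using hδlim.const_add e
    exact ((Complex.continuous_ofReal.tendsto e).comp h |>.mul_const Complex.I).const_add _

/-- The Cauchy integrals of an `L^p` function converge almost everywhere at the boundary. -/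
theorem ae_tendsto_cauchyOp_of_rpow {p : ℝ} (hp : 1 < p) {f : ℝ → ℂ} (hf : AEStronglyMeasurable f)
    (hfp : ∫⁻ x, ‖f x‖ₑ ^ p ≠ ∞) :
    ∀ᵐ x, ∃ l : ℂ, Tendsto (fun d => cauchyOp d f x) (𝓝[>] 0) (𝓝 l) := by
  have hp0 : 0 < p := by linarith
  obtain ⟨C, hC⟩ := cauchyOp_Lp hp
  obtain ⟨D, hD⟩ := cauchyOp_height_sub hp
  have : Fact (1 ≤ ENNReal.ofReal p) := ⟨by simpa using hp.le⟩
  set δ : ℕ → ℝ := fun n => 1 / ((n : ℝ) + 1) with hδ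
  have hδ0 : ∀ n, 0 < δ n := fun n => by positivity
  have hδanti : Antitone δ := fun m n hmn => one_div_le_one_div_of_le (by positivity) (by
    have : (m : ℝ) ≤ n := by exact_mod_cast hmn
    linarith)
  have hδlim : Tendsto δ atTop (𝓝 0) := tendsto_one_div_add_atTop_nhds_zero_nat
  have hmem : ∀ n, MemLp (cauchyOp (δ n) f) (ENNReal.ofReal p) := fun n =>
    (memLp_ofReal_iff hp0).2 ⟨aestronglyMeasurable_cauchyOp (hδ0 n).ne' hf,
      ((hC _ (hδ0 n) f hf hfp).trans_lt
        (ENNReal.mul_lt_top ENNReal.coe_lt_top (lt_top_iff_ne_top.2 hfp))).ne⟩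
  have hW : Tendsto (fun e => (D * ∫⁻ x, ‖poissonOp e f x - Real.pi * f x‖ₑ ^ p) ^ (1 / p))
      (𝓝[>] 0) (𝓝 0) := by
    have h1 := ENNReal.Tendsto.const_mul (a := D) (tendsto_poissonOp_Lp hp hf hfp)
      (Or.inr ENNReal.coe_ne_top)
    rw [mul_zero] at h1
    have h2 := ((ENNReal.continuous_rpow_const (y := 1 / p)).tendsto 0).comp h1
    rwa [ENNReal.zero_rpow_of_pos (by positivity)] at h2
  have hcauchy : CauchySeq fun n => (hmem n).toLp (cauchyOp (δ n) f) := by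
    rw [EMetric.cauchySeq_iff]
    intro ε hε
    have h1 := hW.eventually (gt_mem_nhds hε)
    rw [eventually_nhdsWithin_iff, Metric.eventually_nhds_iff] at h1
    obtain ⟨η, hη, h1⟩ := h1
    obtain ⟨n₀, hn₀⟩ := eventually_atTop.1 (hδlim.eventually (gt_mem_nhds hη))
    have key : ∀ m n, n₀ ≤ m → m ≤ n →
        edist ((hmem m).toLp (cauchyOp (δ m) f)) ((hmem n).toLp (cauchyOp (δ n) f)) < ε := by
      intro m n hm hmn
      rcases (hδanti hmn).eq_or_lt with h | h
      · have : (hmem m).toLp (cauchyOp (δ m) f) = (hmem n).toLp (cauchyOp (δ n) f) := by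
          congr 1; rw [h]
        rw [this, edist_self]; exact hε
      · have he : 0 < δ m - δ n := by linarith
        rw [Lp.edist_toLp_toLp, eLpNorm_ofReal_eq hp0]
        have h2 := hD f hf hfp (δ n) (δ m - δ n) (hδ0 n) he
        rw [add_sub_cancel] at h2
        refine (ENNReal.rpow_le_rpow h2 (by positivity)).trans_lt (h1 ?_ he)
        rw [Real.dist_eq, sub_zero, abs_of_pos he]
        linarith [hn₀ m hm, hδ0 n]
    refine ⟨n₀, fun m hm n hn => ?_⟩
    rcases le_total m n with h | h
    · exact key m n hm h
    · rw [edist_comm]; exact key n m hn h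
  obtain ⟨H, hH⟩ := cauchySeq_tendsto_of_complete hcauchy
  have hHm : AEStronglyMeasurable (H : ℝ → ℂ) := Lp.aestronglyMeasurable H
  have hHp : ∫⁻ x, ‖(H : ℝ → ℂ) x‖ₑ ^ p ≠ ∞ := ((memLp_ofReal_iff hp0).1 (Lp.memLp H)).2
  have hlim : Tendsto (fun n => ∫⁻ x, ‖cauchyOp (δ n) f x - (H : ℝ → ℂ) x‖ₑ ^ p) atTop (𝓝 0) := by
    have h1 := (tendsto_iff_edist_tendsto_0.1 hH)
    have h2 := ((ENNReal.continuous_rpow_const (y := p)).tendsto 0).comp h1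
    rw [ENNReal.zero_rpow_of_pos hp0] at h2
    refine h2.congr fun n => ?_
    simp only [Function.comp_apply]
    rw [Lp.edist_def, eLpNorm_ofReal_eq hp0, ← ENNReal.rpow_mul, one_div, inv_mul_cancel₀ hp0.ne',
      ENNReal.rpow_one]
    refine lintegral_congr_ae ?_
    filter_upwards [(hmem n).coeFn_toLp] with x hx
    rw [Pi.sub_apply, hx]
  -- The limit `H` determines all the Cauchy integrals of `f`: let the inner height tend to zero in
  -- `poissonOp_cauchyOp`. This upgrades convergence in `L^p` along a sequence to pointwise
  -- convergence at the Lebesgue points of `H`, through all heights.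
  have hrep : ∀ e, 0 < e → ∀ x, poissonOp e H x = Real.pi * cauchyOp e f x := by
    intro e he x
    have hfpC := integrable_cauchyKer_mul_of_rpow he.ne' hp hf hfp x
    have h1 : Tendsto (fun n => poissonOp e (cauchyOp (δ n) f) x) atTop
        (𝓝 (Real.pi * cauchyOp e f x)) := by
      simp only [fun n => poissonOp_cauchyOp hp hf hfp (hδ0 n) he x]
      exact (tendsto_cauchyOp_height he hδ0 hδlim hf hfpC).const_mul _
    refine tendsto_nhds_unique ?_ h1
    have hpq := Real.HolderConjugate.conjExponent hp
    have hKt : (∫⁻ t, ‖cauchyKer e t‖ₑ ^ p.conjExponent) ^ (1 / p.conjExponent) ≠ ∞ :=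
      ENNReal.rpow_ne_top_of_nonneg (by have := hpq.symm.pos; positivity)
        (lintegral_cauchyKer_rpow_ne_top he.ne' hpq.symm.lt)
    have h2 := ENNReal.Tendsto.const_mul (((ENNReal.continuous_rpow_const (y := 1 / p)).tendsto
      0).comp hlim) (Or.inr hKt)
    rw [ENNReal.zero_rpow_of_pos (by positivity), mul_zero] at h2
    rw [tendsto_iff_edist_tendsto_0]
    refine tendsto_of_tendsto_of_tendsto_of_le_of_le tendsto_const_nhds h2
      (fun _ => zero_le) fun n => ?_
    have hn := (memLp_ofReal_iff hp0).1 (hmem n)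
    rw [edist_eq_enorm_sub]
    unfold poissonOp
    rw [← integral_sub
      (integrable_poisson_mul he hn.1 (lintegral_mul_poisson_rpow_ne_top hp hn.1 hn.2 he x))
      (integrable_poisson_mul he hHm (lintegral_mul_poisson_rpow_ne_top hp hHm hHp he x))]
    refine (enorm_integral_le_lintegral_enorm _).trans
      (le_trans ?_ (lintegral_cauchyKer_mul_le he.ne' hpq (hn.1.sub hHm) x))
    refine lintegral_mono fun t => ?_
    rw [← mul_sub, enorm_mul, enorm_poisson_ofReal he, ← ofReal_norm (cauchyKer _ _)]
    exact mul_le_mul_left (ENNReal.ofReal_le_ofReal (poisson_le_norm_cauchyKer _)) _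
  filter_upwards [ae_tendsto_lintegral_sub_poisson
    (locallyIntegrable_of_lintegral_rpow hHm hp.le hHp)] with x hx
  refine ⟨(H : ℝ → ℂ) x, ?_⟩
  have h1 := hx fun d hd => lintegral_mul_poisson_rpow_ne_top hp hHm hHp hd x
  have h2 : Tendsto (fun e => poissonOp e H x - Real.pi * (H : ℝ → ℂ) x) (𝓝[>] 0) (𝓝 0) := by
    rw [tendsto_zero_iff_enorm_tendsto_zero]
    refine tendsto_of_tendsto_of_tendsto_of_le_of_le' tendsto_const_nhds h1
      (Eventually.of_forall fun _ => zero_le) ?_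
    filter_upwards [eventually_mem_nhdsWithin] with e he
    exact enorm_poissonOp_sub_le he hHm (lintegral_mul_poisson_rpow_ne_top hp hHm hHp he x) _
  have hpi : (Real.pi : ℂ) ≠ 0 := by exact_mod_cast Real.pi_ne_zero
  have h3 := (h2.const_mul (Real.pi : ℂ)⁻¹).add_const ((H : ℝ → ℂ) x)
  rw [mul_zero, zero_add] at h3
  refine h3.congr' ?_
  filter_upwards [eventually_mem_nhdsWithin] with e he
  rw [hrep e he]
  field_simp
  ring

/-! ### From boundary values to principal values. -/

/-- Absolute convergence of all the Cauchy integrals of a measurable function. -/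
structure CauchyIntegrable (f : ℝ → ℂ) : Prop where
  meas : AEStronglyMeasurable f
  int : ∀ d : ℝ, 0 < d → ∀ x, Integrable fun t => cauchyKer d (x - t) * f t

/-- The kernel at height 1 is divided out: its reciprocal is continuous. -/
theorem CauchyIntegrable.locallyIntegrable {f : ℝ → ℂ} (h : CauchyIntegrable f) :
    LocallyIntegrable f := by
  have h1 := (h.int 1 one_pos 0).locallyIntegrable.continuous_mul
    (g := fun t : ℝ => (((0 - t : ℝ) : ℂ) + (1 : ℝ) * Complex.I)) (by fun_prop)
  refine h1.congr (Eventually.of_forall fun t => ?_)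
  simp only [cauchyKer]
  rw [mul_inv_cancel_left₀ (add_mul_I_ne_zero one_ne_zero _)]

theorem tendsto_cauchyKer_zero {s : ℝ} (hs : s ≠ 0) :
    Tendsto (fun d => cauchyKer d s) (𝓝[>] 0) (𝓝 (cauchyKer 0 s)) := by
  refine tendsto_nhdsWithin_of_tendsto_nhds ?_
  unfold cauchyKer
  refine Tendsto.inv₀ ?_ (by simpa using hs)
  exact (Continuous.tendsto (by fun_prop) 0)

theorem norm_cauchyKer_le_of_far {d s : ℝ} (hs : 1 ≤ |s|) :
    ‖cauchyKer d s‖ ≤ 2 * ‖cauchyKer 1 s‖ := by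
  have h : 1 ≤ s ^ 2 := by rw [← sq_abs]; nlinarith
  rw [← sq_le_sq₀ (norm_nonneg _) (by positivity), mul_pow, norm_cauchyKer_sq, norm_cauchyKer_sq,
    ← div_eq_mul_inv, ← one_div, div_le_div_iff₀ (by positivity) (by positivity)]
  nlinarith [sq_nonneg d]

theorem exists_tendsto_cauchyOp_of_far {f : ℝ → ℂ} (hf : AEStronglyMeasurable f) {x : ℝ}
    (hi : Integrable fun t => cauchyKer 1 (x - t) * f t) (hz : ∀ t, |x - t| < 1 → f t = 0) :
    ∃ l : ℂ, Tendsto (fun d => cauchyOp d f x) (𝓝[>] 0) (𝓝 l) := by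
  refine ⟨cauchyOp 0 f x, ?_⟩
  refine tendsto_integral_filter_of_dominated_convergence
    (fun t => 2 * ‖cauchyKer 1 (x - t) * f t‖) ?_ ?_ (hi.norm.const_mul 2)
    (Eventually.of_forall fun t => ?_)
  · filter_upwards [eventually_mem_nhdsWithin] with d hd
    exact (continuous_cauchyKer_sub (ne_of_gt hd) x).aestronglyMeasurable.mul hf
  · refine Eventually.of_forall fun d => Eventually.of_forall fun t => ?_
    rcases lt_or_ge |x - t| 1 with h | h
    · simp [hz t h]
    · rw [norm_mul, norm_mul, ← mul_assoc]
      exact mul_le_mul_of_nonneg_right (norm_cauchyKer_le_of_far h) (norm_nonneg _)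
  · rcases lt_or_ge |x - t| 1 with h | h
    · simp [hz t h]
    · exact (tendsto_cauchyKer_zero (abs_pos.1 (one_pos.trans_le h))).mul_const _

/-- Boundary values are local: the part of `f` in a ball about `0` is in `L^s`, and the rest
vanishes near `x`, where dominated convergence applies. Countably many balls suffice. -/
theorem CauchyIntegrable.ae_tendsto_cauchyOp {f : ℝ → ℂ} (h : CauchyIntegrable f) {s : ℝ}
    (hs : 1 < s) (hloc : ∀ n : ℕ, ∫⁻ x in ball 0 n, ‖f x‖ₑ ^ s ≠ ∞) :
    ∀ᵐ x, ∃ l : ℂ, Tendsto (fun d => cauchyOp d f x) (𝓝[>] 0) (𝓝 l) := by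
  have h1 : ∀ n : ℕ, ∀ᵐ x, ∃ l : ℂ,
      Tendsto (fun d => cauchyOp d ((ball 0 (n : ℝ)).indicator f) x) (𝓝[>] 0) (𝓝 l) := fun n =>
    ae_tendsto_cauchyOp_of_rpow hs (h.meas.indicator measurableSet_ball) (by
      rw [setLIntegral_indicator_ball f 0 n (by linarith)]; exact hloc n)
  filter_upwards [ae_all_iff.2 h1] with x hx
  obtain ⟨n, hn⟩ := exists_nat_gt (|x| + 1)
  obtain ⟨l, hl⟩ := hx n
  have hind : ∀ d, 0 < d → ∀ S : Set ℝ, MeasurableSet S →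
      Integrable fun t => cauchyKer d (x - t) * S.indicator f t := fun d hd S hS => by
    refine ((h.int d hd x).indicator hS).congr (Eventually.of_forall fun t => ?_)
    by_cases ht : t ∈ S
    · simp [Set.indicator_of_mem ht]
    · simp [Set.indicator_of_notMem ht]
  obtain ⟨m, hm⟩ := exists_tendsto_cauchyOp_of_far (x := x)
    (h.meas.indicator measurableSet_ball.compl) (hind 1 one_pos _ (measurableSet_ball (x := 0)
      (ε := (n : ℝ))).compl) (fun t ht => by
      refine Set.indicator_of_notMem (Set.notMem_compl_iff.2 ?_) _
      rw [mem_ball, Real.dist_eq, sub_zero]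
      have := abs_sub_abs_le_abs_sub t x
      rw [abs_sub_comm] at this
      linarith)
  refine ⟨l + m, (hl.add hm).congr' ?_⟩
  filter_upwards [eventually_mem_nhdsWithin] with d hd
  rw [← cauchyOp_add (hind d hd _ measurableSet_ball) (hind d hd _ measurableSet_ball.compl)]
  congr 1
  funext t
  exact congrFun (Set.indicator_self_add_compl (ball (0 : ℝ) n) f) t

/-- The difference of the truncated Hilbert kernel and the Cauchy kernel of the same scale. -/
noncomputable def diffKer (e t : ℝ) : ℂ :=
  {t : ℝ | e < |t|}.indicator (fun t => (t : ℂ)⁻¹) t - cauchyKer e t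

theorem measurableSet_lt_abs (e : ℝ) : MeasurableSet {t : ℝ | e < |t|} :=
  measurableSet_lt measurable_const continuous_abs.measurable

theorem measurable_diffKer {e : ℝ} (he : 0 < e) : Measurable (diffKer e) :=
  (Measurable.indicator (by fun_prop) (measurableSet_lt_abs e)).sub
    (continuous_cauchyKer he.ne').measurable

/-- For `|t| > e` the two kernels differ by `i e / (t (t + i e))`, which decays quadratically; for
`|t| ≤ e` only the Cauchy kernel remains, and both sides are of size `1 / e`. -/
theorem norm_diffKer_le {e : ℝ} (he : 0 < e) (t : ℝ) : ‖diffKer e t‖ ≤ 2 * poisson e t := by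
  have hp := poisson_nonneg he t
  have hk := norm_cauchyKer_sq e t
  have hpos : 0 < t ^ 2 + e ^ 2 := by positivity
  rw [← sq_le_sq₀ (norm_nonneg _) (by positivity)]
  by_cases h : e < |t|
  · have ht : t ≠ 0 := abs_pos.1 (he.trans h)
    have h2 : e ^ 2 ≤ t ^ 2 := by rw [← sq_abs t]; exact pow_le_pow_left₀ he.le h.le 2
    have htc : (t : ℂ) ≠ 0 := by exact_mod_cast ht
    have : diffKer e t = (e : ℂ) * Complex.I * (t : ℂ)⁻¹ * cauchyKer e t := by
      rw [diffKer, Set.indicator_of_mem (by exact h), cauchyKer]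
      field_simp [add_mul_I_ne_zero he.ne' t]
      ring
    rw [this, norm_mul, norm_mul, norm_mul, norm_inv, Complex.norm_I, mul_one, mul_pow, mul_pow,
      hk, Complex.norm_real, Complex.norm_real, Real.norm_eq_abs, Real.norm_eq_abs, inv_pow,
      sq_abs, sq_abs, poisson]
    have ht2 : 0 < t ^ 2 := by positivity
    rw [show e ^ 2 * (t ^ 2)⁻¹ * (t ^ 2 + e ^ 2)⁻¹ = e ^ 2 / (t ^ 2 * (t ^ 2 + e ^ 2)) by
      field_simp, mul_pow, div_pow, ← mul_div_assoc, div_le_div_iff₀ (by positivity) (by positivity)]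
    have : 0 ≤ e ^ 2 * (t ^ 2 + e ^ 2) := by positivity
    nlinarith
  · have h2 : t ^ 2 ≤ e ^ 2 := by
      rw [← sq_abs t]; exact pow_le_pow_left₀ (abs_nonneg _) (not_lt.1 h) 2
    rw [diffKer, Set.indicator_of_notMem (by exact h), zero_sub, norm_neg, hk, poisson, mul_pow,
      div_pow, ← mul_div_assoc, ← one_div, div_le_div_iff₀ (by positivity) (by positivity)]
    nlinarith

theorem integrable_diffKer {e : ℝ} (he : 0 < e) : Integrable (diffKer e) :=
  ((integrable_poisson he).const_mul 2).mono' (measurable_diffKer he).aestronglyMeasurable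
    (Eventually.of_forall fun t => norm_diffKer_le he t)

theorem diffKer_scale {e : ℝ} (he : 0 < e) (t : ℝ) :
    diffKer e t = (e : ℂ)⁻¹ * diffKer 1 (e⁻¹ * t) := by
  have hec : (e : ℂ) ≠ 0 := by exact_mod_cast he.ne'
  have hker : cauchyKer e t = (e : ℂ)⁻¹ * cauchyKer 1 (e⁻¹ * t) := by
    rw [cauchyKer, cauchyKer, ← mul_inv]
    congr 1
    push_cast
    field_simp
  have hiff : e < |t| ↔ 1 < |e⁻¹ * t| := by
    rw [abs_mul, abs_of_pos (inv_pos.2 he), lt_inv_mul_iff₀ he, mul_one]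
  rw [diffKer, diffKer, mul_sub, hker]
  congr 1
  by_cases h : e < |t|
  · rw [Set.indicator_of_mem (by exact h), Set.indicator_of_mem (by exact hiff.1 h)]
    push_cast
    field_simp
  · rw [Set.indicator_of_notMem (by exact h),
      Set.indicator_of_notMem (by exact fun h' => h (hiff.2 h')), mul_zero]

/-- Scale invariance makes the total mass independent of `e`. Its value is never needed, as it drops
out of the commutator. -/
theorem integral_diffKer {e : ℝ} (he : 0 < e) : ∫ t, diffKer e t = ∫ t, diffKer 1 t := by
  have hec : (e : ℂ) ≠ 0 := by exact_mod_cast he.ne'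
  simp only [diffKer_scale he]
  rw [integral_const_mul, Measure.integral_comp_mul_left (fun t => diffKer 1 t), inv_inv,
    abs_of_pos he, Complex.real_smul, inv_mul_cancel_left₀ hec]

theorem integrable_diffKer_mul {e : ℝ} (he : 0 < e) {f : ℝ → ℂ} (hf : AEStronglyMeasurable f) {x : ℝ}
    (hfin : ∫⁻ t, ‖f t‖ₑ * ENNReal.ofReal (poisson e (t - x)) ≠ ∞) :
    Integrable fun t => diffKer e (x - t) * f t := by
  refine ((integrable_poisson_mul he hf hfin).norm.const_mul 2).mono'
    (((measurable_diffKer he).comp (measurable_const.sub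
      measurable_id)).aestronglyMeasurable.mul hf) (Eventually.of_forall fun t => ?_)
  rw [norm_mul, norm_mul, ← mul_assoc, Complex.norm_real,
    Real.norm_of_nonneg (poisson_nonneg he _)]
  exact mul_le_mul_of_nonneg_right (norm_diffKer_le he _) (norm_nonneg _)

theorem enorm_integral_diffKer_mul_sub_le {e : ℝ} (he : 0 < e) {f : ℝ → ℂ}
    (hf : AEStronglyMeasurable f) {x : ℝ}
    (hfin : ∫⁻ t, ‖f t‖ₑ * ENNReal.ofReal (poisson e (t - x)) ≠ ∞) (a : ℂ) :
    ‖(∫ t, diffKer e (x - t) * f t) - (∫ t, diffKer 1 t) * a‖ₑ ≤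
      2 * ∫⁻ t, ‖f t - a‖ₑ * ENNReal.ofReal (poisson e (t - x)) := by
  have hc : (∫ t, diffKer 1 t) * a = ∫ t, diffKer e (x - t) * a := by
    rw [integral_mul_const, integral_sub_left_eq_self (fun t => diffKer e t), integral_diffKer he]
  rw [hc, ← integral_sub (integrable_diffKer_mul he hf hfin)
    (((integrable_diffKer he).comp_sub_left x).mul_const a),
    ← lintegral_const_mul' _ _ (by simp)]
  refine (enorm_integral_le_lintegral_enorm _).trans (lintegral_mono fun t => ?_)
  rw [← mul_sub, enorm_mul, mul_comm ‖f t - a‖ₑ, ← mul_assoc, ← ofReal_norm (diffKer _ _)]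
  refine mul_le_mul_left ?_ _
  rw [← ENNReal.ofReal_ofNat, ← ENNReal.ofReal_mul (by norm_num), ← poisson_sub_comm]
  exact ENNReal.ofReal_le_ofReal (norm_diffKer_le he _)

theorem truncHilbert_eq (e : ℝ) (f : ℝ → ℂ) (x : ℝ) :
    truncHilbert e f x = ∫ t, {t : ℝ | e < |t|}.indicator (fun t => (t : ℂ)⁻¹) (x - t) * f t := by
  rw [truncHilbert, ← integral_indicator (measurableSet_lt_abs e),
    ← integral_sub_left_eq_self (fun t => {t : ℝ | e < |t|}.indicator
      (fun t => f (x - t) / (t : ℂ)) t) volume x]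
  refine integral_congr_ae (Eventually.of_forall fun t => ?_)
  by_cases h : x - t ∈ {t : ℝ | e < |t|}
  · simp only [Set.indicator_of_mem h]
    rw [sub_sub_cancel, div_eq_mul_inv, mul_comm]
  · simp only [Set.indicator_of_notMem h, zero_mul]

/-- Boundary values of the Cauchy integrals give principal values. -/
theorem CauchyIntegrable.ae_hasHilbertPV {f : ℝ → ℂ} (h : CauchyIntegrable f) :
    ∀ᵐ x, ∀ l : ℂ, Tendsto (fun d => cauchyOp d f x) (𝓝[>] 0) (𝓝 l) →
      HasHilbertPV f x (l + (∫ t, diffKer 1 t) * f x) := by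
  filter_upwards [ae_tendsto_lintegral_sub_poisson h.locallyIntegrable] with x hx l hl
  have hfin : ∀ d, 0 < d → ∫⁻ t, ‖f t‖ₑ * ENNReal.ofReal (poisson d (t - x)) ≠ ∞ := fun d hd =>
    lintegral_mul_poisson_ne_top (h.int d hd x)
  have hdi := fun d (hd : 0 < d) => integrable_diffKer_mul hd h.meas (hfin d hd)
  have hsplit : ∀ e t, {t : ℝ | e < |t|}.indicator (fun t => (t : ℂ)⁻¹) (x - t) * f t =
      cauchyKer e (x - t) * f t + diffKer e (x - t) * f t := fun e t => by
    rw [diffKer]; ring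
  constructor
  · intro e he
    rw [← integrable_indicator_iff (measurableSet_lt_abs e)]
    have hi := (((h.int e he x).add (hdi e he)).comp_sub_left x)
    refine hi.congr (Eventually.of_forall fun t => ?_)
    simp only [Pi.add_apply]
    rw [← hsplit, sub_sub_cancel]
    by_cases ht : t ∈ {t : ℝ | e < |t|}
    · simp only [Set.indicator_of_mem ht]
      rw [div_eq_mul_inv, mul_comm]
    · simp only [Set.indicator_of_notMem ht, zero_mul]
  · have h2 : Tendsto (fun e => (∫ t, diffKer e (x - t) * f t) - (∫ t, diffKer 1 t) * f x)
        (𝓝[>] 0) (𝓝 0) := by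
      rw [tendsto_zero_iff_enorm_tendsto_zero]
      have h1 := ENNReal.Tendsto.const_mul (a := 2) (hx hfin) (Or.inr (by simp))
      rw [mul_zero] at h1
      refine tendsto_of_tendsto_of_tendsto_of_le_of_le' tendsto_const_nhds h1
        (Eventually.of_forall fun _ => zero_le) ?_
      filter_upwards [eventually_mem_nhdsWithin] with e he
      exact enorm_integral_diffKer_mul_sub_le he h.meas (hfin e he) _
    have h3 := hl.add (h2.add_const ((∫ t, diffKer 1 t) * f x))
    rw [zero_add] at h3
    refine h3.congr' ?_
    filter_upwards [eventually_mem_nhdsWithin] with e he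
    rw [sub_add_cancel, truncHilbert_eq, cauchyOp, ← integral_add (h.int e he x) (hdi e he)]
    simp only [hsplit]

/-! ### The commutator of a Cauchy integral with a function of bounded mean oscillation. -/

/-- Hölder for the Poisson average with exponent `s / τ` on `u ^ τ`: the oscillation factor then
carries a finite power, controlled by John-Nirenberg, and `u` appears to the power `s`. -/
theorem osc_mul_poisson {τ s : ℝ} (hτ : 1 ≤ τ) (hτs : τ < s) :
    ∃ C : ℝ≥0, ∀ (b : ℝ → ℂ) (β : ℝ≥0), OscBound b β → ∀ u : ℝ → ℝ≥0∞, AEMeasurable u →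
      ∀ c r y : ℝ, 0 < r → y ∈ ball c r →
        ∫⁻ t, (‖b t - ballAvg b c r‖ₑ * u t) ^ τ * ENNReal.ofReal (poisson r (t - c)) ≤
          (C * β * hlMaximalPow s u y) ^ τ := by
  have hτ0 : 0 < τ := by linarith
  have hs0 : 0 < s := by linarith
  have hpq := Real.HolderConjugate.conjExponent (p := s / τ) (by rwa [one_lt_div hτ0])
  set q := (s / τ).conjExponent with hq
  have hq1 : 1 < q := hpq.symm.lt
  have hq0 : 0 < q := by linarith
  obtain ⟨C₁, h₁⟩ := osc_poisson_bound (q := τ * q) (by nlinarith)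
  obtain ⟨C₂, h₂⟩ := poisson_le_maximalPow (s := s) (by linarith)
  refine ⟨(C₁ ^ (1 / q) * C₂ ^ (τ / s)) ^ (1 / τ), fun b β hb u hu c r y hr hy => ?_⟩
  have hbm : AEMeasurable fun t => ‖b t - ballAvg b c r‖ₑ :=
    (hb.locInt.aestronglyMeasurable.sub aestronglyMeasurable_const).enorm
  simp only [ENNReal.mul_rpow_of_nonneg _ _ hτ0.le]
  refine (lintegral_mul_poisson_holder hpq.symm (hbm.pow_const τ) (hu.pow_const τ) hr).trans ?_
  simp only [← ENNReal.rpow_mul]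
  rw [mul_div_cancel₀ s hτ0.ne', one_div_div]
  have hc : ∀ X : ℝ≥0, ((X ^ (1 / τ) : ℝ≥0) : ℝ≥0∞) ^ τ = X := fun X => by
    rw [← ENNReal.coe_rpow_of_nonneg _ hτ0.le, ← NNReal.rpow_mul, one_div_mul_cancel hτ0.ne',
      NNReal.rpow_one]
  have e1 := ENNReal.rpow_le_rpow (h₁ b β hb c r hr) (by positivity : 0 ≤ 1 / q)
  have e2 := ENNReal.rpow_le_rpow (h₂ u hu c r y hy) (by positivity : 0 ≤ τ / s)
  refine (mul_le_mul' e1 e2).trans (le_of_eq ?_)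
  rw [ENNReal.mul_rpow_of_nonneg _ _ (by positivity), ENNReal.mul_rpow_of_nonneg _ _ (by positivity),
    ← ENNReal.rpow_mul, ← ENNReal.rpow_mul, show τ * q * (1 / q) = τ by field_simp,
    show s * (τ / s) = τ by field_simp, hc, ENNReal.coe_mul,
    ENNReal.coe_rpow_of_nonneg _ (by positivity), ENNReal.coe_rpow_of_nonneg _ (by positivity)]
  ring

theorem cauchyOp_Lp_bound {p : ℝ} (hp : 1 < p) :
    ∃ C : ℝ≥0, ∀ d : ℝ, 0 < d → ∀ f : ℝ → ℂ, AEStronglyMeasurable f →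
      ∫⁻ x, ‖cauchyOp d f x‖ₑ ^ p ≤ C * ∫⁻ x, ‖f x‖ₑ ^ p := by
  obtain ⟨C, hC⟩ := cauchyOp_Lp hp
  -- The added 1 keeps the constant positive, so that the right side is infinite when `f` is not in
  -- `L^p`.
  refine ⟨C + 1, fun d hd f hf => ?_⟩
  by_cases h : ∫⁻ x, ‖f x‖ₑ ^ p = ∞
  · rw [h, ENNReal.mul_top (by simp)]
    exact le_top
  · refine (hC d hd f hf h).trans (mul_le_mul_left ?_ _)
    exact_mod_cast le_self_add

/-- Sharp function estimate for the commutator of a Cauchy integral and a multiplication. -/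
theorem commutator_osc {s : ℝ} (hs : 1 < s) :
    ∃ K : ℝ≥0, ∀ (b : ℝ → ℂ) (β : ℝ≥0), OscBound b β → ∀ f : ℝ → ℂ, AEStronglyMeasurable f →
      ∀ d : ℝ, 0 < d → (∀ x, Integrable fun t => cauchyKer d (x - t) * f t) →
      (∀ x, Integrable fun t => cauchyKer d (x - t) * (b t * f t)) → ∀ c r : ℝ, 0 < r →
      ∃ a : ℂ, ∀ y ∈ ball c r,
        ∫⁻ x in ball c r, ‖b x * cauchyOp d f x - cauchyOp d (fun t => b t * f t) x - a‖ₑ ≤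
          ENNReal.ofReal (2 * r) * ((K * β : ℝ≥0) *
            (hlMaximalPow s (fun t => ‖cauchyOp d f t‖ₑ) y + hlMaximalPow s (fun t => ‖f t‖ₑ) y)) := by
  obtain ⟨q, hq1, hqs⟩ := exists_between hs
  have hq0 : 0 < q := by linarith
  obtain ⟨C₁, h₁⟩ := osc_mul_poisson le_rfl hs
  obtain ⟨C₂, h₂⟩ := osc_mul_poisson hq1.le hqs
  obtain ⟨L, hL⟩ := cauchyOp_Lp_bound hq1
  refine ⟨(3 * L) ^ (1 / q) * C₂ + 3 * C₁, fun b β hb f hf d hd hif hibf c r hr => ?_⟩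
  have hbm : AEStronglyMeasurable b := hb.locInt.aestronglyMeasurable
  have hr2 : 0 ≤ 2 * r := by linarith
  set β' := ballAvg b c r with hβ'
  set g : ℝ → ℂ := fun t => (b t - β') * f t with hg
  have hgm : AEStronglyMeasurable g := (hbm.sub aestronglyMeasurable_const).mul hf
  have hig : ∀ x, Integrable fun t => cauchyKer d (x - t) * g t := fun x => by
    refine ((hibf x).sub ((hif x).const_mul β')).congr (Eventually.of_forall fun t => ?_)
    simp only [Pi.sub_apply, hg]
    ring
  set P : ℝ → ℝ≥0∞ := fun t => ENNReal.ofReal (poisson r (t - c)) with hP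
  -- The factor 3 comes from replacing the doubled ball by the Poisson kernel: `(2² + 1) r ≤ 3 (2
  -- r)`.
  set A : ℝ≥0∞ := (3 * L : ℝ≥0) * ∫⁻ t, ‖g t‖ₑ ^ q * P t with hA
  have hloc : ∫⁻ x in ball c r, ‖cauchyOp d ((ball c (2 * r)).indicator g) x‖ₑ ^ q ≤
      ENNReal.ofReal (2 * r) * A := by
    refine (setLIntegral_le_lintegral _ _).trans ((hL d hd _
      (hgm.indicator measurableSet_ball)).trans ?_)
    rw [setLIntegral_indicator_ball g c (2 * r) hq0, hA]
    refine (mul_le_mul_right (setLIntegral_ball_le_poisson _ hr 2 two_pos) _).trans ?_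
    rw [← mul_assoc, ← mul_assoc]
    refine mul_le_mul_left ?_ _
    rw [ENNReal.coe_mul, ENNReal.coe_ofNat, ← mul_assoc, mul_comm (L : ℝ≥0∞),
      ← ENNReal.ofReal_ofNat, ← ENNReal.ofReal_mul hr2]
    refine mul_le_mul_left (ENNReal.ofReal_le_ofReal ?_) _
    norm_num
    linarith
  obtain ⟨a, ha⟩ := cauchyOp_osc hd hr hgm hig hq1 hloc
  refine ⟨-a, fun y hy => ?_⟩
  set U := hlMaximalPow s (fun t => ‖cauchyOp d f t‖ₑ) y with hU
  set V := hlMaximalPow s (fun t => ‖f t‖ₑ) y with hV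
  have hCf := aestronglyMeasurable_cauchyOp hd.ne' hf
  have hgq : ∫⁻ t, ‖g t‖ₑ ^ q * P t ≤ (C₂ * β * V) ^ q := by
    simp only [hg, enorm_mul]
    exact h₂ b β hb _ hf.enorm c r y hr hy
  have hg1 : ∫⁻ t, ‖g t‖ₑ * P t ≤ C₁ * β * V := by
    have := h₁ b β hb _ hf.enorm c r y hr hy
    simp only [ENNReal.rpow_one] at this
    simpa only [hg, enorm_mul] using this
  have hF1 : ∫⁻ x in ball c r, ‖(b x - β') * cauchyOp d f x‖ₑ ≤
      ENNReal.ofReal (2 * r) * (C₁ * β * U) := by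
    have h3 := setLIntegral_ball_le_poisson (fun x => ‖(b x - β') * cauchyOp d f x‖ₑ) (c := c) hr 1
      one_pos
    rw [one_mul] at h3
    refine h3.trans (mul_le_mul' (ENNReal.ofReal_le_ofReal (by linarith)) ?_)
    have := h₁ b β hb _ hCf.enorm c r y hr hy
    simp only [ENNReal.rpow_one] at this
    simpa only [enorm_mul] using this
  have hA' : A ^ (1 / q) ≤ ((3 * L) ^ (1 / q) * C₂ : ℝ≥0) * β * V := by
    calc A ^ (1 / q) ≤ ((3 * L : ℝ≥0) * (C₂ * β * V) ^ q) ^ (1 / q) :=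
          ENNReal.rpow_le_rpow (mul_le_mul_right hgq _) (by positivity)
      _ = _ := by
          rw [ENNReal.mul_rpow_of_nonneg _ _ (by positivity), ← ENNReal.rpow_mul,
            mul_one_div_cancel hq0.ne', ENNReal.rpow_one, ENNReal.coe_mul (_ ^ _),
            ENNReal.coe_rpow_of_nonneg _ (by positivity)]
          ring
  -- Constants commute with the operator, so `b` may be replaced by `b` minus its average on this
  -- interval.
  have heq : ∀ x, b x * cauchyOp d f x - cauchyOp d (fun t => b t * f t) x - -a =
      (b x - β') * cauchyOp d f x - (cauchyOp d g x - a) := fun x => by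
    have : cauchyOp d (fun t => b t * f t) x = cauchyOp d g x + β' * cauchyOp d f x := by
      rw [← cauchyOp_const_mul, ← cauchyOp_add (hig x)]
      · congr 1
        funext t
        simp only [hg]
        ring
      · refine ((hif x).const_mul β').congr (Eventually.of_forall fun t => ?_)
        ring
    rw [this]
    ring
  calc ∫⁻ x in ball c r, ‖b x * cauchyOp d f x - cauchyOp d (fun t => b t * f t) x - -a‖ₑ
      ≤ ∫⁻ x in ball c r, (‖(b x - β') * cauchyOp d f x‖ₑ + ‖cauchyOp d g x - a‖ₑ) := by
        refine lintegral_mono fun x => ?_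
        rw [heq]
        exact enorm_sub_le
    _ = (∫⁻ x in ball c r, ‖(b x - β') * cauchyOp d f x‖ₑ) +
        ∫⁻ x in ball c r, ‖cauchyOp d g x - a‖ₑ :=
        lintegral_add_left' ((hbm.sub aestronglyMeasurable_const).mul hCf).enorm.restrict _
    _ ≤ ENNReal.ofReal (2 * r) * (C₁ * β * U) + ENNReal.ofReal (2 * r) *
        (((3 * L) ^ (1 / q) * C₂ : ℝ≥0) * β * V + 3 * (C₁ * β * V)) :=
        add_le_add hF1 (ha.trans (mul_le_mul_right
          (add_le_add hA' (mul_le_mul_right hg1 _)) _))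
    _ ≤ _ := by
        rw [← mul_add]
        refine mul_le_mul_right ?_ _
        set D := (3 * L) ^ (1 / q) * C₂
        have : (((D + 3 * C₁) * β : ℝ≥0) : ℝ≥0∞) * (U + V) =
            C₁ * β * U + (D * β * V + 3 * (C₁ * β * V)) + (D * β * U + 2 * (C₁ * β * U)) := by
          push_cast
          ring
        rw [this]
        exact le_self_add

theorem rpow_mul_bounded_ne_top {p : ℝ} (hp : 0 < p) {b f : ℝ → ℂ} {N : ℝ≥0}
    (hN : ∀ t, ‖b t‖ₑ ≤ N) (hfp : ∫⁻ x, ‖f x‖ₑ ^ p ≠ ∞) : ∫⁻ x, ‖b x * f x‖ₑ ^ p ≠ ∞ := by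
  have h : ∫⁻ x, ‖b x * f x‖ₑ ^ p ≤ ∫⁻ x, (N * ‖f x‖ₑ) ^ p :=
    lintegral_mono fun x => ENNReal.rpow_le_rpow
      ((enorm_mul _ _).trans_le (mul_le_mul_left (hN x) _)) hp.le
  rw [lintegral_const_mul_rpow hp.le] at h
  exact (h.trans_lt (ENNReal.mul_lt_top (ENNReal.rpow_lt_top_of_nonneg hp.le (by simp))
    (lt_top_iff_ne_top.2 hfp))).ne

/-- Boundedness of `b` is used only qualitatively, to place the commutator in `L^p` as
`fefferman_stein` demands. The height `N` does not enter the constant. -/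
theorem commutator_cauchyOp_of_bounded {p : ℝ} (hp : 1 < p) :
    ∃ C : ℝ≥0, ∀ (b : ℝ → ℂ) (β N : ℝ≥0), OscBound b β → (∀ t, ‖b t‖ₑ ≤ N) →
      ∀ f : ℝ → ℂ, AEStronglyMeasurable f → ∫⁻ x, ‖f x‖ₑ ^ p ≠ ∞ → ∀ d : ℝ, 0 < d →
        ∫⁻ x, ‖b x * cauchyOp d f x - cauchyOp d (fun t => b t * f t) x‖ₑ ^ p ≤
          (β : ℝ≥0∞) ^ p * C * ∫⁻ x, ‖f x‖ₑ ^ p := by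
  have hp0 : 0 < p := by linarith
  obtain ⟨s, hs1, hsp⟩ := exists_between hp
  obtain ⟨K, hK⟩ := commutator_osc hs1
  obtain ⟨L, hL⟩ := cauchyOp_Lp_bound hp
  obtain ⟨M, hM⟩ := exists_maximalPow_add_bound (by linarith : 0 < s) hsp hp.le
  obtain ⟨S, hS⟩ := fefferman_stein hp
  refine ⟨S * K ^ p * M * (L + 1), fun b β N hb hN f hf hfp d hd => ?_⟩
  have hbm : AEStronglyMeasurable b := hb.locInt.aestronglyMeasurable
  have hbf := rpow_mul_bounded_ne_top hp0 hN hfp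
  have hbfm := hbm.mul hf
  have hCfm := aestronglyMeasurable_cauchyOp hd.ne' hf
  have hCf : ∫⁻ x, ‖cauchyOp d f x‖ₑ ^ p ≠ ∞ := ((hL d hd f hf).trans_lt
    (ENNReal.mul_lt_top ENNReal.coe_lt_top (lt_top_iff_ne_top.2 hfp))).ne
  have hCbf : ∫⁻ x, ‖cauchyOp d (fun t => b t * f t) x‖ₑ ^ p ≠ ∞ := ((hL d hd _ hbfm).trans_lt
    (ENNReal.mul_lt_top ENNReal.coe_lt_top (lt_top_iff_ne_top.2 hbf))).ne
  have hFm : AEStronglyMeasurable fun x =>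
      b x * cauchyOp d f x - cauchyOp d (fun t => b t * f t) x :=
    (hbm.mul hCfm).sub (aestronglyMeasurable_cauchyOp hd.ne' hbfm)
  have hFp : ∫⁻ x, ‖b x * cauchyOp d f x - cauchyOp d (fun t => b t * f t) x‖ₑ ^ p ≠ ∞ := by
    refine ((lintegral_mono fun x => ENNReal.rpow_le_rpow enorm_sub_le hp0.le).trans_lt
      ((lintegral_rpow_add_le hp.le (hbm.mul hCfm).enorm).trans_lt ?_)).ne
    refine ENNReal.mul_lt_top (ENNReal.rpow_lt_top_of_nonneg (by linarith) (by simp))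
      (ENNReal.add_lt_top.2 ⟨lt_top_iff_ne_top.2 (rpow_mul_bounded_ne_top hp0 hN hCf),
        lt_top_iff_ne_top.2 hCbf⟩)
  have h1 := hS _ hFm hFp (fun y => (K * β : ℝ≥0) * (hlMaximalPow s (fun t => ‖cauchyOp d f t‖ₑ) y +
    hlMaximalPow s (fun t => ‖f t‖ₑ) y)) (((measurable_hlMaximalPow _ _).add
      (measurable_hlMaximalPow _ _)).const_mul _) (hK b β hb f hf d hd
      (integrable_cauchyKer_mul_of_rpow hd.ne' hp hf hfp)
      (integrable_cauchyKer_mul_of_rpow hd.ne' hp hbfm hbf))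
  refine h1.trans ((mul_le_mul_right (hM _ _ _ hCfm.enorm hf.enorm) _).trans ?_)
  refine (mul_le_mul_right (mul_le_mul_right (add_le_add_left (hL d hd f hf) _) _) _).trans
    (le_of_eq ?_)
  push_cast
  rw [ENNReal.coe_rpow_of_nonneg _ hp0.le, ENNReal.mul_rpow_of_nonneg _ _ hp0.le]
  ring

theorem OscBound.aestronglyMeasurable {b : ℝ → ℂ} {β : ℝ≥0} (hb : OscBound b β) :
    AEStronglyMeasurable b := hb.locInt.aestronglyMeasurable

/-- Although `b f` need not lie in `L^p`, the kernel times `b` minus an average is in the conjugate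
space by the weighted oscillation bound, and the average itself multiplies an integrable function.
-/
theorem OscBound.cauchyIntegrable_mul {b : ℝ → ℂ} {β : ℝ≥0} (hb : OscBound b β) {p : ℝ} (hp : 1 < p)
    {f : ℝ → ℂ} (hf : AEStronglyMeasurable f) (hfp : ∫⁻ x, ‖f x‖ₑ ^ p ≠ ∞) :
    CauchyIntegrable fun t => b t * f t := by
  refine ⟨hb.aestronglyMeasurable.mul hf, fun d hd x => ?_⟩
  have hpq := Real.HolderConjugate.conjExponent hp
  set q := p.conjExponent with hq
  have hq1 : 1 < q := hpq.symm.lt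
  have hq0 : 0 < q := by linarith
  have hbm : AEStronglyMeasurable fun t => b t - ballAvg b x d :=
    hb.aestronglyMeasurable.sub aestronglyMeasurable_const
  have hkm := (continuous_cauchyKer_sub hd.ne' x).aestronglyMeasurable (μ := volume)
  obtain ⟨C, hC⟩ := osc_weighted_bound hq1 hq1.le
  have h1 : ∫⁻ t, (‖cauchyKer d (x - t)‖ₑ * ‖b t - ballAvg b x d‖ₑ) ^ q ≠ ∞ := by
    refine ((lintegral_mono fun t => ?_).trans_lt ((hC b β hb x d hd).trans_lt
      (ENNReal.mul_lt_top (ENNReal.mul_lt_top ENNReal.coe_lt_top ENNReal.ofReal_lt_top)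
        (ENNReal.rpow_lt_top_of_nonneg hq0.le ENNReal.coe_ne_top)))).ne
    rw [ENNReal.mul_rpow_of_nonneg _ _ hq0.le, mul_comm]
    refine mul_le_mul_right ?_ _
    rw [← ofReal_norm, ENNReal.ofReal_rpow_of_nonneg (norm_nonneg _) hq0.le]
    refine ENNReal.ofReal_le_ofReal ?_
    have h := Real.rpow_le_rpow (norm_nonneg _) (norm_cauchyKer_le hd.ne' (x - t)) hq0.le
    rw [abs_of_pos hd, abs_sub_comm, ← Real.rpow_mul (by positivity), neg_one_mul] at h
    exact h
  have h2 := ENNReal.lintegral_mul_le_Lp_mul_Lq volume hpq.symm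
    (hkm.enorm.mul hbm.enorm) hf.enorm
  have h3 : Integrable fun t => cauchyKer d (x - t) * ((b t - ballAvg b x d) * f t) := by
    refine integrable_mul_of_lintegral hkm (hbm.mul hf) ?_
    simp only [enorm_mul, ← mul_assoc]
    refine (h2.trans_lt (ENNReal.mul_lt_top (ENNReal.rpow_lt_top_of_nonneg (by positivity) h1)
      (ENNReal.rpow_lt_top_of_nonneg (by positivity) hfp))).ne
  refine (h3.add ((integrable_cauchyKer_mul_of_rpow hd.ne' hp hf hfp x).const_mul
    (ballAvg b x d))).congr (Eventually.of_forall fun t => ?_)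
  simp only [Pi.add_apply]
  ring

theorem OscBound.setLIntegral_rpow_ne_top {b : ℝ → ℂ} {β : ℝ≥0} (hb : OscBound b β) {q : ℝ}
    (hq : 1 ≤ q) (c : ℝ) {r : ℝ} (hr : 0 < r) : ∫⁻ x in ball c r, ‖b x‖ₑ ^ q ≠ ∞ := by
  obtain ⟨C, hC⟩ := john_nirenberg hq
  have hq0 : 0 < q := by linarith
  have hbm : AEMeasurable fun t => ‖b t - ballAvg b c r‖ₑ ^ q :=
    (hb.aestronglyMeasurable.sub aestronglyMeasurable_const).enorm.pow_const q
  have h1 : ∫⁻ x in ball c r, ‖b x‖ₑ ^ q ≤ ∫⁻ x in ball c r, 2 ^ (q - 1) *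
      (‖b x - ballAvg b c r‖ₑ ^ q + ‖ballAvg b c r‖ₑ ^ q) := by
    refine lintegral_mono fun x => le_trans ?_ (ENNReal.rpow_add_le_mul_rpow_add_rpow _ _ hq)
    refine ENNReal.rpow_le_rpow ?_ hq0.le
    simpa using enorm_add_le (b x - ballAvg b c r) (ballAvg b c r)
  have h2q : (2 : ℝ≥0∞) ^ (q - 1) < ∞ := ENNReal.rpow_lt_top_of_nonneg (by linarith) (by simp)
  rw [lintegral_const_mul' _ _ h2q.ne, lintegral_add_left' hbm.restrict, setLIntegral_const,
    Real.volume_ball] at h1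
  refine (h1.trans_lt (ENNReal.mul_lt_top h2q (ENNReal.add_lt_top.2 ⟨?_, ?_⟩))).ne
  · exact (hC b β hb c r hr).trans_lt (ENNReal.mul_lt_top ENNReal.ofReal_lt_top
      (ENNReal.mul_lt_top ENNReal.coe_lt_top
        (ENNReal.rpow_lt_top_of_nonneg hq0.le ENNReal.coe_ne_top)))
  · exact ENNReal.mul_lt_top (ENNReal.rpow_lt_top_of_nonneg hq0.le enorm_ne_top)
      ENNReal.ofReal_lt_top

/-- Locally `b` has finite moments of every order, so Hölder allows any `s` strictly between 1 and
`p`. -/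
theorem OscBound.exists_setLIntegral_mul_rpow_ne_top {b : ℝ → ℂ} {β : ℝ≥0} (hb : OscBound b β)
    {p : ℝ} (hp : 1 < p) {f : ℝ → ℂ} (hf : AEStronglyMeasurable f) (hfp : ∫⁻ x, ‖f x‖ₑ ^ p ≠ ∞) :
    ∃ s : ℝ, 1 < s ∧ ∀ n : ℕ, ∫⁻ x in ball 0 n, ‖b x * f x‖ₑ ^ s ≠ ∞ := by
  obtain ⟨s, hs, hsp⟩ := exists_between hp
  have hs0 : 0 < s := by linarith
  have hpq := Real.HolderConjugate.conjExponent (p := p / s) (by rwa [one_lt_div hs0])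
  set q := (p / s).conjExponent with hq
  have hq1 : 1 < q := hpq.symm.lt
  refine ⟨s, hs, fun n => ?_⟩
  rcases Nat.eq_zero_or_pos n with rfl | hn
  · simp
  have h1 := ENNReal.lintegral_mul_le_Lp_mul_Lq (volume.restrict (ball (0 : ℝ) n)) hpq.symm
    (hb.aestronglyMeasurable.enorm.pow_const s).restrict (hf.enorm.pow_const s).restrict
  simp only [Pi.mul_apply, ← ENNReal.mul_rpow_of_nonneg _ _ hs0.le, ← enorm_mul,
    ← ENNReal.rpow_mul] at h1
  refine (h1.trans_lt (ENNReal.mul_lt_top ?_ ?_)).ne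
  · exact ENNReal.rpow_lt_top_of_nonneg (by positivity)
      (hb.setLIntegral_rpow_ne_top (by nlinarith) 0 (by exact_mod_cast hn))
  · rw [mul_div_cancel₀ p hs0.ne']
    exact ENNReal.rpow_lt_top_of_nonneg (by positivity)
      ((setLIntegral_le_lintegral _ _).trans_lt (lt_top_iff_ne_top.2 hfp)).ne

/-- Truncation of the real and imaginary parts at height `N`. -/
def clampParts (N : ℝ) (z : ℂ) : ℂ := ⟨max (-N) (min N z.re), max (-N) (min N z.im)⟩

theorem abs_clamp_sub_clamp_le (N a c : ℝ) : |max (-N) (min N a) - max (-N) (min N c)| ≤ |a - c| :=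
  by
  grind

theorem enorm_clampParts_sub_le (N : ℝ) (z w : ℂ) :
    ‖clampParts N z - clampParts N w‖ₑ ≤ 2 * ‖z - w‖ₑ := by
  rw [← ofReal_norm, ← ofReal_norm, ← ENNReal.ofReal_ofNat, ← ENNReal.ofReal_mul (by norm_num)]
  refine ENNReal.ofReal_le_ofReal ((Complex.norm_le_abs_re_add_abs_im _).trans ?_)
  have h1 := (abs_clamp_sub_clamp_le N z.re w.re).trans (Complex.abs_re_le_norm (z - w))
  have h2 := (abs_clamp_sub_clamp_le N z.im w.im).trans (Complex.abs_im_le_norm (z - w))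
  simp only [clampParts, Complex.sub_re, Complex.sub_im]
  linarith

theorem continuous_clampParts (N : ℝ) : Continuous (clampParts N) := by
  have : clampParts N = fun z : ℂ => ((max (-N) (min N z.re) : ℝ) : ℂ) +
      (max (-N) (min N z.im) : ℝ) * Complex.I := by
    funext z
    exact Complex.mk_eq_add_mul_I _ _
  rw [this]
  fun_prop

theorem clampParts_zero {N : ℝ} (hN : 0 ≤ N) : clampParts N 0 = 0 := by
  simp [clampParts, hN, Complex.ext_iff]

theorem clampParts_of_norm_le {N : ℝ} {z : ℂ} (h : ‖z‖ ≤ N) : clampParts N z = z := by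
  have h1 := abs_le.1 ((Complex.abs_re_le_norm z).trans h)
  have h2 := abs_le.1 ((Complex.abs_im_le_norm z).trans h)
  simp [clampParts, h1, h2]

theorem enorm_clampParts_le {N : ℝ≥0} (z : ℂ) : ‖clampParts N z‖ₑ ≤ (2 * N : ℝ≥0) := by
  rw [← ofReal_norm, ← ENNReal.ofReal_coe_nnreal]
  refine ENNReal.ofReal_le_ofReal ((Complex.norm_le_abs_re_add_abs_im _).trans ?_)
  have h : ∀ a : ℝ, |max (-(N : ℝ)) (min N a)| ≤ N := fun a => by
    have : 0 ≤ (N : ℝ) := N.2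
    grind
  simp only [clampParts]
  push_cast
  linarith [h z.re, h z.im]

theorem norm_clampParts_le {N : ℝ} (hN : 0 ≤ N) (z : ℂ) : ‖clampParts N z‖ ≤ 2 * ‖z‖ := by
  have h := enorm_clampParts_sub_le N z 0
  rw [clampParts_zero hN, sub_zero, sub_zero, ← ofReal_norm, ← ofReal_norm, ← ENNReal.ofReal_ofNat,
    ← ENNReal.ofReal_mul (by norm_num)] at h
  exact (ENNReal.ofReal_le_ofReal_iff (by positivity)).1 h

/-- The cut-off is Lipschitz with constant 2, and passing from the clamped average to the average of
the clamped function costs another 2. The bound does not depend on `N`. -/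
theorem OscBound.clamp {b : ℝ → ℂ} {β : ℝ≥0} (hb : OscBound b β) (N : ℝ≥0) :
    OscBound (fun t => clampParts N (b t)) (4 * β) := by
  have hm : AEStronglyMeasurable fun t => clampParts N (b t) :=
    (continuous_clampParts N).comp_aestronglyMeasurable hb.aestronglyMeasurable
  have hloc : LocallyIntegrable fun t => clampParts N (b t) := by
    refine (hb.locInt.smul (2 : ℝ)).mono hm (Eventually.of_forall fun t => ?_)
    refine (norm_clampParts_le N.2 _).trans (le_of_eq ?_)
    simp
  refine ⟨hloc, fun c r hr => ?_⟩
  set w := clampParts N (ballAvg b c r)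
  set T := fun t => clampParts N (b t)
  have h1 := enorm_ballAvg_sub_le hloc (c := c) hr w
  have h2 : ∫⁻ x in ball c r, ‖T x - w‖ₑ ≤ 2 * (ENNReal.ofReal (2 * r) * β) := by
    refine (lintegral_mono fun x => enorm_clampParts_sub_le N _ _).trans ?_
    rw [lintegral_const_mul' _ _ (by simp)]
    exact mul_le_mul_right (hb.osc c r hr) _
  change ∫⁻ x in ball c r, ‖T x - ballAvg T c r‖ₑ ≤ _
  calc ∫⁻ x in ball c r, ‖T x - ballAvg T c r‖ₑ
      ≤ ∫⁻ x in ball c r, (‖T x - w‖ₑ + ‖ballAvg T c r - w‖ₑ) := by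
        refine lintegral_mono fun x => ?_
        rw [← sub_sub_sub_cancel_right (T x) (ballAvg T c r) w]
        exact enorm_sub_le
    _ = (∫⁻ x in ball c r, ‖T x - w‖ₑ) + ENNReal.ofReal (2 * r) * ‖ballAvg T c r - w‖ₑ := by
        have hTm : AEMeasurable fun x => ‖T x - w‖ₑ := (hm.sub aestronglyMeasurable_const).enorm
        rw [lintegral_add_left' hTm.restrict,
          setLIntegral_const, Real.volume_ball, mul_comm ‖_‖ₑ]
    _ ≤ 2 * (ENNReal.ofReal (2 * r) * β) + 2 * (ENNReal.ofReal (2 * r) * β) :=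
        add_le_add h2 (h1.trans h2)
    _ = _ := by
        push_cast
        ring

/-- Clamp `b`, apply the bounded case and remove the cut-off by Fatou. Inside the Cauchy integral
the clamped products are dominated by `2 |b f|`, which is integrable against the kernel. -/
theorem commutator_cauchyOp {p : ℝ} (hp : 1 < p) :
    ∃ C : ℝ≥0, ∀ (b : ℝ → ℂ) (β : ℝ≥0), OscBound b β →
      ∀ f : ℝ → ℂ, AEStronglyMeasurable f → ∫⁻ x, ‖f x‖ₑ ^ p ≠ ∞ → ∀ d : ℝ, 0 < d →
        ∫⁻ x, ‖b x * cauchyOp d f x - cauchyOp d (fun t => b t * f t) x‖ₑ ^ p ≤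
          (β : ℝ≥0∞) ^ p * C * ∫⁻ x, ‖f x‖ₑ ^ p := by
  have hp0 : 0 < p := by linarith
  obtain ⟨C, hC⟩ := commutator_cauchyOp_of_bounded hp
  refine ⟨4 ^ p * C, fun b β hb f hf hfp d hd => ?_⟩
  have hbm : ∀ n : ℕ, AEStronglyMeasurable fun t => clampParts (n : ℝ≥0) (b t) := fun n =>
    (hb.clamp n).aestronglyMeasurable
  have hptw : ∀ t, Tendsto (fun n : ℕ => clampParts ((n : ℝ≥0) : ℝ) (b t)) atTop (𝓝 (b t)) := by
    intro t
    refine tendsto_const_nhds.congr' ?_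
    obtain ⟨m, hm⟩ := exists_nat_ge ‖b t‖
    filter_upwards [eventually_ge_atTop m] with n hn
    rw [clampParts_of_norm_le]
    have : (m : ℝ) ≤ n := by exact_mod_cast hn
    simpa using hm.trans this
  refine lintegral_rpow_le_of_tendsto (G := fun n x => clampParts (n : ℝ≥0) (b x) * cauchyOp d f x -
    cauchyOp d (fun t => clampParts (n : ℝ≥0) (b t) * f t) x) (fun n => ?_)
    (Eventually.of_forall fun x => ?_) (fun n => ?_)
  · exact ((hbm n).mul (aestronglyMeasurable_cauchyOp hd.ne' hf)).sub
      (aestronglyMeasurable_cauchyOp hd.ne' ((hbm n).mul hf))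
  · refine ((hptw x).mul_const _).sub ?_
    refine tendsto_cauchyOp_of_le hd.ne' (h := fun t => 2 * ‖b t * f t‖) (fun n => (hbm n).mul hf)
      (fun n t => ?_) ?_ fun t => (hptw t).mul_const _
    · rw [norm_mul, norm_mul, ← mul_assoc]
      exact mul_le_mul_of_nonneg_right (norm_clampParts_le (NNReal.coe_nonneg _) _) (norm_nonneg _)
    · refine (((hb.cauchyIntegrable_mul hp hf hfp).int d hd x).norm.const_mul 2).congr
        (Eventually.of_forall fun t => ?_)
      simp only [norm_mul]
      ring
  · refine (hC _ _ (2 * n) (hb.clamp n) (fun t => enorm_clampParts_le _) f hf hfp d hd).trans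
      (le_of_eq ?_)
    push_cast
    rw [ENNReal.mul_rpow_of_nonneg _ _ hp0.le, ENNReal.coe_rpow_of_nonneg _ hp0.le]
    push_cast
    ring

/-! ### The one-dimensional theorem. -/

/-- The commutator of the Hilbert transform on the line with a function of bounded mean
oscillation. -/
theorem commutator_hilbert {p : ℝ} (hp : 1 < p) :
    ∃ C : ℝ≥0, ∀ (b : ℝ → ℂ) (β : ℝ≥0), OscBound b β →
      ∀ f : ℝ → ℂ, AEStronglyMeasurable f → ∫⁻ x, ‖f x‖ₑ ^ p ≠ ∞ →
        (∀ᵐ x, ∃ L, HasHilbertPV f x L) ∧ (∀ᵐ x, ∃ L, HasHilbertPV (fun t => b t * f t) x L) ∧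
        ∫⁻ x, ‖b x * hilbert f x - hilbert (fun t => b t * f t) x‖ₑ ^ p ≤
          (β : ℝ≥0∞) ^ p * C * ∫⁻ x, ‖f x‖ₑ ^ p := by
  obtain ⟨C, hC⟩ := commutator_cauchyOp hp
  refine ⟨C, fun b β hb f hf hfp => ?_⟩
  have hcf : CauchyIntegrable f :=
    ⟨hf, fun d hd x => integrable_cauchyKer_mul_of_rpow hd.ne' hp hf hfp x⟩
  have hcb := hb.cauchyIntegrable_mul hp hf hfp
  obtain ⟨s, hs, hloc⟩ := hb.exists_setLIntegral_mul_rpow_ne_top hp hf hfp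
  have hlf := ae_tendsto_cauchyOp_of_rpow hp hf hfp
  have hlb := hcb.ae_tendsto_cauchyOp hs hloc
  refine ⟨?_, ?_, ?_⟩
  · filter_upwards [hlf, hcf.ae_hasHilbertPV] with x ⟨l, hl⟩ h
    exact ⟨_, h l hl⟩
  · filter_upwards [hlb, hcb.ae_hasHilbertPV] with x ⟨l, hl⟩ h
    exact ⟨_, h l hl⟩
  · have hδ0 : ∀ n : ℕ, 0 < 1 / ((n : ℝ) + 1) := fun n => by positivity
    have hδ : Tendsto (fun n : ℕ => 1 / ((n : ℝ) + 1)) atTop (𝓝[>] 0) :=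
      tendsto_nhdsWithin_iff.2 ⟨tendsto_one_div_add_atTop_nhds_zero_nat,
        Eventually.of_forall hδ0⟩
    refine lintegral_rpow_le_of_tendsto (fun n =>
      (hb.aestronglyMeasurable.mul (aestronglyMeasurable_cauchyOp (hδ0 n).ne' hf)).sub
        (aestronglyMeasurable_cauchyOp (hδ0 n).ne' hcb.meas)) ?_
      fun n => hC b β hb f hf hfp _ (hδ0 n)
    filter_upwards [hlf, hcf.ae_hasHilbertPV, hlb, hcb.ae_hasHilbertPV] with x ⟨l, hl⟩ h ⟨m, hm⟩ h'
    -- Both principal values contain the mass of `diffKer 1` times `b x * f x`; these terms cancel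
    -- and leave the limit of the Cauchy commutators.
    rw [(h l hl).hilbert_eq, (h' m hm).hilbert_eq]
    convert! ((hl.comp hδ).const_mul (b x)).sub (hm.comp hδ) using 2
    ring

/-- Local integrability is not assumed. If `g` is not integrable on an interval its average takes
the default value `0`; in either case finiteness makes `g` minus a constant integrable there, hence
`g` itself. -/
theorem oscBound_of_bmoNorm_le {g : ℝ → ℂ} (hg : AEStronglyMeasurable g) {β : ℝ≥0}
    (h : bmoNorm g ≤ β) : OscBound g β := by
  have h1 : ∀ r s : ℝ, r < s → ∫⁻ x in Set.Icc r s, ‖g x - ⨍ u in Set.Icc r s, g u‖ₑ ≤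
      ENNReal.ofReal (s - r) * β := fun r s hrs => by
    have h2 := (le_iSup₂_of_le r s (le_iSup_of_le hrs le_rfl)).trans h
    rw [setLAverage_eq, Real.volume_Icc] at h2
    rw [mul_comm]
    exact (ENNReal.div_le_iff (by simpa using hrs) ENNReal.ofReal_ne_top).1 h2
  constructor
  · intro x
    refine ⟨Set.Icc (x - 1) (x + 1), Icc_mem_nhds (by linarith) (by linarith), ?_⟩
    have hm : AEStronglyMeasurable (fun y => g y - ⨍ u in Set.Icc (x - 1) (x + 1), g u)
        (volume.restrict (Set.Icc (x - 1) (x + 1))) :=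
      (hg.sub aestronglyMeasurable_const).restrict
    have hi : IntegrableOn (fun y => g y - ⨍ u in Set.Icc (x - 1) (x + 1), g u)
        (Set.Icc (x - 1) (x + 1)) := by
      refine ⟨hm, ?_⟩
      rw [hasFiniteIntegral_iff_enorm]
      exact (h1 _ _ (by linarith)).trans_lt
        (ENNReal.mul_lt_top ENNReal.ofReal_lt_top ENNReal.coe_lt_top)
    have hc : IntegrableOn (fun _ : ℝ => ⨍ u in Set.Icc (x - 1) (x + 1), g u)
        (Set.Icc (x - 1) (x + 1)) := integrableOn_const (by simp)
    refine (hi.add hc).congr (Eventually.of_forall fun y => ?_)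
    simp
  · intro c r hr
    have h2 := h1 (c - r) (c + r) (by linarith)
    rw [← Real.closedBall_eq_Icc, Real.restrict_closedBall_eq_ball] at h2
    rw [show c + r - (c - r) = 2 * r by ring] at h2
    exact h2

/-! ### Measurability and passage from lines to the plane. -/

/-- Truncations are continuous from the right in `ε`, because the strict condition `ε < |t|` is the
union of those for larger thresholds. Rational truncations therefore decide convergence. -/
theorem tendsto_truncHilbert_of_antitone {g : ℝ → ℂ} {x ε : ℝ} {u : ℕ → ℝ} (hu : Antitone u)
    (hlt : ∀ n, ε < u n) (hlim : Tendsto u atTop (𝓝 ε))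
    (hi : IntegrableOn (fun t : ℝ => g (x - t) / (t : ℂ)) {t : ℝ | ε < |t|}) :
    Tendsto (fun n => truncHilbert (u n) g x) atTop (𝓝 (truncHilbert ε g x)) := by
  have hU : ⋃ n, {t : ℝ | u n < |t|} = {t : ℝ | ε < |t|} := by
    ext t
    simp only [Set.mem_iUnion, Set.mem_ofPred_eq]
    exact ⟨fun ⟨n, hn⟩ => (hlt n).trans hn, fun ht => (hlim.eventually (gt_mem_nhds ht)).exists⟩
  have h := tendsto_setIntegral_of_monotone (fun n => measurableSet_lt_abs (u n))
    (fun m n hmn t ht => (hu hmn).trans_lt ht) (hU ▸ hi)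
  rwa [hU] at h

/-- A criterion for the existence of principal values in terms of countably many truncations. -/
theorem exists_hasHilbertPV_iff {g : ℝ → ℂ} {x : ℝ} : (∃ L, HasHilbertPV g x L) ↔
    (∀ n : ℕ, IntegrableOn (fun t : ℝ => g (x - t) / (t : ℂ)) {t : ℝ | 1 / ((n : ℝ) + 1) < |t|}) ∧
    ∀ k : ℕ, ∃ m : ℕ, ∀ q q' : ℚ, (0 < q ∧ q < 1 / ((m : ℝ) + 1)) → (0 < q' ∧ q' < 1 / ((m : ℝ) + 1)) →
      ‖truncHilbert q g x - truncHilbert q' g x‖ ≤ 1 / ((k : ℝ) + 1) := by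
  constructor
  · rintro ⟨L, hi, hL⟩
    refine ⟨fun n => hi _ (by positivity), fun k => ?_⟩
    have hc := (Metric.cauchy_iff.1 hL.cauchy_map).2 (1 / ((k : ℝ) + 1)) (by positivity)
    obtain ⟨S, hS, hSd⟩ := hc
    rw [mem_map, mem_nhdsWithin_iff_exists_mem_nhds_inter] at hS
    obtain ⟨V, hV, hVS⟩ := hS
    obtain ⟨η, hη, hηV⟩ := Metric.mem_nhds_iff.1 hV
    obtain ⟨m, hm⟩ := exists_nat_one_div_lt hη
    refine ⟨m, fun q q' hq hq' => ?_⟩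
    have hmem : ∀ q : ℚ, (0 < q ∧ q < 1 / ((m : ℝ) + 1)) → truncHilbert q g x ∈ S := fun q hq => by
      have hq0 : (0 : ℝ) < q := by exact_mod_cast hq.1
      refine hVS ⟨hηV ?_, hq0⟩
      rw [mem_ball, Real.dist_eq, sub_zero, abs_of_pos hq0]
      exact hq.2.trans hm
    rw [← dist_eq_norm]
    exact (hSd _ (hmem q hq) _ (hmem q' hq')).le
  · rintro ⟨hn, hk⟩
    have hi : ∀ ε : ℝ, 0 < ε →
        IntegrableOn (fun t : ℝ => g (x - t) / (t : ℂ)) {t : ℝ | ε < |t|} := fun ε hε => by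
      obtain ⟨m, hm⟩ := exists_nat_one_div_lt hε
      exact (hn m).mono_set fun t ht => hm.trans ht
    suffices h : Cauchy (map (fun ε : ℝ => truncHilbert ε g x) (𝓝[>] 0)) by
      obtain ⟨L, hL⟩ := CompleteSpace.complete h
      exact ⟨L, hi, hL⟩
    refine Metric.cauchy_iff.2 ⟨inferInstance, fun δ hδ => ?_⟩
    obtain ⟨k, hkδ⟩ := exists_nat_one_div_lt hδ
    obtain ⟨m, hm⟩ := hk k
    have hm0 : (0 : ℝ) < 1 / ((m : ℝ) + 1) := by positivity
    refine ⟨_, image_mem_map (Ioo_mem_nhdsGT hm0), ?_⟩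
    rintro _ ⟨ε, hε, rfl⟩ _ ⟨ε', hε', rfl⟩
    refine lt_of_le_of_lt ?_ hkδ
    obtain ⟨u, hu, hul, hut⟩ := Real.exists_seq_rat_strictAnti_tendsto ε
    obtain ⟨v, hv, hvl, hvt⟩ := Real.exists_seq_rat_strictAnti_tendsto ε'
    have h1 := tendsto_truncHilbert_of_antitone (g := g) (x := x) (u := fun n => (u n : ℝ))
      (fun i j hij => Rat.cast_le.2 (hu.antitone hij)) hul hut (hi _ hε.1)
    have h2 := tendsto_truncHilbert_of_antitone (g := g) (x := x) (u := fun n => (v n : ℝ))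
      (fun i j hij => Rat.cast_le.2 (hv.antitone hij)) hvl hvt (hi _ hε'.1)
    rw [dist_eq_norm]
    refine le_of_tendsto (h1.sub h2).norm ?_
    filter_upwards [hut.eventually (gt_mem_nhds hε.2), hvt.eventually (gt_mem_nhds hε'.2)] with n
      hun hvn
    refine hm _ _ ⟨?_, hun⟩ ⟨?_, hvn⟩
    · exact_mod_cast hε.1.trans (hul n)
    · exact_mod_cast hε'.1.trans (hvl n)

section Lines

variable {f g : ℝ × ℝ → ℂ}

theorem stronglyMeasurable_truncated_kernel (hf : StronglyMeasurable f) :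
    StronglyMeasurable fun w : (ℝ × ℝ) × ℝ => f (w.1.1 - w.2, w.1.2) / (w.2 : ℂ) :=
  (hf.measurable.comp (by fun_prop)).stronglyMeasurable.div (by fun_prop)

theorem stronglyMeasurable_truncHilbert (hf : StronglyMeasurable f) (ε : ℝ) :
    StronglyMeasurable fun z : ℝ × ℝ => truncHilbert ε (fun x => f (x, z.2)) z.1 :=
  (stronglyMeasurable_truncated_kernel hf).integral_prod_right'

/-- Tonelli turns "almost every point of almost every line" into "almost every point" only for
measurable sets; the countable criterion provides one. -/
theorem measurableSet_hilbertLineExistsAt (hf : StronglyMeasurable f) :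
    MeasurableSet {z | HilbertLineExistsAt f z} := by
  unfold HilbertLineExistsAt
  simp only [exists_hasHilbertPV_iff]
  rw [measurableSet_setOfPred]
  refine Measurable.and (Measurable.forall fun n => ?_) (Measurable.forall fun k =>
    Measurable.exists fun m => Measurable.forall fun q => Measurable.forall fun q' =>
    Measurable.imp measurable_const (Measurable.imp measurable_const ?_))
  · rw [← measurableSet_setOfPred]
    exact measurableSet_integrable (μ := volume.restrict {t : ℝ | 1 / ((n : ℝ) + 1) < |t|})
      (f := fun (z : ℝ × ℝ) (t : ℝ) => f (z.1 - t, z.2) / (t : ℂ)) (stronglyMeasurable_truncated_kernel hf)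
  · rw [← measurableSet_setOfPred]
    exact measurableSet_le ((stronglyMeasurable_truncHilbert hf q).sub
      (stronglyMeasurable_truncHilbert hf q')).norm.measurable measurable_const

/-- Valid at every `x`, not just almost every one: representatives can be exchanged on a line
without moving any principal value. -/
theorem truncHilbert_congr {g h : ℝ → ℂ} (hgh : g =ᵐ[volume] h) (ε x : ℝ) :
    truncHilbert ε g x = truncHilbert ε h x := by
  rw [truncHilbert_eq, truncHilbert_eq]
  refine integral_congr_ae ?_
  filter_upwards [hgh] with t ht
  rw [ht]

theorem HasHilbertPV.congr {g h : ℝ → ℂ} (hgh : g =ᵐ[volume] h) {x : ℝ} {L : ℂ}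
    (hL : HasHilbertPV g x L) : HasHilbertPV h x L := by
  refine ⟨fun ε hε => (hL.1 ε hε).congr (ae_restrict_of_ae ?_), hL.2.congr fun ε =>
    truncHilbert_congr hgh ε x⟩
  filter_upwards [(quasiMeasurePreserving_sub_left volume x).ae hgh] with t ht
  rw [ht]

theorem hilbert_congr {g h : ℝ → ℂ} (hgh : g =ᵐ[volume] h) (x : ℝ) : hilbert g x = hilbert h x := by
  unfold hilbert
  simp only [truncHilbert_congr hgh]

theorem ae_ae_of_ae_swap {P : ℝ × ℝ → Prop} (h : ∀ᵐ z, P z) : ∀ᵐ y : ℝ, ∀ᵐ x : ℝ, P (x, y) := by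
  have h1 : ∀ᵐ z : ℝ × ℝ ∂(volume.prod volume), P z.swap :=
    Measure.measurePreserving_swap.quasiMeasurePreserving.ae h
  exact Measure.ae_ae_of_ae_prod h1

theorem ae_of_ae_ae_swap {P : ℝ × ℝ → Prop} (hP : MeasurableSet {z | P z})
    (h : ∀ᵐ y : ℝ, ∀ᵐ x : ℝ, P (x, y)) : ∀ᵐ z, P z := by
  have hm : MeasurableSet {z : ℝ × ℝ | P z.swap} := hP.preimage measurable_swap
  have h1 : ∀ᵐ z : ℝ × ℝ ∂(volume.prod volume), P z.swap := (Measure.ae_prod_iff_ae_ae hm).2 h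
  have h2 := Measure.measurePreserving_swap.quasiMeasurePreserving.ae h1
  exact h2

theorem ae_snd {P : ℝ → Prop} (h : ∀ᵐ y, P y) : ∀ᵐ z : ℝ × ℝ, P z.2 :=
  Measure.quasiMeasurePreserving_snd.ae h

theorem ae_slice_eq (h : f =ᵐ[volume] g) :
    ∀ᵐ z : ℝ × ℝ, (fun x => f (x, z.2)) =ᵐ[volume] fun x => g (x, z.2) :=
  ae_snd (ae_ae_of_ae_swap h)

theorem hilbertLine_congr (h : f =ᵐ[volume] g) : hilbertLine f =ᵐ[volume] hilbertLine g := by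
  filter_upwards [ae_slice_eq h] with z hz
  exact hilbert_congr hz _

/-- The measurability argument is run for a strongly measurable representative, and the result
transferred back along almost every line. -/
theorem ae_hilbertLineExistsAt (hf : AEStronglyMeasurable f)
    (h : ∀ᵐ y : ℝ, ∀ᵐ x : ℝ, ∃ L, HasHilbertPV (fun x => f (x, y)) x L) :
    ∀ᵐ z, HilbertLineExistsAt f z := by
  have h1 : ∀ᵐ z, HilbertLineExistsAt (hf.mk f) z := by
    refine ae_of_ae_ae_swap (measurableSet_hilbertLineExistsAt hf.stronglyMeasurable_mk) ?_
    filter_upwards [h, ae_ae_of_ae_swap hf.ae_eq_mk] with y hy hy'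
    filter_upwards [hy] with x ⟨L, hL⟩
    exact ⟨L, hL.congr hy'⟩
  filter_upwards [h1, ae_slice_eq hf.ae_eq_mk] with z ⟨L, hL⟩ hz
  exact ⟨L, hL.congr hz.symm⟩

theorem HilbertLineExistsAt.hasHilbertPV {z : ℝ × ℝ} (h : HilbertLineExistsAt f z) :
    HasHilbertPV (fun x => f (x, z.2)) z.1 (hilbertLine f z) := by
  obtain ⟨L, hL⟩ := h
  rwa [hilbertLine, hL.hilbert_eq]

theorem aestronglyMeasurable_hilbertLine (hf : AEStronglyMeasurable f)
    (h : ∀ᵐ z, HilbertLineExistsAt f z) : AEStronglyMeasurable (hilbertLine f) := by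
  have hδ : Tendsto (fun n : ℕ => 1 / ((n : ℝ) + 1)) atTop (𝓝[>] 0) :=
    tendsto_nhdsWithin_iff.2 ⟨tendsto_one_div_add_atTop_nhds_zero_nat,
      Eventually.of_forall fun n => by simp only [Set.mem_Ioi]; positivity⟩
  refine aestronglyMeasurable_of_tendsto_ae atTop (fun n : ℕ =>
    (stronglyMeasurable_truncHilbert hf.stronglyMeasurable_mk
      (1 / ((n : ℝ) + 1))).aestronglyMeasurable) ?_
  filter_upwards [h, ae_slice_eq hf.ae_eq_mk] with z hz hz'
  exact (hz.hasHilbertPV.congr hz').2.comp hδ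

theorem HasHilbertPV.add {g h : ℝ → ℂ} {x : ℝ} {L M : ℂ} (hg : HasHilbertPV g x L)
    (hh : HasHilbertPV h x M) : HasHilbertPV (fun t => g t + h t) x (L + M) := by
  refine ⟨fun ε hε => ?_, (hg.2.add hh.2).congr' ?_⟩
  · simp only [add_div]
    exact (hg.1 ε hε).add (hh.1 ε hε)
  · filter_upwards [eventually_mem_nhdsWithin] with ε hε
    simp only [truncHilbert, add_div]
    exact (integral_add (hg.1 ε hε) (hh.1 ε hε)).symm

theorem HasHilbertPV.const_mul {g : ℝ → ℂ} {x : ℝ} {L : ℂ} (hg : HasHilbertPV g x L) (a : ℂ) :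
    HasHilbertPV (fun t => a * g t) x (a * L) := by
  refine ⟨fun ε hε => ?_, (hg.2.const_mul a).congr fun ε => ?_⟩
  · simp only [mul_div_assoc]
    exact (hg.1 ε hε).const_mul a
  · simp only [truncHilbert, mul_div_assoc]
    exact (integral_const_mul _ _).symm

end Lines

/-! ### The commutator as an operator on `L^p` of the plane. -/

section Commutator

variable {b f g : ℝ × ℝ → ℂ}

theorem multCommutator_congr (h : f =ᵐ[volume] g) :
    multCommutator b hilbertLine f =ᵐ[volume] multCommutator b hilbertLine g := by
  have h2 : (fun w => b w * f w) =ᵐ[volume] fun w => b w * g w := by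
    filter_upwards [h] with w hw
    rw [hw]
  filter_upwards [hilbertLine_congr h, hilbertLine_congr h2] with z hz hz2
  simp only [multCommutator, hz, hz2]

theorem multCommutator_add (hf : ∀ᵐ z, HilbertLineExistsAt f z) (hg : ∀ᵐ z, HilbertLineExistsAt g z)
    (hbf : ∀ᵐ z, HilbertLineExistsAt (fun w => b w * f w) z)
    (hbg : ∀ᵐ z, HilbertLineExistsAt (fun w => b w * g w) z) :
    multCommutator b hilbertLine (f + g) =ᵐ[volume]
      multCommutator b hilbertLine f + multCommutator b hilbertLine g := by
  filter_upwards [hf, hg, hbf, hbg] with z h1 h2 h3 h4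
  have e1 : hilbertLine (f + g) z = hilbertLine f z + hilbertLine g z :=
    (h1.hasHilbertPV.add h2.hasHilbertPV).hilbert_eq
  have e2 : hilbertLine (fun w => b w * (f + g) w) z =
      hilbertLine (fun w => b w * f w) z + hilbertLine (fun w => b w * g w) z := by
    have h := (h3.hasHilbertPV.add h4.hasHilbertPV).hilbert_eq
    simp only [← mul_add] at h
    exact h
  simp only [multCommutator, Pi.add_apply] at *
  rw [e1, e2]
  ring

theorem multCommutator_const_smul (a : ℂ) (hf : ∀ᵐ z, HilbertLineExistsAt f z)
    (hbf : ∀ᵐ z, HilbertLineExistsAt (fun w => b w * f w) z) :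
    multCommutator b hilbertLine (a • f) =ᵐ[volume] a • multCommutator b hilbertLine f := by
  filter_upwards [hf, hbf] with z h1 h3
  have e1 : hilbertLine (a • f) z = a * hilbertLine f z := (h1.hasHilbertPV.const_mul a).hilbert_eq
  have e2 : hilbertLine (fun w => b w * (a • f) w) z = a * hilbertLine (fun w => b w * f w) z := by
    have h := (h3.hasHilbertPV.const_mul a).hilbert_eq
    simp only [mul_left_comm a] at h
    exact h
  simp only [multCommutator, Pi.smul_apply, smul_eq_mul] at *
  rw [e1, e2]
  ring

theorem ae_aestronglyMeasurable_slice (hf : AEStronglyMeasurable f) :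
    ∀ᵐ y : ℝ, AEStronglyMeasurable fun x => f (x, y) := by
  have h : AEStronglyMeasurable f (volume.prod volume) := hf
  exact h.prod_swap.prodMk_left

theorem lintegral_slices {F : ℝ × ℝ → ℝ≥0∞} (hF : AEMeasurable F) :
    ∫⁻ z, F z = ∫⁻ y : ℝ, ∫⁻ x : ℝ, F (x, y) :=
  lintegral_prod_symm F hF

theorem ae_lintegral_slice_ne_top {F : ℝ × ℝ → ℝ≥0∞} (hF : AEMeasurable F) (h : ∫⁻ z, F z ≠ ∞) :
    ∀ᵐ y : ℝ, ∫⁻ x : ℝ, F (x, y) ≠ ∞ := by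
  rw [lintegral_slices hF] at h
  have hm : AEMeasurable fun y : ℝ => ∫⁻ x : ℝ, F (x, y) := by
    have h' : AEMeasurable F (volume.prod volume) := hF
    exact h'.prod_swap.lintegral_prod_right'
  filter_upwards [ae_lt_top' hm h] with y hy
  exact hy.ne

/-- The one-dimensional theorem holds with one constant on almost every line, and the inequality
between `q`-th powers is integrated in `y`. -/
theorem multCommutator_hilbertLine_bound {q : ℝ} (hq : 1 < q) :
    ∃ C : ℝ≥0, ∀ (b : ℝ × ℝ → ℂ) (β : ℝ≥0), AEStronglyMeasurable b → bmoInftyNorm b ≤ β →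
      ∀ f : ℝ × ℝ → ℂ, MemLp f (ENNReal.ofReal q) →
        (∀ᵐ z, HilbertLineExistsAt f z) ∧ (∀ᵐ z, HilbertLineExistsAt (fun w => b w * f w) z) ∧
        AEStronglyMeasurable (multCommutator b hilbertLine f) ∧
        eLpNorm (multCommutator b hilbertLine f) (ENNReal.ofReal q) volume ≤
          C * β * eLpNorm f (ENNReal.ofReal q) volume := by
  have hq0 : 0 < q := by linarith
  obtain ⟨C, hC⟩ := commutator_hilbert hq
  refine ⟨C ^ (1 / q), fun b β hb hβ f hf => ?_⟩
  obtain ⟨hfm, hfp⟩ := (memLp_ofReal_iff hq0).1 hf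
  have hlines : ∀ᵐ y : ℝ, (∀ᵐ x, ∃ L, HasHilbertPV (fun x => f (x, y)) x L) ∧
      (∀ᵐ x, ∃ L, HasHilbertPV (fun x => b (x, y) * f (x, y)) x L) ∧
      ∫⁻ x, ‖multCommutator b hilbertLine f (x, y)‖ₑ ^ q ≤
        (β : ℝ≥0∞) ^ q * C * ∫⁻ x, ‖f (x, y)‖ₑ ^ q := by
    filter_upwards [ae_aestronglyMeasurable_slice hb, ae_aestronglyMeasurable_slice hfm,
      ae_lintegral_slice_ne_top (hfm.enorm.pow_const q) hfp,
      ENNReal.ae_le_essSup fun y : ℝ => bmoNorm fun x => b (x, y)] with y hby hfy hfpy hβy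
    exact hC _ β (oscBound_of_bmoNorm_le hby (hβy.trans hβ)) _ hfy hfpy
  have hex := ae_hilbertLineExistsAt hfm (hlines.mono fun y hy => hy.1)
  have hexb := ae_hilbertLineExistsAt (hb.mul hfm) (hlines.mono fun y hy => hy.2.1)
  have hm : AEStronglyMeasurable (multCommutator b hilbertLine f) :=
    (hb.mul (aestronglyMeasurable_hilbertLine hfm hex)).sub
      (aestronglyMeasurable_hilbertLine (hb.mul hfm) hexb)
  refine ⟨hex, hexb, hm, ?_⟩
  have hbound : ∫⁻ z, ‖multCommutator b hilbertLine f z‖ₑ ^ q ≤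
      (β : ℝ≥0∞) ^ q * C * ∫⁻ z, ‖f z‖ₑ ^ q := by
    rw [lintegral_slices (hm.enorm.pow_const q), lintegral_slices (hfm.enorm.pow_const q),
      ← lintegral_const_mul' _ _ (ENNReal.mul_ne_top
        (ENNReal.rpow_ne_top_of_nonneg hq0.le ENNReal.coe_ne_top) ENNReal.coe_ne_top)]
    exact lintegral_mono_ae (hlines.mono fun y hy => hy.2.2)
  rw [eLpNorm_ofReal_eq hq0, eLpNorm_ofReal_eq hq0]
  refine (ENNReal.rpow_le_rpow hbound (by positivity)).trans (le_of_eq ?_)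
  rw [ENNReal.mul_rpow_of_nonneg _ _ (by positivity), ENNReal.mul_rpow_of_nonneg _ _ (by positivity),
    ← ENNReal.rpow_mul, mul_one_div_cancel hq0.ne', ENNReal.rpow_one,
    ENNReal.coe_rpow_of_nonneg _ (by positivity), mul_comm (β : ℝ≥0∞)]

end Commutator

theorem mainTheorem8 (p : ℝ≥0∞) [Fact (1 ≤ p)] (hp : 1 < p) (hp_top : p < ∞) :
    ∃ C : ℝ≥0, ∀ b : ℝ × ℝ → ℂ, AEStronglyMeasurable b volume → bmoInftyNorm b < ∞ →
      ∃ T : Lp ℂ p (volume : Measure (ℝ × ℝ)) →L[ℂ] Lp ℂ p (volume : Measure (ℝ × ℝ)),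
        (∀ (f : ℝ × ℝ → ℂ) (hf : MemLp f p volume),
          (∀ᵐ z : ℝ × ℝ, HilbertLineExistsAt f z) ∧
          (∀ᵐ z : ℝ × ℝ, HilbertLineExistsAt (fun w => b w * f w) z) ∧
          (T (hf.toLp f) : ℝ × ℝ → ℂ) =ᵐ[volume] multCommutator b hilbertLine f) ∧
        ‖T‖ ≤ C * (bmoInftyNorm b).toReal := by
  have hpq : p = ENNReal.ofReal p.toReal := (ENNReal.ofReal_toReal hp_top.ne).symm
  have hq : 1 < p.toReal := by
    rw [← ENNReal.toReal_one]
    exact (ENNReal.toReal_lt_toReal (by simp) hp_top.ne).2 hp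
  obtain ⟨C, hC⟩ := multCommutator_hilbertLine_bound hq
  rw [← hpq] at hC
  refine ⟨C, fun b hb hβ => ?_⟩
  set β := (bmoInftyNorm b).toNNReal with hβdef
  replace hC := hC b β hb (ENNReal.coe_toNNReal hβ.ne).ge
  have hmem : ∀ f : ℝ × ℝ → ℂ, MemLp f p → MemLp (multCommutator b hilbertLine f) p := fun f hf =>
    ⟨(hC f hf).2.2.1, (hC f hf).2.2.2.trans_lt
      (ENNReal.mul_lt_top (ENNReal.mul_lt_top ENNReal.coe_lt_top ENNReal.coe_lt_top) hf.2)⟩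
  let T₀ : Lp ℂ p (volume : Measure (ℝ × ℝ)) →ₗ[ℂ] Lp ℂ p (volume : Measure (ℝ × ℝ)) :=
    { toFun := fun F => (hmem F (Lp.memLp F)).toLp _
      -- Additivity holds only where all four principal values exist, hence almost everywhere, which
      -- is enough for classes. The representative of the sum is exchanged for the sum of the
      -- representatives.
      map_add' := fun F G => by
        have hF := hC F (Lp.memLp F)
        have hG := hC G (Lp.memLp G)
        rw [← MemLp.toLp_add]
        exact MemLp.toLp_congr _ _ ((multCommutator_congr (Lp.coeFn_add F G)).trans
          (multCommutator_add hF.1 hG.1 hF.2.1 hG.2.1))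
      map_smul' := fun a F => by
        have hF := hC F (Lp.memLp F)
        rw [RingHom.id_apply, ← MemLp.toLp_const_smul]
        exact MemLp.toLp_congr _ _ ((multCommutator_congr (Lp.coeFn_smul a F)).trans
          (multCommutator_const_smul a hF.1 hF.2.1)) }
  have hT₀ : ∀ F, ‖T₀ F‖ ≤ (C * (bmoInftyNorm b).toReal) * ‖F‖ := fun F => by
    have h := (hC F (Lp.memLp F)).2.2.2
    have h2 := ENNReal.toReal_mono (ENNReal.mul_ne_top (ENNReal.mul_ne_top ENNReal.coe_ne_top
      ENNReal.coe_ne_top) (Lp.memLp F).2.ne) h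
    rw [ENNReal.toReal_mul, ENNReal.toReal_mul] at h2
    rw [Lp.norm_def F]
    exact (Lp.norm_toLp _ (hmem F (Lp.memLp F))).trans_le h2
  refine ⟨T₀.mkContinuous _ hT₀, fun f hf => ⟨(hC f hf).1, (hC f hf).2.1, ?_⟩,
    T₀.mkContinuous_norm_le (by positivity) hT₀⟩
  exact (MemLp.coeFn_toLp (hmem _ (Lp.memLp _))).trans (multCommutator_congr hf.coeFn_toLp)
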